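/- Let $H$ be a finite-dimensional complex vector space with a non-degenerate symmetric bilinear form $(\cdot,\cdot)$, a vector $\mathbf 1\neq 0$, and a basis $\{\phi_\alpha\}$; let $g_{\alpha\beta}=(\phi_\alpha,\phi_\beta)$, $(g^{\alpha\beta})=(g_{\alpha\beta})^{-1}$, $\phi^\alpha=\sum_\beta g^{\alpha\beta}\phi_\beta$. Let $\mathcal H=H((z^{-1}))$, with symplectic form $\Omega(f,g)=\operatorname{Res}_{z=0}(f(-z),g(z))\,dz$, where $\operatorname{Res}_{z=0}$ is the coefficient of $z^{-1}$, and with Darboux coordinates $p_k^\alpha,q_k^\alpha$ given by $$f=\sum_{k\ge0}\sum_\alpha q_k^\alpha\phi_\alpha z^k+\sum_{k\ge0}\sum_\alpha p_k^\alpha\phi^\alpha(-z)^{-k-1}.$$ *Theories.* For $u\in H$, a formal function near $-\mathbf 1z+u\in H[z]$ is a formal power series in the coordinates $t$ of $q-(-\mathbf 1z+u)$, and $GW_0(u)$ is the set of those formal functions $F$ near $-\mathbf 1z+u$ that satisfy $$\sum_{k,\alpha} q_k^\alpha\partial_{\alpha,k}F=2F,\qquad \sum_{k,\alpha} q_{k+1}^\alpha\partial_{\alpha,k}F=-\tfrac12(q_0,q_0),$$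 $$\partial_{\alpha,k+1}\partial_{\beta,l}\partial_{\gamma,m}F=\sum_{\mu,\nu}\partial_{\alpha,k}\partial_{\mu,0}F\;g^{\mu\nu}\;\partial_{\nu,0}\partial_{\beta,l}\partial_{\gamma,m}F$$ for all $\alpha,\beta,\gamma$ and all $k,l,m\ge0$. For $u=0$ these are the power series in the dilaton shifted variables $q_k^\alpha=t_k^\alpha-\delta_{k,1}\mathbf 1^\alpha$. *Group.* Let $G_-$ be the group of series $S(z)=1+\sum_{i>0}S_iz^{-i}$, $S_i\in\operatorname{End}H$, with $S^*(-z)S(z)=1$, and $\mathfrak g_-=\{\sum_{i>0}a_iz^{-i}:a_i^*=(-1)^{i+1}a_i\}$ its Lie algebra. *Action through cones.* For a formal function $F$ near $-\mathbf 1z+u$, let $\mathcal L_F$ be the graph $\{p_k^\alpha=\partial F/\partial q_k^\alpha\}$ of $dF$. It is a formal germ, described by its points over all commutative $\mathbb C$-algebras $A$: elements of $(A\otimes H)((z^{-1}))$ whose $q$-coordinates differ from those of $-\mathbf 1z+u$ by nilpotent elements of $A$. The element $S\in G_-$ sends $F\in GW_0(u)$ to the $F'\in GW_0(u-S_1\mathbf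 1)$ with $\mathcal L_{F'}=S(\mathcal L_F)$. (So the base point is preserved if $S_1\mathbf 1=0$, in particular if $S_1=0$.) *Action through quantization.* For $a\in\mathfrak g_-$ let $\widehat H_a$ be the quantization of the quadratic Hamiltonian $H_a(f)=\tfrac12\Omega(af,f)$ by the rule $q_iq_j\mapsto\hbar^{-1}q_iq_j$, $q_ip_j\mapsto q_i\partial_j$, $p_ip_j\mapsto\hbar\,\partial_i\partial_j$, where $i,j$ are multi-indices $(\alpha,k)$. For $S=\exp(a)$, $\widehat S=\exp(\widehat H_a)$ acts on total descendent potentials $Z=\exp\left(\sum_{g\ge0}\hbar^{g-1}F_g\right)$ with $F_g$ formal functions near $-\mathbf 1z+u$: $\widehat SZ$ is the value at $\varepsilon=1$ of the solution, in total descendent potentials $Z_\varepsilon$, of $\frac{d}{d\varepsilon}Z_\varepsilon=\widehat H_aZ_\varepsilon$, $Z_0=Z$, where $Z_\varepsilon$ is expanded at the point $-\mathbf 1z+(u-\varepsilon a_1\mathbf 1)$, which is the image of $-\mathbf 1z+u$ under the flow of the vector field $q(z)\mapsto[a(z)q(z)]_+$ on $H[z]$ (with $[\;\cdot\;]_+$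 the part of non-negative powers of $z$). **Theorem.** Let $u\in H$, $S\in G_-$ and $F\in GW_0(u)$. 1. There is a unique $F'\in GW_0(u-S_1\mathbf 1)$ with $\mathcal L_{F'}=S(\mathcal L_F)$. 2. For every total descendent potential $Z$ with genus zero part $F$, the potential $\widehat SZ$ exists and is unique, and its genus zero part is this $F'$. In particular that genus zero part depends on $S$ and $F$ only. So the action of $G_-$ defined through Lagrangian cones coincides with the genus zero restriction of the action by quantization of quadratic Hamiltonians. -/

import Mathlib

open scoped TensorProduct

noncomputable section

namespace GenusZero

/-! ### The loop space `H((z⁻¹))` and its symplectic form -/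

/-- `V((z⁻¹))`: Laurent series in `z⁻¹` with coefficients in `V`. The value `f.1 n` is the
coefficient of `zⁿ`; only finitely many positive powers of `z` occur. -/
def Loop (V : Type*) [Zero V] : Type _ :=
  {f : ℤ → V // ∃ N : ℤ, ∀ n : ℤ, N < n → f n = 0}

/-- The action of an operator series `∑_{i ≥ 0} Mᵢ z⁻ⁱ` on `V((z⁻¹))`. The sum is finite. -/
def Loop.act {R V : Type*} [CommRing R] [AddCommGroup V] [Module R V]
    (M : ℕ → Module.End R V) (f : Loop V) : Loop V :=
  ⟨fun n => ∑ᶠ i : ℕ, M i (f.1 (n + i)), by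
    obtain ⟨N, hN⟩ := f.2
    refine ⟨N, fun n hn => ?_⟩
    have h : ∀ i : ℕ, M i (f.1 (n + i)) = 0 := fun i => by
      rw [hN (n + i) (by omega), map_zero]
    simp [h]⟩

section Space

variable {ι H : Type*} [Fintype ι] [DecidableEq ι] [AddCommGroup H] [Module ℂ H]

/-- `Ω(f, g)`, the coefficient of `z⁻¹` in `(f(-z), g(z))`. The sum is finite. -/
def omega (B : LinearMap.BilinForm ℂ H) (f g : Loop H) : ℂ :=
  ∑ᶠ n : ℤ, (-1 : ℂ) ^ n * B (f.1 n) (g.1 (-1 - n))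

/-- The inverse Gram matrix `g^{μν}` of the basis `b`. -/
def gramInv (B : LinearMap.BilinForm ℂ H) (b : Module.Basis ι ℂ H) : Matrix ι ι ℂ :=
  (Matrix.of fun μ ν => B (b μ) (b ν))⁻¹

/-- The dual basis `φ^α = ∑_β g^{αβ} φ_β`. -/
def dualVec (B : LinearMap.BilinForm ℂ H) (b : Module.Basis ι ℂ H) (α : ι) : H :=
  ∑ β, gramInv B b α β • b β

/-- The vector `φ_α zᵏ`, along which the Darboux coordinate `q_k^α` runs. -/
def qVec (b : Module.Basis ι ℂ H) (i : ι × ℕ) : Loop H :=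
  ⟨fun n => if n = (i.2 : ℤ) then b i.1 else 0,
    ⟨i.2, fun n hn => if_neg (by omega)⟩⟩

/-- The vector `φ^α (-z)^{-k-1}`, along which the Darboux coordinate `p_k^α` runs. -/
def pVec (B : LinearMap.BilinForm ℂ H) (b : Module.Basis ι ℂ H) (i : ι × ℕ) : Loop H :=
  ⟨fun n => if n = -(i.2 : ℤ) - 1 then (-1 : ℂ) ^ (i.2 + 1) • dualVec B b i.1 else 0,
    ⟨0, fun n hn => if_neg (by omega)⟩⟩

/-! ### The lower-triangular group and its Lie algebra

A power series over `End H` stands for `∑_{i ≥ 0} Sᵢ z⁻ⁱ`: its variable is `z⁻¹`. -/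

/-- `S*(-z)`, with `*` the adjoint with respect to the pairing. -/
def adjNeg [FiniteDimensional ℂ H] (B : LinearMap.BilinForm ℂ H) (hB : B.Nondegenerate)
    (S : PowerSeries (Module.End ℂ H)) : PowerSeries (Module.End ℂ H) :=
  PowerSeries.mk fun n =>
    (-1 : ℂ) ^ n • B.leftAdjointOfNondegenerate hB (PowerSeries.coeff n S)

/-- The lower-triangular group `G₋`: series `S(z) = 1 + S₁z⁻¹ + S₂z⁻² + ⋯` with
`S*(-z) S(z) = 1`. -/
def lowerGroup [FiniteDimensional ℂ H] (B : LinearMap.BilinForm ℂ H) (hB : B.Nondegenerate) :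
    Set (PowerSeries (Module.End ℂ H)) :=
  {S | PowerSeries.coeff 0 S = 1 ∧ adjNeg B hB S * S = 1}

/-- The Lie algebra `g₋` of `G₋`: series `∑_{i > 0} aᵢ z⁻ⁱ` with `aᵢ* = (-1)^{i+1} aᵢ`. -/
def lowerAlgebra [FiniteDimensional ℂ H] (B : LinearMap.BilinForm ℂ H) (hB : B.Nondegenerate) :
    Set (PowerSeries (Module.End ℂ H)) :=
  {a | PowerSeries.coeff 0 a = 0 ∧ ∀ i : ℕ,
    B.leftAdjointOfNondegenerate hB (PowerSeries.coeff i a) =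
      (-1 : ℂ) ^ (i + 1) • PowerSeries.coeff i a}

/-- The exponential `∑ₙ aⁿ / n!` of a series `a` without constant term (so that only `n ≤ k`
contributes to the coefficient of `z⁻ᵏ`). -/
def expSeries (a : PowerSeries (Module.End ℂ H)) : PowerSeries (Module.End ℂ H) :=
  PowerSeries.mk fun k =>
    ∑ n ∈ Finset.range (k + 1), ((n.factorial : ℂ)⁻¹) • PowerSeries.coeff k (a ^ n)

/-! ### Formal genus zero theories

A formal function near the point `-𝟏z + u` of `H[z]` is a power series in the coordinates
`t = q - (-𝟏z + u)`. For `u = 0` these are power series in the variables `t` of the dilaton shift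
`q_n^α = t_n^α - δ_{n,1} 𝟏^α`. -/

/-- The coordinates `q_k^α` of the base point `-𝟏z + u`. -/
def basePt (b : Module.Basis ι ℂ H) (one u : H) (i : ι × ℕ) : ℂ :=
  if i.2 = 0 then b.repr u i.1 else if i.2 = 1 then -(b.repr one i.1) else 0

/-- The coordinate function `q_k^α`, as a power series at the point with coordinates `x`. -/
def qVar (x : ι × ℕ → ℂ) (i : ι × ℕ) : MvPowerSeries (ι × ℕ) ℂ :=
  MvPowerSeries.C (x i) + MvPowerSeries.X i

/-- The partial derivative `∂/∂q_k^α`. -/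
abbrev pd (i : ι × ℕ) (F : MvPowerSeries (ι × ℕ) ℂ) : MvPowerSeries (ι × ℕ) ℂ :=
  MvPowerSeries.pderiv ℂ i F

/-- The dilaton equation `∑ q_k^α ∂_{α,k} F = 2F`. The infinite sum of power series is taken
coefficient by coefficient, where it is finite. -/
def Dilaton (x : ι × ℕ → ℂ) (F : MvPowerSeries (ι × ℕ) ℂ) : Prop :=
  ∀ m : (ι × ℕ) →₀ ℕ,
    ∑ᶠ i : ι × ℕ, MvPowerSeries.coeff m (qVar x i * pd i F) = 2 * MvPowerSeries.coeff m F

/-- The string equation `∑ q_{k+1}^α ∂_{α,k} F = -½ (q₀, q₀)`, coefficient by coefficient. -/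
def StringEq (B : LinearMap.BilinForm ℂ H) (b : Module.Basis ι ℂ H) (x : ι × ℕ → ℂ)
    (F : MvPowerSeries (ι × ℕ) ℂ) : Prop :=
  ∀ m : (ι × ℕ) →₀ ℕ,
    ∑ᶠ i : ι × ℕ, MvPowerSeries.coeff m (qVar x (i.1, i.2 + 1) * pd i F) =
      -(1 / 2) * MvPowerSeries.coeff m
        (∑ α, ∑ β, MvPowerSeries.C (B (b α) (b β)) * qVar x (α, 0) * qVar x (β, 0))

/-- The genus zero topological recursion relations. -/
def TRR (B : LinearMap.BilinForm ℂ H) (b : Module.Basis ι ℂ H)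
    (F : MvPowerSeries (ι × ℕ) ℂ) : Prop :=
  ∀ (α β γ : ι) (k l m : ℕ),
    pd (α, k + 1) (pd (β, l) (pd (γ, m) F)) =
      ∑ μ, ∑ ν, pd (α, k) (pd (μ, 0) F) * MvPowerSeries.C (gramInv B b μ ν) *
        pd (ν, 0) (pd (β, l) (pd (γ, m) F))

/-- The set `GW₀` of formal genus zero theories, as formal functions near `-𝟏z + u`. -/
def GW0 (B : LinearMap.BilinForm ℂ H) (b : Module.Basis ι ℂ H) (one u : H) :
    Set (MvPowerSeries (ι × ℕ) ℂ) :=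
  {F | Dilaton (basePt b one u) F ∧ StringEq B b (basePt b one u) F ∧ TRR B b F}

/-! ### Lagrangian cones

The graph of `dF` for a formal function `F` near `-𝟏z + u` is a formal germ. It is described by
its points over commutative `ℂ`-algebras `A`: elements of `(A ⊗ H)((z⁻¹))` whose `q`-coordinates
differ from those of the base point by nilpotent elements of `A`. -/

/-- The Darboux coordinate `q_k^α` of a point of `(A ⊗ H)((z⁻¹))`. -/
def qCoord (b : Module.Basis ι ℂ H) (A : Type) [CommRing A] [Algebra ℂ A]
    (f : Loop (A ⊗[ℂ] H)) (i : ι × ℕ) : A :=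
  (b.baseChange A).repr (f.1 i.2) i.1

/-- The Darboux coordinate `p_k^α` of a point of `(A ⊗ H)((z⁻¹))`: the part of negative powers of
`z` is `∑ p_k^α φ^α (-z)^{-k-1}`. -/
def pCoord (B : LinearMap.BilinForm ℂ H) (b : Module.Basis ι ℂ H) (A : Type) [CommRing A]
    [Algebra ℂ A] (f : Loop (A ⊗[ℂ] H)) (i : ι × ℕ) : A :=
  (-1 : A) ^ (i.2 + 1) * (LinearMap.BilinForm.baseChange A B) (f.1 (-(i.2 : ℤ) - 1))
    ((b.baseChange A) i.1)

/-- The value `F(t) ∈ A` of a power series at a finitely supported tuple `t` of nilpotent elements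
of `A`. Only finitely many monomials contribute. -/
def evalNil {A : Type} [CommRing A] [Algebra ℂ A] (F : MvPowerSeries (ι × ℕ) ℂ)
    (t : ι × ℕ → A) : A :=
  ∑ᶠ m : (ι × ℕ) →₀ ℕ,
    algebraMap ℂ A (MvPowerSeries.coeff m F) * m.prod fun i e => t i ^ e

/-- The `A`-points of the cone `L_F`, the graph `p_k^α = ∂F/∂q_k^α` of `dF`. -/
def cone (B : LinearMap.BilinForm ℂ H) (b : Module.Basis ι ℂ H) (one u : H)
    (F : MvPowerSeries (ι × ℕ) ℂ) (A : Type) [CommRing A] [Algebra ℂ A] :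
    Set (Loop (A ⊗[ℂ] H)) :=
  {f | (∀ i, IsNilpotent (qCoord b A f i - algebraMap ℂ A (basePt b one u i))) ∧
    ∀ i, pCoord B b A f i =
      evalNil (pd i F) fun j => qCoord b A f j - algebraMap ℂ A (basePt b one u j)}

/-- The action of `S ∈ G₋` through Lagrangian cones sends `F`, a theory near `-𝟏z + u`, to the
theory `F'` with `L_{F'} = S(L_F)`. Since `[S(z)(-𝟏z + u)]₊ = -𝟏z + u - S₁𝟏`, the function `F'` is
a theory near the point `-𝟏z + (u - S₁𝟏)`. -/
def ConeAction (B : LinearMap.BilinForm ℂ H) (b : Module.Basis ι ℂ H) (one u : H)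
    (S : PowerSeries (Module.End ℂ H)) (F F' : MvPowerSeries (ι × ℕ) ℂ) : Prop :=
  F' ∈ GW0 B b one (u - PowerSeries.coeff 1 S one) ∧
    ∀ (A : Type) [CommRing A] [Algebra ℂ A],
      (Loop.act fun i => (PowerSeries.coeff i S).baseChange A) '' cone B b one u F A =
        cone B b one (u - PowerSeries.coeff 1 S one) F' A

/-! ### Quantization of quadratic Hamiltonians -/

/-- The quadratic Hamiltonian `H_a(f) = ½ Ω(af, f)`. -/
def hamiltonian (B : LinearMap.BilinForm ℂ H) (a : PowerSeries (Module.End ℂ H))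
    (f : Loop H) : ℂ :=
  1 / 2 * omega B (Loop.act (fun i => PowerSeries.coeff i a) f) f

/-- The polarization of `H_a`: the symmetric bilinear form with `H_a(f) = ½ hamPolar(f, f)`. In
Darboux coordinates, with `e_i = qVec i` and `d_i = pVec i`,
`H_a = ½ ∑ hamPolar(e_i, e_j) q_i q_j + ∑ hamPolar(e_i, d_j) q_i p_j
  + ½ ∑ hamPolar(d_i, d_j) p_i p_j`. -/
def hamPolar (B : LinearMap.BilinForm ℂ H) (a : PowerSeries (Module.End ℂ H))
    (f g : Loop H) : ℂ :=
  1 / 2 * (omega B (Loop.act (fun i => PowerSeries.coeff i a) f) g +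
    omega B (Loop.act (fun i => PowerSeries.coeff i a) g) f)

theorem hamiltonian_eq (B : LinearMap.BilinForm ℂ H) (a : PowerSeries (Module.End ℂ H))
    (f : Loop H) : hamiltonian B a f = 1 / 2 * hamPolar B a f f := by
  unfold hamiltonian hamPolar; ring

/-- Laurent series in `ħ` whose coefficients are formal functions on `H[z]` near some point. -/
abbrev HbarSeries (ι : Type*) : Type _ := LaurentSeries (MvPowerSeries (ι × ℕ) ℂ)

/-- The conjugate `e^{-f} ∂_i e^{f} = ∂_i + (∂_i f)` of the partial derivative `∂_i`, acting
on `ħ`-series; it is `∂_i` itself for `f = 0`. -/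
def conjDeriv (f : HbarSeries ι) (i : ι × ℕ) (g : HbarSeries ι) : HbarSeries ι :=
  g.map (MvPowerSeries.pderiv ℂ i) + f.map (MvPowerSeries.pderiv ℂ i) * g

/-- The quantized Hamiltonian, by the rule `q_i q_j ↦ ħ⁻¹ q_i q_j`, `q_i p_j ↦ q_i ∂_j`,
`p_i p_j ↦ ħ ∂_i ∂_j`, conjugated by `e^{f}`: the coefficient of `ħⁿ tᵐ` in
`e^{-f} Ĥ_a (e^{f} g)`, where `t` are the coordinates at the point with `q`-coordinates `x`. -/
def quantHam (B : LinearMap.BilinForm ℂ H) (b : Module.Basis ι ℂ H) (x : ι × ℕ → ℂ)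
    (a : PowerSeries (Module.End ℂ H)) (f g : HbarSeries ι) (n : ℤ) (m : (ι × ℕ) →₀ ℕ) : ℂ :=
  1 / 2 * ∑ᶠ ij : (ι × ℕ) × (ι × ℕ), hamPolar B a (qVec b ij.1) (qVec b ij.2) *
      MvPowerSeries.coeff m (qVar x ij.1 * qVar x ij.2 * g.coeff (n + 1)) +
    ∑ᶠ ij : (ι × ℕ) × (ι × ℕ), hamPolar B a (qVec b ij.1) (pVec B b ij.2) *
      MvPowerSeries.coeff m (qVar x ij.1 * (conjDeriv f ij.2 g).coeff n) +
    1 / 2 * ∑ᶠ ij : (ι × ℕ) × (ι × ℕ), hamPolar B a (pVec B b ij.1) (pVec B b ij.2) *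
      MvPowerSeries.coeff m ((conjDeriv f ij.1 (conjDeriv f ij.2 g)).coeff (n - 1))

/-- `f = ∑_{g ≥ 0} ħ^{g-1} F_g`, the logarithm of a total descendent potential
`exp(ħ⁻¹F₀ + F₁ + ħF₂ + ⋯)`. -/
def IsLogPotential (f : HbarSeries ι) : Prop :=
  ∀ n : ℤ, n < -1 → f.coeff n = 0

/-- The genus `g` part `F_g` of `f = ∑ ħ^{g-1} F_g`. -/
def genusPart (f : HbarSeries ι) (g : ℕ) : MvPowerSeries (ι × ℕ) ℂ :=
  f.coeff ((g : ℤ) - 1)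

/-- `γ` is a solution `Z_ε = exp(γ_ε)` of `dZ_ε/dε = Ĥ_a Z_ε` with `Z_ε` of the form of a
total descendent potential. The base point `-𝟏z + u` moves with the
flow `q ↦ [exp(εa) q]₊` on `H[z]` of the vector field `q ↦ [a q]₊`: the series `γ_ε` is expanded at
`x_ε = -𝟏z + (u - ε a₁𝟏)`, so `exp(γ_ε)` stands for the formal function
`q ↦ exp(γ_ε(q - x_ε))`. At a fixed `q`, the `ε`-derivative of `γ_ε(q - x_ε)` is
`dγ_ε/dε - ∑_α (dx_ε/dε)_0^α ∂_{α,0} γ_ε` with `dx_ε/dε = -a₁𝟏`, and it has to equal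
`e^{-γ_ε} Ĥ_a e^{γ_ε}`. For `a₁𝟏 = 0` the point does not move. -/
def IsQuantumFlow (B : LinearMap.BilinForm ℂ H) (b : Module.Basis ι ℂ H) (one u : H)
    (a : PowerSeries (Module.End ℂ H)) (γ : ℝ → HbarSeries ι) : Prop :=
  ∀ ε : ℝ, IsLogPotential (γ ε) ∧ ∀ (n : ℤ) (m : (ι × ℕ) →₀ ℕ),
    HasDerivAt (fun ε' : ℝ => MvPowerSeries.coeff m ((γ ε').coeff n))
      (quantHam B b (basePt b one (u - (ε : ℂ) • PowerSeries.coeff 1 a one)) a (γ ε) 1 n m +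
        ∑ α, b.repr (-(PowerSeries.coeff 1 a one)) α *
          MvPowerSeries.coeff m (pd (α, 0) ((γ ε).coeff n))) ε

/-- The quantized action of `S ∈ G₋` on total descendent potentials: for `S = exp(a)` with
`a ∈ g₋`, the operator `Ŝ = exp(Ĥ_a)` sends `exp(f)` to `exp(f')`, the time one value of the flow of
`Ĥ_a` that starts at `exp(f)`. Here `f` is expanded at `-𝟏z + u` and `f'` at
`-𝟏z + (u - S₁𝟏)`. -/
def QuantumAction [FiniteDimensional ℂ H] (B : LinearMap.BilinForm ℂ H) (hB : B.Nondegenerate)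
    (b : Module.Basis ι ℂ H) (one u : H) (S : PowerSeries (Module.End ℂ H))
    (f f' : HbarSeries ι) : Prop :=
  ∃ a ∈ lowerAlgebra B hB, expSeries a = S ∧
    ∃ γ : ℝ → HbarSeries ι, IsQuantumFlow B b one u a γ ∧ γ 0 = f ∧ γ 1 = f'

end Space

end GenusZero

end

open scoped TensorProduct

noncomputable section

namespace GenusZero

/-! ### Exponential and logarithm of operator series in z⁻¹. -/

section Exponential

variable {H : Type*} [AddCommGroup H] [Module ℂ H]

open Finset PowerSeries

/-! Both actions are given by one explicit formula. Put R = S*(-z) = S⁻¹ and W(q, q) = Ω([Rq]₊,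
[Rq]₋). Then F'(q) = F([Rq]₊) + ½ W(q, q), which is `transform`.

Cone side. The momenta of Sf are the transpose of q ↦ [Rq]₊ applied to the momenta of f, plus W
applied to the positions of Sf (`pCoord_actBase`). The differential of F' has the same shape, by the
chain rule. Hence the defect p - dF of f and the defect p - dF' of Sf differ by an invertible
matrix, and S carries one cone onto the other (`actBase_mem_cone_iff`). The function F' is again a
theory. The dilaton equation survives because W is homogeneous of degree two. The string equation
survives because W(zf, g) + W(f, zg) has a closed form (`wVec_succ_add`, `string_identity`). In the
recursion relations, the Hessian of W supplies exactly the term that the triangular substitution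
produces in excess (`SatisfiesTRR.subst_mat`). A cone determines dF, since power series are
separated by nilpotent points (`eq_of_evalNil_eq`), and dF determines F through the dilaton
equation.

Quantum side. For S = exp(a) the Hamiltonian has no pp term, so in log Z the flow equation is affine
and each power of ħ evolves by itself: a linear vector field acts on every genus, and a quadratic
source enters genus zero only (`quantHam_add`). In coordinates that move with the base point the
vector field has no constant part. Its solution is the same formula with R = exp(-εa)
(`isQuantumFlow_quantFlow`). It is the only one, because a has no constant term in z⁻¹ and so the
field strictly lowers a weight (`eq_zero_of_flow`). At ε = 1 the genus zero part is F'.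

There are infinitely many variables. Infinite sums are controlled by comparing coefficients only for
monomials of bounded degree in finitely many levels (`Congr`). All matrices are triangular in the
level, so this truncation is compatible with every operation used. -/

theorem coeff_pow_eq_zero_of_lt {E : Type*} [Semiring E] {a : PowerSeries E}
    (ha : coeff 0 a = 0) {n k : ℕ} (h : k < n) : coeff k (a ^ n) = 0 := by
  induction n generalizing k with
  | zero => omega
  | succ n ih =>
    rw [pow_succ, coeff_mul]
    refine sum_eq_zero fun p hp => ?_
    rw [HasAntidiagonal.mem_antidiagonal] at hp
    rcases Nat.eq_zero_or_pos p.2 with h2 | h2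
    · rw [h2, ha, mul_zero]
    · rw [ih (by omega), zero_mul]

theorem coeff_pow_congr {E : Type*} [Semiring E] {a a' : PowerSeries E} {k : ℕ}
    (h : ∀ i < k, coeff i a = coeff i a') (n : ℕ) {i : ℕ} (hi : i < k) :
    coeff i (a ^ n) = coeff i (a' ^ n) := by
  induction n generalizing i with
  | zero => simp
  | succ n ih =>
    rw [pow_succ, pow_succ, coeff_mul, coeff_mul]
    refine sum_congr rfl fun p hp => ?_
    rw [HasAntidiagonal.mem_antidiagonal] at hp
    rw [ih (by omega), h _ (by omega)]

/-- With no constant terms, each of two or more factors that contribute to degree k has degree below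
k. This makes the exponential triangular in the coefficients, hence recursively invertible. -/
theorem coeff_pow_congr_of_two_le {E : Type*} [Semiring E] {a a' : PowerSeries E} {k : ℕ}
    (ha : coeff 0 a = 0) (ha' : coeff 0 a' = 0)
    (h : ∀ i < k, coeff i a = coeff i a') {n : ℕ} (hn : 2 ≤ n) :
    coeff k (a ^ n) = coeff k (a' ^ n) := by
  obtain ⟨n, rfl⟩ : ∃ m, n = m + 1 := ⟨n - 1, by omega⟩
  rw [pow_succ, pow_succ, coeff_mul, coeff_mul]
  refine sum_congr rfl fun p hp => ?_
  rw [HasAntidiagonal.mem_antidiagonal] at hp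
  rcases Nat.eq_zero_or_pos p.2 with h2 | h2
  · rw [h2, ha, ha', mul_zero, mul_zero]
  rcases Nat.eq_zero_or_pos p.1 with h1 | h1
  · rw [h1, coeff_pow_eq_zero_of_lt ha (by omega), coeff_pow_eq_zero_of_lt ha' (by omega),
      zero_mul, zero_mul]
  · rw [coeff_pow_congr h n (by omega), h _ (by omega)]

/-- Powers beyond the k-th start above degree k, so the cut-off is free. Products of exponentials
can then use one common cut-off. -/
theorem coeff_expSeries {a : PowerSeries (Module.End ℂ H)} (ha : coeff 0 a = 0) {k L : ℕ}
    (h : k < L) :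
    coeff k (expSeries a) = ∑ n ∈ range L, ((n.factorial : ℂ)⁻¹) • coeff k (a ^ n) := by
  rw [expSeries, coeff_mk]
  refine sum_subset (range_mono (by omega)) fun n _ hn => ?_
  rw [coeff_pow_eq_zero_of_lt ha (by simpa using hn), smul_zero]

theorem coeff_zero_expSeries (a : PowerSeries (Module.End ℂ H)) : coeff 0 (expSeries a) = 1 := by
  simp [expSeries]

theorem coeff_one_expSeries {a : PowerSeries (Module.End ℂ H)} :
    coeff 1 (expSeries a) = coeff 1 a := by
  simp [expSeries, sum_range_succ, coeff_one]

theorem sum_range_range_eq_sum_antidiagonal {V : Type*} [AddCommMonoid V] {g : ℕ → ℕ → V} {L : ℕ}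
    (hg : ∀ i j, L ≤ i + j → g i j = 0) :
    ∑ i ∈ range L, ∑ j ∈ range L, g i j = ∑ n ∈ range L, ∑ p ∈ antidiagonal n, g p.1 p.2 := by
  have h0 : ∑ p ∈ range L ×ˢ range L with ¬ p.1 + p.2 < L, g p.1 p.2 = 0 :=
    sum_eq_zero fun p hp => hg _ _ (not_lt.1 (mem_filter.1 hp).2)
  rw [← sum_product', sum_sigma', ← sum_filter_add_sum_filter_not (range L ×ˢ range L)
    (fun p => p.1 + p.2 < L), h0, add_zero]
  refine sum_bij' (fun p _ => ⟨p.1 + p.2, p⟩) (fun q _ => q.2) ?_ ?_ ?_ ?_ ?_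
  · rintro ⟨i, j⟩ h
    simp at h ⊢
    omega
  · rintro ⟨n, i, j⟩ h
    simp at h ⊢
    omega
  · simp
  · rintro ⟨n, i, j⟩ h
    simp at h
    obtain ⟨_, rfl⟩ := h
    rfl
  · simp

/-- The binomial theorem. The square of indices i, j ≤ k may be replaced by the triangle i + j ≤ k
because aⁱ⁺ʲ has no coefficient of degree k outside it. -/
theorem expSeries_smul_mul_expSeries_smul {a : PowerSeries (Module.End ℂ H)} (ha : coeff 0 a = 0)
    (s t : ℂ) : expSeries (s • a) * expSeries (t • a) = expSeries ((s + t) • a) := by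
  have h0 : ∀ s : ℂ, coeff 0 (s • a) = 0 := fun s => by simp [ha]
  have hp : ∀ (s : ℂ) (n k : ℕ), coeff k ((s • a) ^ n) = s ^ n • coeff k (a ^ n) := fun s n k => by
    rw [smul_pow]; simp
  ext1 k
  rw [coeff_mul, coeff_expSeries (h0 _) (Nat.lt_succ_self k)]
  calc _ = ∑ p ∈ antidiagonal k, ∑ i ∈ range (k + 1), ∑ j ∈ range (k + 1),
        ((s ^ i / i.factorial) * (t ^ j / j.factorial)) • (coeff p.1 (a ^ i) * coeff p.2 (a ^ j)) := by
        refine sum_congr rfl fun p hpk => ?_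
        rw [HasAntidiagonal.mem_antidiagonal] at hpk
        rw [coeff_expSeries (h0 _) (show p.1 < k + 1 by omega),
          coeff_expSeries (h0 _) (show p.2 < k + 1 by omega), sum_mul_sum]
        refine sum_congr rfl fun i _ => sum_congr rfl fun j _ => ?_
        rw [hp, hp, smul_smul, smul_smul, smul_mul_smul_comm]
        congr 1
        ring
    _ = ∑ i ∈ range (k + 1), ∑ j ∈ range (k + 1),
        ((s ^ i / i.factorial) * (t ^ j / j.factorial)) • coeff k (a ^ (i + j)) := by
        rw [sum_comm]
        refine sum_congr rfl fun i _ => ?_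
        rw [sum_comm]
        refine sum_congr rfl fun j _ => ?_
        rw [pow_add, coeff_mul, smul_sum]
    _ = _ := by
        rw [sum_range_range_eq_sum_antidiagonal]
        · refine sum_congr rfl fun n _ => ?_
          rw [hp, smul_smul, (Commute.all s t).add_pow', mul_sum, sum_smul]
          refine sum_congr rfl fun p hpn => ?_
          rw [HasAntidiagonal.mem_antidiagonal] at hpn
          rw [hpn]
          congr 1
          subst hpn
          rw [Nat.choose_symm_add, Nat.add_choose]
          rw [nsmul_eq_mul, Nat.cast_div (Nat.factorial_mul_factorial_dvd_factorial_add _ _)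
            (by exact_mod_cast mul_ne_zero (Nat.factorial_ne_zero _) (Nat.factorial_ne_zero _))]
          have h1 := Nat.factorial_ne_zero (p.1 + p.2)
          have h2 := Nat.factorial_ne_zero p.1
          have h3 := Nat.factorial_ne_zero p.2
          push_cast
          field_simp
        · intro i j hij
          rw [coeff_pow_eq_zero_of_lt ha (by omega), smul_zero]

theorem expSeries_zero : expSeries (0 : PowerSeries (Module.End ℂ H)) = 1 := by
  ext1 k
  rw [coeff_expSeries (by simp) (Nat.lt_succ_self k), sum_range_succ']
  simp

theorem expSeries_mul_expSeries_neg {a : PowerSeries (Module.End ℂ H)} (ha : coeff 0 a = 0) :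
    expSeries a * expSeries (-a) = 1 := by
  have := expSeries_smul_mul_expSeries_smul ha 1 (-1)
  simpa [expSeries_zero] using this

theorem expSeries_neg_mul_expSeries {a : PowerSeries (Module.End ℂ H)} (ha : coeff 0 a = 0) :
    expSeries (-a) * expSeries a = 1 := by
  have := expSeries_smul_mul_expSeries_smul ha (-1) 1
  simpa [expSeries_zero] using this

/-- Isolates the linear term: what remains depends on lower coefficients of a only. -/
theorem coeff_expSeries_eq_add {a : PowerSeries (Module.End ℂ H)} (ha : coeff 0 a = 0) {k : ℕ}
    (hk : 0 < k) :
    coeff k (expSeries a) = coeff k a +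
      ∑ n ∈ range (k + 1), if 2 ≤ n then ((n.factorial : ℂ)⁻¹) • coeff k (a ^ n) else 0 := by
  obtain ⟨k, rfl⟩ : ∃ m, k = m + 1 := ⟨k - 1, by omega⟩
  rw [coeff_expSeries ha (Nat.lt_succ_self _), sum_range_succ', sum_range_succ',
    sum_range_succ', sum_range_succ']
  have h : ∀ x : ℕ, 2 ≤ x + 1 + 1 := fun x => by omega
  simp [coeff_one, add_comm _ (coeff (k + 1) a), h]

theorem expSeries_injOn {a a' : PowerSeries (Module.End ℂ H)} (ha : coeff 0 a = 0)
    (ha' : coeff 0 a' = 0) (h : expSeries a = expSeries a') : a = a' := by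
  ext1 k
  induction k using Nat.strong_induction_on with
  | _ k ih =>
    rcases Nat.eq_zero_or_pos k with rfl | hk
    · rw [ha, ha']
    · have := congrArg (coeff k) h
      rw [coeff_expSeries_eq_add ha hk, coeff_expSeries_eq_add ha' hk] at this
      rw [sum_congr rfl
        (g := fun n => if 2 ≤ n then ((n.factorial : ℂ)⁻¹) • coeff k (a' ^ n) else 0)] at this
      · exact add_right_cancel this
      · intro n _
        split_ifs with hn
        · rw [coeff_pow_congr_of_two_le ha ha' ih hn]
        · rfl

/-- The coefficients of the logarithm of a series with constant term one. -/
def logCoeff (S : PowerSeries (Module.End ℂ H)) : ℕ → Module.End ℂ H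
  | 0 => 0
  | k + 1 => coeff (k + 1) S - ∑ n ∈ range (k + 2), if 2 ≤ n then ((n.factorial : ℂ)⁻¹) •
      coeff (k + 1) ((PowerSeries.mk fun i => if _h : i < k + 1 then logCoeff S i else 0) ^ n) else 0

theorem exists_expSeries_eq {S : PowerSeries (Module.End ℂ H)} (hS : coeff 0 S = 1) :
    ∃ a : PowerSeries (Module.End ℂ H), coeff 0 a = 0 ∧ expSeries a = S := by
  have ha : coeff 0 (PowerSeries.mk (logCoeff S)) = 0 := by simp [logCoeff]
  refine ⟨PowerSeries.mk (logCoeff S), ha, ?_⟩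
  ext1 k
  rcases k with _ | k
  · rw [coeff_zero_expSeries, hS]
  · rw [coeff_expSeries_eq_add ha (Nat.succ_pos k), coeff_mk, logCoeff, sub_add_eq_add_sub,
      sub_eq_iff_eq_add]
    congr 1
    refine sum_congr rfl fun n _ => ?_
    split_ifs with hn
    -- `logCoeff` recurses through the series cut off below k + 1; for powers from the second on,
    -- the cut-off is not seen in degree k + 1.
    · rw [coeff_pow_congr_of_two_le (k := k + 1) ha
        (a' := PowerSeries.mk fun i => if _h : i < k + 1 then logCoeff S i else 0)
        (by simp [logCoeff]) (fun i hi => by rw [coeff_mk, coeff_mk, dif_pos hi]) hn]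
    · rfl

end Exponential

/-! ### The group, its Lie algebra and the exponential between them. -/

section LowerGroup

variable {H : Type*} [AddCommGroup H] [Module ℂ H] [FiniteDimensional ℂ H]
  (B : LinearMap.BilinForm ℂ H) (hB : B.Nondegenerate)

open Finset PowerSeries

theorem leftAdjoint_apply (φ : Module.End ℂ H) (v w : H) :
    B (B.leftAdjointOfNondegenerate hB φ v) w = B v (φ w) :=
  B.isAdjointPairLeftAdjointOfNondegenerate hB φ v w

theorem leftAdjoint_eq {φ ψ : Module.End ℂ H} (h : ∀ v w, B (ψ v) w = B v (φ w)) :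
    B.leftAdjointOfNondegenerate hB φ = ψ :=
  ((B.isAdjointPair_iff_eq_of_nondegenerate hB ψ φ).1 h).symm

theorem leftAdjoint_one : B.leftAdjointOfNondegenerate hB (1 : Module.End ℂ H) = 1 :=
  leftAdjoint_eq B hB fun _ _ => rfl

theorem leftAdjoint_zero : B.leftAdjointOfNondegenerate hB (0 : Module.End ℂ H) = 0 :=
  leftAdjoint_eq B hB fun _ _ => by simp

theorem leftAdjoint_mul (φ ψ : Module.End ℂ H) :
    B.leftAdjointOfNondegenerate hB (φ * ψ) =
      B.leftAdjointOfNondegenerate hB ψ * B.leftAdjointOfNondegenerate hB φ :=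
  leftAdjoint_eq B hB fun v w => by simp [leftAdjoint_apply]

theorem leftAdjoint_smul (c : ℂ) (φ : Module.End ℂ H) :
    B.leftAdjointOfNondegenerate hB (c • φ) = c • B.leftAdjointOfNondegenerate hB φ :=
  leftAdjoint_eq B hB fun v w => by simp [leftAdjoint_apply]

theorem leftAdjoint_sum {κ : Type*} (s : Finset κ) (φ : κ → Module.End ℂ H) :
    B.leftAdjointOfNondegenerate hB (∑ i ∈ s, φ i) =
      ∑ i ∈ s, B.leftAdjointOfNondegenerate hB (φ i) :=
  leftAdjoint_eq B hB fun v w => by simp [leftAdjoint_apply]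

theorem adjNeg_one : adjNeg B hB (1 : PowerSeries (Module.End ℂ H)) = 1 := by
  ext1 n
  rw [adjNeg, coeff_mk, coeff_one]
  split_ifs with h
  · simp [h, leftAdjoint_one]
  · rw [leftAdjoint_zero, smul_zero]

theorem adjNeg_mul (S T : PowerSeries (Module.End ℂ H)) :
    adjNeg B hB (S * T) = adjNeg B hB T * adjNeg B hB S := by
  ext1 n
  rw [adjNeg, coeff_mk, coeff_mul, leftAdjoint_sum, smul_sum, coeff_mul,
    ← Finset.Nat.sum_antidiagonal_swap]
  refine sum_congr rfl fun p hp => ?_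
  rw [HasAntidiagonal.mem_antidiagonal] at hp
  rw [leftAdjoint_mul, adjNeg, adjNeg, coeff_mk, coeff_mk, smul_mul_smul_comm, ← pow_add, hp]
  rfl

theorem adjNeg_pow (S : PowerSeries (Module.End ℂ H)) (n : ℕ) :
    adjNeg B hB (S ^ n) = adjNeg B hB S ^ n := by
  induction n with
  | zero => simp [adjNeg_one]
  | succ n ih => rw [pow_succ, adjNeg_mul, ih, pow_succ']

theorem adjNeg_expSeries (a : PowerSeries (Module.End ℂ H)) :
    adjNeg B hB (expSeries a) = expSeries (adjNeg B hB a) := by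
  ext1 k
  rw [adjNeg, coeff_mk, expSeries, expSeries, coeff_mk, coeff_mk, leftAdjoint_sum, smul_sum]
  refine sum_congr rfl fun n _ => ?_
  rw [leftAdjoint_smul, smul_comm, ← adjNeg_pow, adjNeg, coeff_mk]

/-- The sign condition is the linearization of S*(-z) S(z) = 1, in a form that can be exponentiated.
-/
theorem mem_lowerAlgebra_iff {a : PowerSeries (Module.End ℂ H)} :
    a ∈ lowerAlgebra B hB ↔ coeff 0 a = 0 ∧ adjNeg B hB a = -a := by
  refine and_congr_right fun _ => ⟨fun h => ?_, fun h i => ?_⟩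
  · ext1 n
    rw [adjNeg, coeff_mk, h, smul_smul, ← pow_add, map_neg, show n + (n + 1) = 2 * n + 1 by ring,
      pow_succ, pow_mul]
    simp
  · have := congrArg (coeff i) h
    rw [adjNeg, coeff_mk, map_neg] at this
    have h2 := congrArg (fun x => (-1 : ℂ) ^ i • x) this
    simp only [smul_smul, ← pow_add, ← two_mul] at h2
    rw [pow_mul] at h2
    simp only [even_two, Even.neg_pow, one_pow, one_smul] at h2
    rw [h2, pow_succ]
    simp

theorem neg_mem_lowerAlgebra {a : PowerSeries (Module.End ℂ H)} (ha : a ∈ lowerAlgebra B hB) :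
    -a ∈ lowerAlgebra B hB := by
  refine ⟨by rw [map_neg, ha.1, neg_zero], fun i => ?_⟩
  rw [map_neg, smul_neg, ← ha.2 i, ← neg_one_smul ℂ, leftAdjoint_smul, neg_one_smul]

theorem smul_mem_lowerAlgebra {a : PowerSeries (Module.End ℂ H)} (ha : a ∈ lowerAlgebra B hB)
    (c : ℂ) : c • a ∈ lowerAlgebra B hB := by
  refine ⟨by rw [coeff_smul, ha.1, smul_zero], fun i => ?_⟩
  rw [coeff_smul, leftAdjoint_smul, ha.2 i, smul_comm]

theorem expSeries_mem_lowerGroup {a : PowerSeries (Module.End ℂ H)}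
    (ha : a ∈ lowerAlgebra B hB) : expSeries a ∈ lowerGroup B hB := by
  rw [mem_lowerAlgebra_iff] at ha
  refine ⟨coeff_zero_expSeries a, ?_⟩
  rw [adjNeg_expSeries, ha.2, expSeries_neg_mul_expSeries ha.1]

theorem adjNeg_expSeries_of_mem {a : PowerSeries (Module.End ℂ H)}
    (ha : a ∈ lowerAlgebra B hB) : adjNeg B hB (expSeries a) = expSeries (-a) := by
  rw [mem_lowerAlgebra_iff] at ha
  rw [adjNeg_expSeries, ha.2]

/-- For S = exp(a), both exp of a*(-z) and exp(-a) are inverse to S. Injectivity of the exponential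
then puts a in the Lie algebra. -/
theorem existsUnique_expSeries_eq {S : PowerSeries (Module.End ℂ H)}
    (hS : S ∈ lowerGroup B hB) : ∃! a, a ∈ lowerAlgebra B hB ∧ expSeries a = S := by
  obtain ⟨a, ha, rfl⟩ := exists_expSeries_eq hS.1
  refine ⟨a, ⟨?_, rfl⟩, fun a' h => expSeries_injOn h.1.1 ha h.2⟩
  rw [mem_lowerAlgebra_iff]
  refine ⟨ha, expSeries_injOn ?_ (by rw [map_neg, ha, neg_zero]) ?_⟩
  · rw [adjNeg, coeff_mk, ha, leftAdjoint_zero, smul_zero]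
  · rw [← adjNeg_expSeries, ← mul_one (adjNeg B hB _), ← expSeries_mul_expSeries_neg ha,
      ← mul_assoc, hS.2, one_mul]

end LowerGroup

section

open Finset MvPowerSeries

/-! ### Truncated comparison of power series in infinitely many variables. -/

section Congruence

variable {σ : Type*}

/-- Two power series agree on the monomials of degree at most `N` in the variables from `s`. -/
def Congr (s : Finset σ) (N : ℕ) (G G' : MvPowerSeries σ ℂ) : Prop :=
  ∀ m : σ →₀ ℕ, m.support ⊆ s → m.degree ≤ N → coeff m G = coeff m G'

variable {s : Finset σ} {N : ℕ} {G G' K K' : MvPowerSeries σ ℂ}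

theorem Congr.refl (s : Finset σ) (N : ℕ) (G : MvPowerSeries σ ℂ) : Congr s N G G :=
  fun _ _ _ => rfl

theorem Congr.of_eq (h : G = G') : Congr s N G G' := h ▸ Congr.refl s N G

theorem Congr.symm (h : Congr s N G G') : Congr s N G' G := fun m hm hN => (h m hm hN).symm

theorem Congr.trans (h : Congr s N G G') (h' : Congr s N G' K) : Congr s N G K :=
  fun m hm hN => (h m hm hN).trans (h' m hm hN)

theorem Congr.add (h : Congr s N G G') (h' : Congr s N K K') : Congr s N (G + K) (G' + K') :=
  fun m hm hN => by rw [map_add, map_add, h m hm hN, h' m hm hN]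

theorem Congr.neg (h : Congr s N G G') : Congr s N (-G) (-G') :=
  fun m hm hN => by rw [map_neg, map_neg, h m hm hN]

theorem Congr.mul (h : Congr s N G G') (h' : Congr s N K K') : Congr s N (G * K) (G' * K') := by
  classical
  intro m hm hN
  rw [coeff_mul, coeff_mul]
  refine sum_congr rfl fun p hp => ?_
  rw [HasAntidiagonal.mem_antidiagonal] at hp
  have h1 : p.1 ≤ m := hp ▸ le_self_add
  have h2 : p.2 ≤ m := hp ▸ le_add_self
  rw [h _ ((Finsupp.support_mono h1).trans hm) ((Finsupp.degree_mono h1).trans hN),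
    h' _ ((Finsupp.support_mono h2).trans hm) ((Finsupp.degree_mono h2).trans hN)]

theorem Congr.sum {κ : Type*} {f g : κ → MvPowerSeries σ ℂ} {r : Finset κ}
    (h : ∀ i ∈ r, Congr s N (f i) (g i)) : Congr s N (∑ i ∈ r, f i) (∑ i ∈ r, g i) :=
  fun m hm hN => by
    rw [map_sum, map_sum]
    exact sum_congr rfl fun i hi => h i hi m hm hN

theorem Congr.pderiv {i : σ} (hi : i ∈ s) (h : Congr s (N + 1) G G') :
    Congr s N (pderiv ℂ i G) (pderiv ℂ i G') := by
  classical
  intro m hm hN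
  rw [coeff_pderiv, coeff_pderiv, h]
  · refine Finsupp.support_add.trans (union_subset hm ?_)
    exact Finsupp.support_single_subset.trans (singleton_subset_iff.2 hi)
  · rw [map_add, Finsupp.degree_single]
    omega

theorem congr_X_zero {i : σ} (hi : i ∉ s) : Congr s N (X i) 0 := by
  classical
  intro m hm _
  rw [coeff_X, if_neg, map_zero]
  rintro rfl
  exact hi (hm (by simp))

/-- Lets identities compatible with truncation be proved for polynomials, by induction on their
construction, and then transferred to power series. -/
theorem exists_mvPolynomial_congr (s : Finset σ) (N : ℕ) (G : MvPowerSeries σ ℂ) :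
    ∃ P : MvPolynomial σ ℂ, Congr s N G P := by
  classical
  refine ⟨∑ m ∈ (range (N + 1)).biUnion (finsuppAntidiag s), MvPolynomial.monomial m (coeff m G),
    fun m hm hN => ?_⟩
  rw [MvPolynomial.coeff_coe, MvPolynomial.coeff_sum]
  simp only [MvPolynomial.coeff_monomial]
  rw [sum_ite_eq', if_pos]
  rw [mem_biUnion]
  refine ⟨m.degree, by rw [mem_range]; omega, ?_⟩
  rw [mem_finsuppAntidiag]
  refine ⟨?_, hm⟩
  rw [Finsupp.degree_apply]
  exact (sum_subset hm fun i _ hi => by simpa using hi).symm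

theorem coeff_X_mul_eq_zero {i : σ} {m : σ →₀ ℕ} (hi : i ∉ m.support)
    (G : MvPowerSeries σ ℂ) : coeff m (X i * G) = 0 := by
  have := (congr_X_zero (N := m.degree) hi).mul (Congr.refl m.support m.degree G) m subset_rfl le_rfl
  rwa [zero_mul, map_zero] at this

/-- The linear form `∑ cᵢ Xᵢ` in possibly infinitely many variables. -/
def linForm (c : σ → ℂ) : MvPowerSeries σ ℂ := fun m => ∑ i ∈ m.support, c i * coeff m (X i)

theorem coeff_linForm (c : σ → ℂ) {m : σ →₀ ℕ} (hs : m.support ⊆ s) :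
    coeff m (linForm c) = ∑ i ∈ s, c i * coeff m (X i) := by
  refine sum_subset hs fun i _ hi => ?_
  rw [← mul_one (X i), coeff_X_mul_eq_zero hi, mul_zero]

theorem linForm_congr (c : σ → ℂ) (s : Finset σ) (N : ℕ) :
    Congr s N (linForm c) (∑ i ∈ s, C (c i) * X i) := by
  intro m hm _
  rw [coeff_linForm c hm, map_sum]
  simp only [coeff_C_mul]

theorem constantCoeff_linForm (c : σ → ℂ) : constantCoeff (linForm c) = 0 := by
  rw [← coeff_zero_eq_constantCoeff_apply, coeff_linForm (s := ∅) c (by simp), sum_empty]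

theorem congr_ext {r : ℕ → Finset σ} (hr : ∀ m : σ →₀ ℕ, ∃ k, ∀ k' ≥ k, m.support ⊆ r k')
    (k₀ : ℕ) (h : ∀ k ≥ k₀, ∀ N, Congr (r k) N G G') : G = G' := by
  ext m
  obtain ⟨k, hk⟩ := hr m
  exact h (max k k₀) (le_max_right _ _) m.degree m (hk _ (le_max_left _ _)) le_rfl

theorem pderiv_linForm (c : σ → ℂ) (i : σ) : pderiv ℂ i (linForm c) = C (c i) := by
  classical
  ext m
  rw [coeff_pderiv, coeff_linForm (s := insert i m.support) c, coeff_C]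
  · have h : ∀ x, coeff (m + Finsupp.single i 1) (X x : MvPowerSeries σ ℂ) =
        if m = 0 ∧ x = i then 1 else 0 := fun x => by
      rw [coeff_X]
      congr 1
      rw [eq_iff_iff]
      constructor
      · intro h
        have hx : i = x := by
          by_contra hne
          have := DFunLike.congr_fun h i
          simp [Ne.symm hne] at this
        subst hx
        exact ⟨by simpa using h, rfl⟩
      · rintro ⟨rfl, rfl⟩
        simp
    simp only [h]
    by_cases hm : m = 0
    · simp [hm]
    · simp [hm]
  · refine Finsupp.support_add.trans (union_subset (subset_insert _ _) ?_)
    exact Finsupp.support_single_subset.trans (by simp)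

end Congruence

/-! ### Triangular linear substitutions and their chain rule. -/

section Substitution

variable {ι : Type*} [Fintype ι]

/-- The coordinates of level below `K`. -/
def lvl (ι : Type*) [Fintype ι] (K : ℕ) : Finset (ι × ℕ) := univ ×ˢ range K

@[simp]
theorem mem_lvl {K : ℕ} {i : ι × ℕ} : i ∈ lvl ι K ↔ i.2 < K := by simp [lvl]

theorem exists_support_subset_lvl (m : ι × ℕ →₀ ℕ) : ∃ k, ∀ k' ≥ k, m.support ⊆ lvl ι k' := by
  refine ⟨m.support.sup Prod.snd + 1, fun k' hk i hi => ?_⟩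
  have := le_sup (f := Prod.snd) hi
  rw [mem_lvl]
  omega

theorem lvl_ext {G G' : MvPowerSeries (ι × ℕ) ℂ} (k₀ : ℕ)
    (h : ∀ k ≥ k₀, ∀ N, Congr (lvl ι k) N G G') : G = G' :=
  congr_ext exists_support_subset_lvl k₀ h

theorem sum_lvl {V : Type*} [AddCommMonoid V] (K : ℕ) (f : ι × ℕ → V) :
    ∑ i ∈ lvl ι K, f i = ∑ k ∈ range K, ∑ α, f (α, k) := by
  rw [lvl, sum_product_right]

/-- A matrix whose `i`-th column is supported in the levels up to that of `i`. -/
def IsLow (M : ι × ℕ → ι × ℕ → ℂ) : Prop := ∀ j i, i.2 < j.2 → M j i = 0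

theorem IsLow.sum_eq {M : ι × ℕ → ι × ℕ → ℂ} (hM : IsLow M) {V : Type*} [AddCommMonoid V]
    {i : ι × ℕ} {K : ℕ} (hi : i.2 < K) {f : ι × ℕ → V} (hf : ∀ j, M j i = 0 → f j = 0) :
    ∑ j ∈ lvl ι (i.2 + 1), f j = ∑ j ∈ lvl ι K, f j := by
  refine sum_subset (fun j hj => ?_) fun j _ hj => hf j (hM _ _ ?_)
  · rw [mem_lvl] at hj ⊢
    omega
  · rw [mem_lvl] at hj
    omega

/-- The substitution `X_j ↦ ∑ᵢ M j i Xᵢ`. -/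
def linSub (M : ι × ℕ → ι × ℕ → ℂ) (j : ι × ℕ) : MvPowerSeries (ι × ℕ) ℂ := linForm (M j)

variable {M : ι × ℕ → ι × ℕ → ℂ}

/-- A variable of high level is replaced by a form in variables of at least that level. Setting the
high variables to zero therefore commutes with the substitution. -/
theorem linSub_congr_zero (hM : IsLow M) {j : ι × ℕ} {K : ℕ} (hj : K ≤ j.2) (N : ℕ) :
    Congr (lvl ι K) N (linSub M j) 0 := by
  refine (linForm_congr _ _ _).trans (Congr.of_eq (sum_eq_zero fun i hi => ?_))
  rw [mem_lvl] at hi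
  rw [hM _ _ (by omega), map_zero, zero_mul]

theorem hasSubst_linSub (hM : IsLow M) : HasSubst (linSub M) where
  const_coeff j := by
    rw [linSub, constantCoeff_linForm]
    exact IsNilpotent.zero
  coeff_zero d := by
    obtain ⟨k, hk⟩ := exists_support_subset_lvl d
    refine (lvl ι k).finite_toSet.subset fun j hj => ?_
    rw [mem_coe, mem_lvl]
    by_contra h
    refine hj ?_
    rw [linSub_congr_zero hM (not_lt.1 h) d.degree d (hk k le_rfl) le_rfl, map_zero]

theorem subst_linSub_sum (hM : IsLow M) {κ : Type*} (r : Finset κ) (f : κ → MvPowerSeries (ι × ℕ) ℂ) :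
    subst (linSub M) (∑ i ∈ r, f i) = ∑ i ∈ r, subst (linSub M) (f i) := by
  simp only [← substAlgHom_apply (hasSubst_linSub hM), map_sum]

/-- A variable of level K or more kills the product modulo the high levels; and since the
substituted forms have no constant term, a monomial of degree exceeding that of m contributes only
in higher order. -/
theorem coeff_prod_linSub_eq_zero (hM : IsLow M) {K : ℕ} {m d : ι × ℕ →₀ ℕ}
    (hm : m.support ⊆ lvl ι K) (h : ¬ (d.support ⊆ lvl ι K ∧ d.degree ≤ m.degree)) :
    coeff m (d.prod fun j e => linSub M j ^ e) = 0 := by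
  classical
  rw [not_and_or] at h
  rcases h with h | h
  · obtain ⟨j, hj, hjK⟩ := not_subset.1 h
    rw [mem_lvl, not_lt] at hjK
    have hd : d j ≠ 0 := by simpa using hj
    rw [Finsupp.prod, ← mul_prod_erase _ _ hj, ← Nat.succ_pred_eq_of_ne_zero hd, pow_succ', mul_assoc,
      (linSub_congr_zero hM hjK m.degree).mul (Congr.refl _ _ _) m hm le_rfl, zero_mul, map_zero]
  · refine coeff_of_lt_order (lt_of_lt_of_le (b := (d.degree : ℕ∞)) ?_ ?_)
    · exact_mod_cast not_le.1 h
    · rw [Finsupp.prod]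
      refine le_trans ?_ (le_order_prod _ _)
      rw [Finsupp.degree_apply, Nat.cast_sum]
      exact sum_le_sum fun j _ => le_order_pow_of_constantCoeff_eq_zero _ (constantCoeff_linForm _)

theorem Congr.subst (hM : IsLow M) {K N : ℕ} {G G' : MvPowerSeries (ι × ℕ) ℂ}
    (h : Congr (lvl ι K) N G G') :
    Congr (lvl ι K) N (subst (linSub M) G) (subst (linSub M) G') := by
  intro m hm hN
  rw [coeff_subst (hasSubst_linSub hM), coeff_subst (hasSubst_linSub hM)]
  refine finsum_congr fun d => ?_
  by_cases hd : d.support ⊆ lvl ι K ∧ d.degree ≤ m.degree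
  · rw [h d hd.1 (hd.2.trans hN)]
  · rw [coeff_prod_linSub_eq_zero hM hm hd, smul_zero, smul_zero]

/-- The chain rule for a triangular linear substitution. -/
theorem pderiv_subst (hM : IsLow M) (i : ι × ℕ) (G : MvPowerSeries (ι × ℕ) ℂ) :
    pderiv ℂ i (subst (linSub M) G) =
      ∑ j ∈ lvl ι (i.2 + 1), C (M j i) * subst (linSub M) (pderiv ℂ j G) := by
  classical
  have hS := hasSubst_linSub hM
  have hP : ∀ P : MvPolynomial (ι × ℕ) ℂ, pderiv ℂ i (subst (linSub M) (P : MvPowerSeries _ ℂ)) =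
      ∑ j ∈ lvl ι (i.2 + 1), C (M j i) * subst (linSub M) (pderiv ℂ j (P : MvPowerSeries _ ℂ)) := by
    intro P
    induction P using MvPolynomial.induction_on with
    | C c =>
      rw [MvPolynomial.coe_C, subst_C, pderiv_C]
      simp only [pderiv_C]
      rw [← map_zero C, subst_C]
      simp
    | add P Q hP hQ =>
      rw [MvPolynomial.coe_add, subst_add hS, map_add, hP, hQ]
      simp only [map_add, subst_add hS, mul_add, sum_add_distrib]
    | mul_X P k hP =>
      rw [MvPolynomial.coe_mul, MvPolynomial.coe_X, subst_mul hS, subst_X hS, Derivation.leibniz,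
        hP, linSub, pderiv_linForm]
      simp only [Derivation.leibniz, subst_add hS, smul_eq_mul, subst_mul hS, subst_X hS, mul_add,
        sum_add_distrib]
      congr 1
      · rw [sum_eq_single k]
        · rw [pderiv_X_self, ← map_one C, subst_C, map_one, mul_one, mul_comm]
        · intro j _ hj
          rw [pderiv_X_of_ne (Ne.symm hj), ← map_zero C, subst_C]
          simp
        · intro hk
          rw [hM k i (by rw [mem_lvl] at hk; omega)]
          simp
      · rw [mul_sum]
        refine sum_congr rfl fun j _ => ?_
        rw [linSub]
        ring
  refine lvl_ext (i.2 + 1) fun K hK N => ?_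
  -- Accuracy N + 1 is needed because differentiation costs one degree.
  obtain ⟨P, hGP⟩ := exists_mvPolynomial_congr (lvl ι K) (N + 1) G
  refine ((hGP.subst hM).pderiv (mem_lvl.2 hK)).trans ((Congr.of_eq (hP P)).trans ?_)
  refine Congr.sum fun j hj => (Congr.refl _ _ _).mul (Congr.subst hM (Congr.pderiv ?_ hGP).symm)
  rw [mem_lvl] at hj ⊢
  omega

theorem pderiv_subst_eq_sum (hM : IsLow M) {i : ι × ℕ} {K : ℕ} (hi : i.2 < K)
    (G : MvPowerSeries (ι × ℕ) ℂ) :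
    pderiv ℂ i (subst (linSub M) G) =
      ∑ j ∈ lvl ι K, C (M j i) * subst (linSub M) (pderiv ℂ j G) := by
  rw [pderiv_subst hM, hM.sum_eq hi]
  intro j hj
  rw [hj, map_zero, zero_mul]

end Substitution

/-! ### Linear vector fields and differentiation along their flows. -/

section Flow

variable {ι : Type*} [Fintype ι]

/-- The linear vector field `∑ A j i Xᵢ ∂_j`. -/
def flowOp (A : ι × ℕ → ι × ℕ → ℂ) (G : MvPowerSeries (ι × ℕ) ℂ) : MvPowerSeries (ι × ℕ) ℂ :=
  fun m => coeff m (∑ i ∈ m.support, X i * ∑ j ∈ lvl ι (i.2 + 1), C (A j i) * pderiv ℂ j G)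

variable {A : ι × ℕ → ι × ℕ → ℂ}

theorem flowOp_congr_sum (hA : IsLow A) (K N : ℕ) (G : MvPowerSeries (ι × ℕ) ℂ) :
    Congr (lvl ι K) N (flowOp A G)
      (∑ i ∈ lvl ι K, X i * ∑ j ∈ lvl ι K, C (A j i) * pderiv ℂ j G) := by
  intro m hm _
  change coeff m (∑ i ∈ m.support, X i * ∑ j ∈ lvl ι (i.2 + 1), C (A j i) * pderiv ℂ j G) = _
  rw [map_sum, map_sum, sum_subset hm fun i _ hi => coeff_X_mul_eq_zero hi _]
  refine sum_congr rfl fun i hi => ?_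
  rw [hA.sum_eq (mem_lvl.1 hi)]
  intro j hj
  rw [hj, map_zero, zero_mul]

theorem Congr.flowOp (hA : IsLow A) {K N : ℕ} {G G' : MvPowerSeries (ι × ℕ) ℂ}
    (h : Congr (lvl ι K) (N + 1) G G') :
    Congr (lvl ι K) N (flowOp A G) (flowOp A G') := by
  refine (flowOp_congr_sum hA K N G).trans (Congr.trans ?_ (flowOp_congr_sum hA K N G').symm)
  exact Congr.sum fun i _ => (Congr.refl _ _ _).mul
    (Congr.sum fun j hj => (Congr.refl _ _ _).mul (h.pderiv hj))

theorem flowOp_add (hA : IsLow A) (G G' : MvPowerSeries (ι × ℕ) ℂ) :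
    flowOp A (G + G') = flowOp A G + flowOp A G' := by
  refine lvl_ext 0 fun K _ N => (flowOp_congr_sum hA K N _).trans
    (Congr.trans (Congr.of_eq ?_) ((flowOp_congr_sum hA K N G).add (flowOp_congr_sum hA K N G')).symm)
  simp only [map_add, mul_add, sum_add_distrib]

theorem flowOp_neg (hA : IsLow A) (G : MvPowerSeries (ι × ℕ) ℂ) :
    flowOp A (-G) = -flowOp A G := by
  refine lvl_ext 0 fun K _ N => (flowOp_congr_sum hA K N _).trans
    (Congr.trans (Congr.of_eq ?_) (flowOp_congr_sum hA K N G).neg.symm)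
  simp only [map_neg, mul_neg, sum_neg_distrib]

theorem flowOp_C (hA : IsLow A) (c : ℂ) : flowOp A (C c) = 0 := by
  refine lvl_ext 0 fun K _ N => (flowOp_congr_sum hA K N _).trans (Congr.of_eq ?_)
  simp

theorem flowOp_mul (hA : IsLow A) (G G' : MvPowerSeries (ι × ℕ) ℂ) :
    flowOp A (G * G') = flowOp A G * G' + G * flowOp A G' := by
  refine lvl_ext 0 fun K _ N => (flowOp_congr_sum hA K N _).trans
    (Congr.trans (Congr.of_eq ?_) (((flowOp_congr_sum hA K N G).mul (Congr.refl _ _ G')).add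
      ((Congr.refl _ _ G).mul (flowOp_congr_sum hA K N G'))).symm)
  simp only [Derivation.leibniz, smul_eq_mul, sum_mul, mul_sum, ← sum_add_distrib]
  refine sum_congr rfl fun i _ => sum_congr rfl fun j _ => ?_
  ring

theorem flowOp_linForm (c : ι × ℕ → ℂ) :
    flowOp A (linForm c) = linForm fun i => ∑ j ∈ lvl ι (i.2 + 1), c j * A j i := by
  ext m
  change coeff m (∑ i ∈ m.support, _) = ∑ i ∈ m.support, _
  rw [map_sum]
  refine sum_congr rfl fun i _ => ?_
  simp only [pderiv_linForm, ← map_mul, ← map_sum]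
  rw [mul_comm, coeff_C_mul]
  simp only [mul_comm]

/-- `Y'` is the derivative at `ε` of the family `Y` of power series, coefficient by coefficient. -/
def HasCoeffDerivAt {σ : Type*} (Y : ℝ → MvPowerSeries σ ℂ) (Y' : MvPowerSeries σ ℂ) (ε : ℝ) :
    Prop :=
  ∀ m, HasDerivAt (fun e => coeff m (Y e)) (coeff m Y') ε

theorem HasCoeffDerivAt.add {σ : Type*} {Y Z : ℝ → MvPowerSeries σ ℂ} {Y' Z' : MvPowerSeries σ ℂ}
    {ε : ℝ} (hY : HasCoeffDerivAt Y Y' ε) (hZ : HasCoeffDerivAt Z Z' ε) :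
    HasCoeffDerivAt (fun e => Y e + Z e) (Y' + Z') ε := fun m => by
  simp only [map_add]
  exact (hY m).fun_add (hZ m)

theorem HasCoeffDerivAt.mul {σ : Type*} {Y Z : ℝ → MvPowerSeries σ ℂ} {Y' Z' : MvPowerSeries σ ℂ}
    {ε : ℝ} (hY : HasCoeffDerivAt Y Y' ε) (hZ : HasCoeffDerivAt Z Z' ε) :
    HasCoeffDerivAt (fun e => Y e * Z e) (Y' * Z ε + Y ε * Z') ε := fun m => by
  classical
  simp only [map_add, coeff_mul, ← sum_add_distrib]
  exact HasDerivAt.fun_sum fun p _ => (hY p.1).mul (hZ p.2)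

theorem HasCoeffDerivAt.const {σ : Type*} (Y : MvPowerSeries σ ℂ) (ε : ℝ) :
    HasCoeffDerivAt (fun _ => Y) 0 ε := fun m => by
  simpa using hasDerivAt_const ε (coeff m Y)

theorem HasCoeffDerivAt.linForm {σ : Type*} {c : ℝ → σ → ℂ} {c' : σ → ℂ} {ε : ℝ}
    (h : ∀ i, HasDerivAt (fun e => c e i) (c' i) ε) :
    HasCoeffDerivAt (fun e => linForm (c e)) (linForm c') ε := fun m => by
  simp only [coeff_linForm _ subset_rfl]
  exact HasDerivAt.fun_sum fun i _ => (h i).mul_const _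

theorem linForm_neg {σ : Type*} (c : σ → ℂ) : linForm (fun i => -c i) = -linForm c := by
  ext m
  simp [coeff_linForm _ subset_rfl]

/-- The derivative of a substitution along a linear flow. -/
theorem hasCoeffDerivAt_subst (hA : IsLow A) {M : ℝ → ι × ℕ → ι × ℕ → ℂ} (hM : ∀ e, IsLow (M e))
    {ε : ℝ} (hd : ∀ j i, HasDerivAt (fun e => M e j i)
      (-∑ k ∈ lvl ι (i.2 + 1), M ε j k * A k i) ε) (G : MvPowerSeries (ι × ℕ) ℂ) :
    HasCoeffDerivAt (fun e => subst (linSub (M e)) G) (-flowOp A (subst (linSub (M ε)) G)) ε := by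
  have hP : ∀ P : MvPolynomial (ι × ℕ) ℂ,
      HasCoeffDerivAt (fun e => subst (linSub (M e)) (P : MvPowerSeries _ ℂ))
        (-flowOp A (subst (linSub (M ε)) (P : MvPowerSeries _ ℂ))) ε := by
    intro P
    induction P using MvPolynomial.induction_on with
    | C c =>
      simp only [MvPolynomial.coe_C, subst_C, flowOp_C hA, neg_zero]
      exact HasCoeffDerivAt.const _ _
    | add P Q hP hQ =>
      simp only [MvPolynomial.coe_add, subst_add (hasSubst_linSub (hM _)), flowOp_add hA, neg_add]
      exact hP.add hQ
    | mul_X P k hP =>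
      simp only [MvPolynomial.coe_mul, MvPolynomial.coe_X, subst_mul (hasSubst_linSub (hM _)),
        flowOp_mul hA, neg_add, subst_X (hasSubst_linSub (hM _)), ← neg_mul]
      rw [neg_mul (subst _ _), ← mul_neg]
      refine hP.mul ?_
      simp only [linSub, flowOp_linForm, ← linForm_neg]
      exact HasCoeffDerivAt.linForm (hd k)
  intro m
  obtain ⟨K, hK⟩ := exists_support_subset_lvl m
  obtain ⟨P, hGP⟩ := exists_mvPolynomial_congr (lvl ι K) (m.degree + 1) G
  -- The polynomial is chosen independently of time, so the whole curve of coefficients is the one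
  -- of a polynomial. The extra degree in its accuracy is for `flowOp`, which differentiates.
  have h1 : ∀ e, coeff m (subst (linSub (M e)) G) =
      coeff m (subst (linSub (M e)) (P : MvPowerSeries _ ℂ)) :=
    fun e => hGP.subst (hM e) m (hK K le_rfl) (by omega)
  simp only [h1]
  rw [(((hGP.subst (hM ε)).flowOp hA).neg m (hK K le_rfl) le_rfl)]
  exact hP P m

end Flow

/-! ### Quadratic functions of infinitely many coordinates. -/

section Quadratic

theorem pderiv_qVar {ι : Type*} [DecidableEq ι] (x : ι × ℕ → ℂ) (i j : ι × ℕ) :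
    pderiv ℂ i (qVar x j) = if j = i then 1 else 0 := by
  rw [qVar, map_add, pderiv_C, zero_add]
  split_ifs with h
  · rw [h, pderiv_X_self]
  · rw [pderiv_X_of_ne h]

theorem coeff_qVar_mul_eq_zero {ι : Type*} {x : ι × ℕ → ℂ} {i : ι × ℕ} (hx : x i = 0) {m : ι × ℕ →₀ ℕ}
    (hi : i ∉ m.support) (G : MvPowerSeries (ι × ℕ) ℂ) : coeff m (qVar x i * G) = 0 := by
  rw [qVar, hx, map_zero, zero_add, coeff_X_mul_eq_zero hi]

variable {ι : Type*} [Fintype ι] [DecidableEq ι]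

/-- The quadratic function `½ ∑ w i j q_i q_j`, expanded at the point `x`, where `x` vanishes on
the levels from two on. -/
def quad (w : ι × ℕ → ι × ℕ → ℂ) (x : ι × ℕ → ℂ) : MvPowerSeries (ι × ℕ) ℂ := fun m =>
  coeff m (C (1 / 2) * ∑ i ∈ lvl ι 2 ∪ m.support, ∑ j ∈ lvl ι 2 ∪ m.support,
    C (w i j) * (qVar x i * qVar x j))

variable {w : ι × ℕ → ι × ℕ → ℂ} {x : ι × ℕ → ℂ}

/-- From level two on, q_i is the bare variable X_i, which can contribute only if it occurs in the
monomial. This makes the infinite quadratic sum finite in each coefficient. -/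
theorem coeff_qVar_mul_qVar_eq_zero (hx : ∀ i, 2 ≤ i.2 → x i = 0) {m : ι × ℕ →₀ ℕ} {i j : ι × ℕ}
    (h : ¬ (i ∈ lvl ι 2 ∪ m.support ∧ j ∈ lvl ι 2 ∪ m.support)) :
    coeff m (qVar x i * qVar x j) = 0 := by
  rw [not_and_or] at h
  simp only [mem_union, mem_lvl, not_or, not_lt] at h
  rcases h with h | h
  · exact coeff_qVar_mul_eq_zero (hx _ h.1) h.2 _
  · rw [mul_comm]
    exact coeff_qVar_mul_eq_zero (hx _ h.1) h.2 _

theorem coeff_quad (hx : ∀ i, 2 ≤ i.2 → x i = 0) {s : Finset (ι × ℕ)} {m : ι × ℕ →₀ ℕ}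
    (hs : lvl ι 2 ∪ m.support ⊆ s) :
    coeff m (quad w x) =
      coeff m (C (1 / 2) * ∑ i ∈ s, ∑ j ∈ s, C (w i j) * (qVar x i * qVar x j)) := by
  change coeff m (C (1 / 2) * ∑ i ∈ lvl ι 2 ∪ m.support, ∑ j ∈ lvl ι 2 ∪ m.support,
    C (w i j) * (qVar x i * qVar x j)) = _
  rw [coeff_C_mul, coeff_C_mul, ← sum_product', ← sum_product', map_sum, map_sum]
  congr 1
  refine sum_subset (product_subset_product hs hs) fun p _ hp => ?_
  rw [coeff_C_mul, coeff_qVar_mul_qVar_eq_zero hx (by simpa only [mem_product] using hp), mul_zero]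

theorem quad_congr (hx : ∀ i, 2 ≤ i.2 → x i = 0) {K : ℕ} (hK : 2 ≤ K) (N : ℕ) :
    Congr (lvl ι K) N (quad w x)
      (C (1 / 2) * ∑ i ∈ lvl ι K, ∑ j ∈ lvl ι K, C (w i j) * (qVar x i * qVar x j)) := by
  intro m hm _
  refine coeff_quad hx (union_subset (fun i hi => ?_) hm)
  rw [mem_lvl] at hi ⊢
  omega

theorem coeff_quad_eq_finsum (hx : ∀ i, 2 ≤ i.2 → x i = 0) (m : ι × ℕ →₀ ℕ) :
    coeff m (quad w x) =
      1 / 2 * ∑ᶠ ij : (ι × ℕ) × (ι × ℕ), w ij.1 ij.2 * coeff m (qVar x ij.1 * qVar x ij.2) := by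
  rw [finsum_eq_sum_of_support_subset
    (s := (lvl ι 2 ∪ m.support) ×ˢ (lvl ι 2 ∪ m.support))]
  · rw [coeff_quad hx subset_rfl, coeff_C_mul, ← sum_product', map_sum]
    simp only [coeff_C_mul]
  · intro p hp
    rw [Finset.mem_coe, mem_product]
    by_contra h
    exact hp (by simp only [coeff_qVar_mul_qVar_eq_zero hx h, mul_zero])

theorem pderiv_quad_congr (hw : ∀ i j, w i j = w j i) (hx : ∀ i, 2 ≤ i.2 → x i = 0) {K : ℕ}
    (hK : 2 ≤ K) {i : ι × ℕ} (hi : i.2 < K) (N : ℕ) :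
    Congr (lvl ι K) N (pderiv ℂ i (quad w x)) (∑ j ∈ lvl ι K, C (w i j) * qVar x j) := by
  refine ((quad_congr hx hK (N + 1)).pderiv (mem_lvl.2 hi)).trans (Congr.of_eq ?_)
  have h2 : ∀ y : MvPowerSeries (ι × ℕ) ℂ, C (1 / 2) * (y + y) = y := fun y => by
    rw [← two_mul, ← mul_assoc, show (2 : MvPowerSeries (ι × ℕ) ℂ) = C 2 from rfl, ← map_mul]
    norm_num
  rw [Derivation.leibniz, pderiv_C, smul_zero, add_zero, smul_eq_mul, map_sum]
  rw [← h2 (∑ j ∈ lvl ι K, C (w i j) * qVar x j)]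
  congr 1
  simp only [map_sum, Derivation.leibniz, pderiv_C, add_zero, pderiv_qVar, smul_eq_mul,
    mul_add, mul_ite, mul_one, mul_zero, sum_add_distrib]
  have hi' := mem_lvl.2 hi
  congr 1
  · simp [hi', hw _ i]
  · rw [sum_comm]
    simp [hi']

theorem pderiv_pderiv_quad (hw : ∀ i j, w i j = w j i) (hx : ∀ i, 2 ≤ i.2 → x i = 0)
    (i j : ι × ℕ) : pderiv ℂ j (pderiv ℂ i (quad w x)) = C (w i j) := by
  refine lvl_ext (i.2 + j.2 + 2) fun K hK N => ?_
  refine ((pderiv_quad_congr hw hx (by omega) (by omega) (N + 1)).pderiv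
    (mem_lvl.2 (by omega))).trans (Congr.of_eq ?_)
  simp only [map_sum, Derivation.leibniz, pderiv_C, add_zero, pderiv_qVar, smul_eq_mul,
    mul_ite, mul_one, mul_zero]
  rw [sum_ite_eq', if_pos (mem_lvl.2 (by omega))]

/-- Write q = x + X and let T(f) be the pairing of f with q under w. The terms -Aᵀw - wA contribute
-2T(Aq), the motion of the base point contributes 2T(Ax), and what is left, -2T(AX), is the vector
field with X, not q, as coefficient. -/
theorem quad_flow_identity {R κ : Type*} [CommRing R] (s : Finset κ) (w A h : κ → κ → R)
    (hw : ∀ i j, w i j = w j i) (x X : κ → R) :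
    ∑ i ∈ s, ∑ j ∈ s, ((h i j - ∑ k ∈ s, A k i * w k j - ∑ k ∈ s, A k j * w i k) *
        ((x i + X i) * (x j + X j)) +
      w i j * ((∑ k ∈ s, A i k * x k) * (x j + X j) + (x i + X i) * ∑ k ∈ s, A j k * x k)) =
    ∑ i ∈ s, ∑ j ∈ s, h i j * ((x i + X i) * (x j + X j)) -
      2 * ∑ i ∈ s, X i * ∑ j ∈ s, A j i * ∑ l ∈ s, w j l * (x l + X l) := by
  set T : (κ → R) → R := fun f => ∑ i ∈ s, ∑ j ∈ s, w i j * (f i * (x j + X j)) with hT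
  have e1 : ∑ i ∈ s, ∑ j ∈ s, (∑ k ∈ s, A k i * w k j) * ((x i + X i) * (x j + X j)) =
      T fun i => ∑ k ∈ s, A i k * (x k + X k) := by
    simp only [hT, sum_mul, mul_sum]
    rw [sum_congr rfl fun i _ => sum_comm, sum_comm]
    refine sum_congr rfl fun k _ => ?_
    rw [sum_comm]
    exact sum_congr rfl fun j _ => sum_congr rfl fun i _ => by ring
  have e2 : ∑ i ∈ s, ∑ j ∈ s, (∑ k ∈ s, A k j * w i k) * ((x i + X i) * (x j + X j)) =
      T fun i => ∑ k ∈ s, A i k * (x k + X k) := by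
    rw [← e1, sum_comm]
    refine sum_congr rfl fun i _ => sum_congr rfl fun j _ => ?_
    rw [mul_comm (x i + X i)]
    simp only [hw j]
  have e3 : ∑ i ∈ s, ∑ j ∈ s, w i j * ((∑ k ∈ s, A i k * x k) * (x j + X j)) =
      T fun i => ∑ k ∈ s, A i k * x k := rfl
  have e4 : ∑ i ∈ s, ∑ j ∈ s, w i j * ((x i + X i) * ∑ k ∈ s, A j k * x k) =
      T fun i => ∑ k ∈ s, A i k * x k := by
    rw [← e3, sum_comm]
    refine sum_congr rfl fun i _ => sum_congr rfl fun j _ => ?_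
    rw [mul_comm (x j + X j), hw]
  have e5 : ∑ i ∈ s, X i * ∑ j ∈ s, A j i * ∑ l ∈ s, w j l * (x l + X l) =
      T fun i => ∑ k ∈ s, A i k * X k := by
    simp only [hT, sum_mul, mul_sum]
    rw [sum_comm]
    refine sum_congr rfl fun k _ => ?_
    rw [sum_comm]
    exact sum_congr rfl fun j _ => sum_congr rfl fun i _ => by ring
  have e6 : (T fun i => ∑ k ∈ s, A i k * (x k + X k)) =
      (T fun i => ∑ k ∈ s, A i k * x k) + T fun i => ∑ k ∈ s, A i k * X k := by
    simp only [hT, mul_add, sum_add_distrib, add_mul]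
    ring
  simp only [sub_mul, add_mul, mul_add, sum_add_distrib, sum_sub_distrib] at *
  linear_combination (-1 : R) * e1 - e2 + e3 + e4 + 2 * e5 - 2 * e6

theorem hasCoeffDerivAt_C {σ : Type*} {c : ℝ → ℂ} {c' : ℂ} {ε : ℝ} (h : HasDerivAt c c' ε) :
    HasCoeffDerivAt (fun e => (C (c e) : MvPowerSeries σ ℂ)) (C c') ε := fun m => by
  classical
  simp only [coeff_C]
  split_ifs
  · exact h
  · exact hasDerivAt_const _ _

theorem HasCoeffDerivAt.sum {σ κ : Type*} {s : Finset κ} {Y : κ → ℝ → MvPowerSeries σ ℂ}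
    {Y' : κ → MvPowerSeries σ ℂ} {ε : ℝ} (h : ∀ k ∈ s, HasCoeffDerivAt (Y k) (Y' k) ε) :
    HasCoeffDerivAt (fun e => ∑ k ∈ s, Y k e) (∑ k ∈ s, Y' k) ε := fun m => by
  simp only [map_sum]
  exact HasDerivAt.fun_sum fun k hk => h k hk m

/-- The derivative of a quadratic function along a linear flow that moves the base point. -/
theorem hasCoeffDerivAt_quad {A h : ι × ℕ → ι × ℕ → ℂ} (hA : IsLow A)
    {w : ℝ → ι × ℕ → ι × ℕ → ℂ} {x : ℝ → ι × ℕ → ℂ} {ε : ℝ} (hw : ∀ i j, w ε i j = w ε j i)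
    (hx : ∀ e i, 2 ≤ i.2 → x e i = 0)
    (hdw : ∀ K i j, i.2 < K → j.2 < K → HasDerivAt (fun e => w e i j)
      (h i j - ∑ k ∈ lvl ι K, A k i * w ε k j - ∑ k ∈ lvl ι K, A k j * w ε i k) ε)
    (hdx : ∀ K ≥ 2, ∀ j, HasDerivAt (fun e => x e j) (∑ i ∈ lvl ι K, A j i * x ε i) ε) :
    HasCoeffDerivAt (fun e => quad (w e) (x e))
      (quad h (x ε) - flowOp A (quad (w ε) (x ε))) ε := by
  intro m
  obtain ⟨k, hk⟩ := exists_support_subset_lvl m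
  set K := max k 2
  have hm : m.support ⊆ lvl ι K := hk _ (le_max_left _ _)
  have hK : 2 ≤ K := le_max_right _ _
  have h1 : ∀ e, coeff m (quad (w e) (x e)) = coeff m (C (1 / 2) * ∑ i ∈ lvl ι K, ∑ j ∈ lvl ι K,
      C (w e i j) * (qVar (x e) i * qVar (x e) j)) := fun e => quad_congr (hx e) hK _ m hm le_rfl
  simp only [h1]
  -- Only the base point moves; the formal variable X i is constant in time.
  have hq : ∀ i, HasCoeffDerivAt (fun e => qVar (x e) i) (C (∑ j ∈ lvl ι K, A i j * x ε j)) ε :=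
    fun i => by
      rw [← add_zero (C _)]
      exact (hasCoeffDerivAt_C (hdx K hK i)).add (HasCoeffDerivAt.const (X i) ε)
  have h2 := (HasCoeffDerivAt.const (C (1 / 2)) ε).mul (HasCoeffDerivAt.sum fun i hi =>
    HasCoeffDerivAt.sum fun j hj => (hasCoeffDerivAt_C (σ := ι × ℕ)
      (hdw K i j (mem_lvl.1 hi) (mem_lvl.1 hj))).mul ((hq i).mul (hq j)))
  refine (h2 m).congr_deriv ?_
  have h3 : Congr (lvl ι K) m.degree (flowOp A (quad (w ε) (x ε))) (∑ i ∈ lvl ι K, X i *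
      ∑ j ∈ lvl ι K, C (A j i) * ∑ l ∈ lvl ι K, C (w ε j l) * qVar (x ε) l) :=
    (flowOp_congr_sum hA K _ _).trans (Congr.sum fun i _ => (Congr.refl _ _ _).mul
      (Congr.sum fun j hj => (Congr.refl _ _ _).mul
        (pderiv_quad_congr hw (hx ε) hK (mem_lvl.1 hj) _)))
  rw [map_sub, quad_congr (hx ε) hK _ m hm le_rfl, h3 m hm le_rfl, ← map_sub]
  congr 1
  have h4 := quad_flow_identity (lvl ι K) (fun i j => C (w ε i j)) (fun i j => C (A i j))
    (fun i j => C (h i j)) (fun i j => congrArg C (hw i j)) (fun i => C (x ε i))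
    (fun i => (X i : MvPowerSeries (ι × ℕ) ℂ))
  have h5 : (C (1 / 2) : MvPowerSeries (ι × ℕ) ℂ) * 2 = 1 := by
    rw [show (2 : MvPowerSeries (ι × ℕ) ℂ) = C 2 from rfl, ← map_mul]
    norm_num
  simp only [qVar, map_sum, map_sub, map_mul, zero_mul, zero_add] at h4 ⊢
  rw [h4, mul_sub, ← mul_assoc _ 2, h5, one_mul]

end Quadratic

end

section

open Finset

/-! ### Matrices of the operators q ↦ [Rq]₊. -/

section Matrix

variable {ι H : Type*} [AddCommGroup H] [Module ℂ H]

/-- The matrix of the operator `q ↦ [R q]₊` on `H[z]`. -/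
def mat (b : Module.Basis ι ℂ H) (R : PowerSeries (Module.End ℂ H)) (j i : ι × ℕ) : ℂ :=
  if j.2 ≤ i.2 then b.repr (PowerSeries.coeff (i.2 - j.2) R (b i.1)) j.1 else 0

variable (b : Module.Basis ι ℂ H) (R : PowerSeries (Module.End ℂ H))

theorem isLow_mat : IsLow (mat b R) := fun _ _ h => if_neg (not_le.2 h)

theorem mat_one [DecidableEq ι] (j i : ι × ℕ) : mat b 1 j i = if j = i then 1 else 0 := by
  rw [mat, PowerSeries.coeff_one]
  split_ifs with h1 h2 h3 h4 h5
  · subst h3; simp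
  · rw [Module.End.one_apply, Module.Basis.repr_self, Finsupp.single_apply, if_neg]
    exact fun h => h3 (Prod.ext h.symm (by omega))
  · subst h4; simp at h2
  · simp
  · subst h5; simp at h1
  · rfl

theorem mat_self_level {R : PowerSeries (Module.End ℂ H)} (hR : PowerSeries.coeff 0 R = 1)
    [DecidableEq ι] (α β : ι) (k : ℕ) : mat b R (β, k) (α, k) = if β = α then 1 else 0 := by
  rw [mat, if_pos le_rfl]
  simp only [Nat.sub_self, hR, Module.End.one_apply, Module.Basis.repr_self, Finsupp.single_apply]
  simp only [eq_comm]

theorem basePt_eq (one u : H) (i : ι × ℕ) :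
    basePt b one u i = b.repr (if i.2 = 0 then u else if i.2 = 1 then -one else 0) i.1 := by
  rw [basePt]
  split_ifs <;> simp

theorem basePt_eq_zero (one u : H) {i : ι × ℕ} (hi : 2 ≤ i.2) : basePt b one u i = 0 := by
  rw [basePt, if_neg (by omega), if_neg (by omega)]

variable [Fintype ι]

/-- Summation against a column of the matrix of `R`. -/
theorem sum_mat_smul {V : Type*} [AddCommGroup V] [Module ℂ V] (f : ℕ → H →ₗ[ℂ] V) (i : ι × ℕ)
    {K : ℕ} (hi : i.2 < K) :
    ∑ j ∈ lvl ι K, mat b R j i • f j.2 (b j.1) =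
      ∑ s ∈ range (i.2 + 1), f (i.2 - s) (PowerSeries.coeff s R (b i.1)) := by
  rw [← (isLow_mat b R).sum_eq hi fun j hj => by rw [hj, zero_smul], sum_lvl, ← sum_range_reflect]
  refine sum_congr rfl fun s hs => ?_
  rw [mem_range] at hs
  simp only [mat]
  rw [show i.2 + 1 - 1 - s = i.2 - s by omega, show i.2 - (i.2 - s) = s by omega]
  conv_rhs => rw [← b.sum_repr (PowerSeries.coeff s R (b i.1)), map_sum]
  refine sum_congr rfl fun α _ => ?_
  rw [if_pos (by omega), map_smul]

/-- Series in z⁻¹ never bring negative powers of z back, so [S[Rq]₊]₊ = [SRq]₊; truncating to levels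
below K loses nothing for a column of level below K. -/
theorem mat_mul (S : PowerSeries (Module.End ℂ H)) (k i : ι × ℕ) {K : ℕ} (hi : i.2 < K) :
    ∑ j ∈ lvl ι K, mat b S k j * mat b R j i = mat b (S * R) k i := by
  have h := sum_mat_smul b R (fun l => if k.2 ≤ l then
    b.coord k.1 ∘ₗ PowerSeries.coeff (l - k.2) S else 0) i hi
  have h2 : ∀ j : ι × ℕ, (if k.2 ≤ j.2 then
      b.coord k.1 ∘ₗ PowerSeries.coeff (j.2 - k.2) S else 0) (b j.1) = mat b S k j := fun j => by
    rw [mat]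
    split_ifs <;> simp
  simp only [h2, smul_eq_mul] at h
  simp only [mul_comm (mat b S k _)]
  rw [h, mat]
  split_ifs with hk
  · rw [PowerSeries.coeff_mul, LinearMap.sum_apply, map_sum, Finsupp.finsetSum_apply,
      ← Finset.Nat.sum_antidiagonal_swap, Finset.Nat.sum_antidiagonal_eq_sum_range_succ_mk]
    symm
    refine sum_subset_zero_on_sdiff (range_mono (by omega)) (fun s hs => ?_) fun s hs => ?_
    · simp only [mem_sdiff, mem_range] at hs
      rw [if_neg (by omega), LinearMap.zero_apply]
    · rw [mem_range] at hs
      rw [if_pos (by omega), show i.2 - s - k.2 = i.2 - k.2 - s by omega]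
      rfl
  · refine sum_eq_zero fun s _ => ?_
    rw [if_neg (by omega), LinearMap.zero_apply]

/-- Summation of a row of the matrix of `R` against the coordinates of a vector. -/
theorem sum_mat_repr (y : ℕ → H) (j : ι × ℕ) (K : ℕ) :
    ∑ i ∈ lvl ι K, mat b R j i * b.repr (y i.2) i.1 =
      b.repr (∑ k ∈ range K, if j.2 ≤ k then PowerSeries.coeff (k - j.2) R (y k) else 0) j.1 := by
  rw [sum_lvl, map_sum, Finsupp.finsetSum_apply]
  refine sum_congr rfl fun k _ => ?_
  simp only [mat]
  split_ifs with h
  · conv_rhs => rw [← b.sum_repr (y k)]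
    rw [map_sum, map_sum, Finsupp.finsetSum_apply]
    refine sum_congr rfl fun α _ => ?_
    rw [map_smul, map_smul, Finsupp.smul_apply, smul_eq_mul, mul_comm]
  · simp

/-- Expands [R(-𝟏z + u)]₊. It covers both group elements, where R₀ = 1 and the base point shifts,
and Lie algebra elements, where R₀ = 0 and only the velocity of that shift remains. -/
theorem sum_mat_basePt (one u : H) (j : ι × ℕ) {K : ℕ} (hK : 2 ≤ K) :
    ∑ i ∈ lvl ι K, mat b R j i * basePt b one u i =
      basePt b (PowerSeries.coeff 0 R one)
        (PowerSeries.coeff 0 R u - PowerSeries.coeff 1 R one) j := by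
  simp only [basePt_eq]
  rw [sum_mat_repr b R (fun k => if k = 0 then u else if k = 1 then -one else 0),
    ← sum_subset (range_mono hK)]
  · congr 2
    rw [sum_range_succ, sum_range_one]
    rcases j with ⟨β, _ | _ | l⟩
    · simp [sub_eq_add_neg]
    · simp
    · simp
  · intro k _ hk
    rw [mem_range] at hk
    rw [if_neg (show ¬ k = 0 by omega), if_neg (show ¬ k = 1 by omega), map_zero, ite_self]

end Matrix

/-! ### The inverse Gram matrix and dual vectors. -/

section Gram

variable {ι H : Type*} [Fintype ι] [DecidableEq ι] [AddCommGroup H] [Module ℂ H]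
  {B : LinearMap.BilinForm ℂ H} (hsymm : B.IsSymm) (hB : B.Nondegenerate)
  (b : Module.Basis ι ℂ H)

include hB in
theorem isUnit_det_gram : IsUnit (Matrix.of fun μ ν => B (b μ) (b ν)).det := by
  have h : (Matrix.of fun μ ν => B (b μ) (b ν)) = LinearMap.BilinForm.toMatrix b B := by
    ext μ ν
    rw [LinearMap.BilinForm.toMatrix_apply]
    rfl
  rw [h, isUnit_iff_ne_zero, ← Matrix.nondegenerate_iff_det_ne_zero]
  exact (LinearMap.BilinForm.nondegenerate_toMatrix_iff b).2 hB

include hB in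
theorem bilin_dualVec_left (β : ι) (v : H) : B (dualVec B b β) v = b.repr v β := by
  conv_lhs => rw [← b.sum_repr v]
  have h : ∀ α, B (dualVec B b β) (b α) = if β = α then 1 else 0 := fun α => by
    have := congrFun (congrFun (Matrix.nonsing_inv_mul _ (isUnit_det_gram hB b)) β) α
    rw [Matrix.mul_apply, Matrix.one_apply] at this
    rw [← this, dualVec, map_sum, LinearMap.sum_apply]
    refine sum_congr rfl fun γ _ => ?_
    rw [map_smul, LinearMap.smul_apply, smul_eq_mul]
    rfl
  simp only [map_sum, map_smul, smul_eq_mul, h]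
  simp

include hsymm hB in
theorem sum_bilin_mul_gramInv (y : H) (ν : ι) :
    ∑ μ, B (b μ) y * gramInv B b μ ν = b.repr y ν := by
  have h : ∀ α, ∑ μ, B (b μ) (b α) * gramInv B b μ ν = if α = ν then 1 else 0 := fun α => by
    have := congrFun (congrFun (Matrix.mul_nonsing_inv _ (isUnit_det_gram hB b)) α) ν
    rw [Matrix.mul_apply, Matrix.one_apply] at this
    rw [← this]
    exact sum_congr rfl fun μ _ => by rw [hsymm.eq]; rfl
  conv_lhs => rw [← b.sum_repr y]
  simp only [map_sum, map_smul, smul_eq_mul, sum_mul]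
  rw [sum_comm]
  simp only [mul_assoc, ← mul_sum, h]
  simp

end Gram

/-! ### The form W = Ω([Rf]₊, [Rg]₋) on H[z]. -/

section WForm

variable {H : Type*} [AddCommGroup H] [Module ℂ H] (B : LinearMap.BilinForm ℂ H)

/-- The coefficients of the quadratic form `Ω([R q]₊, [R q]₋)` on `H[z]`. -/
def wVec (R : PowerSeries (Module.End ℂ H)) (k l : ℕ) (v w : H) : ℂ :=
  ∑ s ∈ range (k + 1), (-1 : ℂ) ^ (k - s) *
    B (PowerSeries.coeff s R v) (PowerSeries.coeff (k + l + 1 - s) R w)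

/-- The shift by one level flips the sign (-1)^{k-s}, so the two sums cancel termwise except for the
last term of the longer one. This drives the string equation. -/
theorem wVec_succ_add (R : PowerSeries (Module.End ℂ H)) (k l : ℕ) (v w : H) :
    wVec B R (k + 1) l v w + wVec B R k (l + 1) v w =
      B (PowerSeries.coeff (k + 1) R v) (PowerSeries.coeff (l + 1) R w) := by
  rw [wVec, wVec, sum_range_succ, add_right_comm, ← sum_add_distrib, sum_eq_zero, zero_add]
  · rw [Nat.sub_self, pow_zero, one_mul, show k + 1 + l + 1 - (k + 1) = l + 1 by omega]
  · intro s hs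
    rw [mem_range] at hs
    rw [show k + 1 - s = k - s + 1 by omega, show k + 1 + l + 1 - s = k + (l + 1) + 1 - s by omega,
      pow_succ]
    ring

theorem wVec_one (k l : ℕ) (v w : H) : wVec B 1 k l v w = 0 := by
  refine sum_eq_zero fun s hs => ?_
  rw [mem_range] at hs
  rw [PowerSeries.coeff_one, PowerSeries.coeff_one, if_neg (show k + l + 1 - s ≠ 0 by omega)]
  simp

variable [FiniteDimensional ℂ H] {B} (hsymm : B.IsSymm) (hB : B.Nondegenerate)

include hsymm in
-- The coefficients of (R(-z)v, R(z)w) = (v, w).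
theorem sum_antidiagonal_pairing {R : PowerSeries (Module.End ℂ H)} (hR : R ∈ lowerGroup B hB)
    (n : ℕ) (v w : H) :
    ∑ p ∈ antidiagonal n, (-1 : ℂ) ^ p.1 *
      B (PowerSeries.coeff p.1 R v) (PowerSeries.coeff p.2 R w) = if n = 0 then B v w else 0 := by
  have h := congrArg (fun S : PowerSeries (Module.End ℂ H) => B (PowerSeries.coeff n S w) v) hR.2
  simp only [PowerSeries.coeff_mul, adjNeg, PowerSeries.coeff_mk, LinearMap.sum_apply, map_sum,
    PowerSeries.coeff_one] at h
  rw [show (if n = 0 then B v w else 0) = B ((if n = 0 then 1 else 0 : Module.End ℂ H) w) v by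
    split_ifs <;> simp [hsymm.eq v w], ← h]
  refine sum_congr rfl fun p _ => ?_
  rw [Module.End.mul_apply, LinearMap.smul_apply, map_smul, LinearMap.smul_apply, smul_eq_mul,
    leftAdjoint_apply, hsymm.eq]

include hsymm in
-- For f, g in H[z], Ω(Rf, Rg) = Ω(f, g) = 0. Splitting into positive and negative parts gives
-- Ω([Rf]₊, [Rg]₋) = -Ω([Rf]₋, [Rg]₊), and antisymmetry of Ω finishes. Concretely, the antidiagonal
-- sum in degree k + l + 1 is cut after index k.
theorem wVec_symm {R : PowerSeries (Module.End ℂ H)} (hR : R ∈ lowerGroup B hB)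
    (k l : ℕ) (v w : H) : wVec B R k l v w = wVec B R l k w v := by
  have h := sum_antidiagonal_pairing hsymm hB hR (k + l + 1) v w
  rw [if_neg (by omega), Finset.Nat.sum_antidiagonal_eq_sum_range_succ_mk,
    show (k + l + 1).succ = (k + 1) + (l + 1) by omega, sum_range_add,
    ← sum_range_reflect _ (l + 1)] at h
  have h1 : ∑ s ∈ range (k + 1), (-1 : ℂ) ^ s * B (PowerSeries.coeff s R v)
      (PowerSeries.coeff (k + l + 1 - s) R w) = (-1) ^ k * wVec B R k l v w := by
    rw [wVec, mul_sum]
    refine sum_congr rfl fun s hs => ?_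
    rw [mem_range] at hs
    obtain ⟨t, rfl⟩ : ∃ t, k = s + t := ⟨k - s, by omega⟩
    rw [← mul_assoc, ← pow_add, show s + t + (s + t - s) = s + 2 * t by omega, pow_add _ s, pow_mul]
    simp
  have h2 : ∑ s ∈ range (l + 1), (-1 : ℂ) ^ (k + 1 + (l + 1 - 1 - s)) *
      B (PowerSeries.coeff (k + 1 + (l + 1 - 1 - s)) R v)
        (PowerSeries.coeff (k + l + 1 - (k + 1 + (l + 1 - 1 - s))) R w) =
      - ((-1) ^ k * wVec B R l k w v) := by
    rw [wVec, mul_sum, ← sum_neg_distrib]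
    refine sum_congr rfl fun s hs => ?_
    rw [mem_range] at hs
    rw [show k + 1 + (l + 1 - 1 - s) = l + k + 1 - s by omega,
      show k + l + 1 - (l + k + 1 - s) = s by omega,
      show l + k + 1 - s = k + (l - s) + 1 by omega, hsymm.eq, pow_succ, pow_add]
    ring
  simp only at h h1 h2
  rw [h1, h2, ← sub_eq_add_neg, sub_eq_zero] at h
  exact mul_left_cancel₀ (pow_ne_zero _ (by norm_num)) h

theorem wVec_zero_left {R : PowerSeries (Module.End ℂ H)} (hR : R ∈ lowerGroup B hB)
    (l : ℕ) (v w : H) : wVec B R 0 l v w = B v (PowerSeries.coeff (l + 1) R w) := by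
  simp [wVec, hR.1]

end WForm

end

section

open Finset MvPowerSeries

/-! ### The transformed potential and the topological recursion relations. -/

section Transform

variable {ι H : Type*} [Fintype ι] [DecidableEq ι] [AddCommGroup H] [Module ℂ H]

/-- The matrix of the quadratic form with coefficients `wVec`. -/
def wMat (B : LinearMap.BilinForm ℂ H) (b : Module.Basis ι ℂ H)
    (R : PowerSeries (Module.End ℂ H)) (i j : ι × ℕ) : ℂ :=
  wVec B R i.2 j.2 (b i.1) (b j.1)

/-- The formal function `q ↦ F([R q]₊) + ½ Ω([R q]₊, [R q]₋)`, expanded at the point `x`. -/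
def transform (B : LinearMap.BilinForm ℂ H) (b : Module.Basis ι ℂ H)
    (R : PowerSeries (Module.End ℂ H)) (x : ι × ℕ → ℂ) (F : MvPowerSeries (ι × ℕ) ℂ) :
    MvPowerSeries (ι × ℕ) ℂ :=
  subst (linSub (mat b R)) F + quad (wMat B b R) x

/-- A direction-wise linear extension of a family indexed by the coordinates. -/
def dirMap {V : Type*} [AddCommGroup V] [Module ℂ V] (b : Module.Basis ι ℂ H) (G : ι × ℕ → V)
    (l : ℕ) : H →ₗ[ℂ] V :=
  ∑ β, (b.coord β).smulRight (G (β, l))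

omit [DecidableEq ι] in
theorem dirMap_apply {V : Type*} [AddCommGroup V] [Module ℂ V] (b : Module.Basis ι ℂ H)
    (G : ι × ℕ → V) (l : ℕ) (v : H) : dirMap b G l v = ∑ β, b.repr v β • G (β, l) := by
  simp [dirMap]

theorem dirMap_basis {V : Type*} [AddCommGroup V] [Module ℂ V] (b : Module.Basis ι ℂ H)
    (G : ι × ℕ → V) (l : ℕ) (β : ι) : dirMap b G l (b β) = G (β, l) := by
  simp [dirMap_apply, Finsupp.single_apply]

variable {B : LinearMap.BilinForm ℂ H} (b : Module.Basis ι ℂ H)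
  {R : PowerSeries (Module.End ℂ H)}

theorem pderiv_subst_mat (α : ι) (k : ℕ) (G : MvPowerSeries (ι × ℕ) ℂ) :
    pderiv ℂ (α, k) (subst (linSub (mat b R)) G) = ∑ s ∈ range (k + 1),
      dirMap b (fun j => subst (linSub (mat b R)) (pderiv ℂ j G)) (k - s)
        (PowerSeries.coeff s R (b α)) := by
  rw [pderiv_subst (isLow_mat b R), ← sum_mat_smul b R _ (α, k) (Nat.lt_succ_self k)]
  refine sum_congr rfl fun j _ => ?_
  rw [dirMap_basis, smul_eq_C_mul]

theorem pderiv_subst_mat_zero (hR : PowerSeries.coeff 0 R = 1) (α : ι)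
    (G : MvPowerSeries (ι × ℕ) ℂ) : pderiv ℂ (α, 0) (subst (linSub (mat b R)) G) =
      subst (linSub (mat b R)) (pderiv ℂ (α, 0) G) := by
  rw [pderiv_subst_mat, sum_range_one, hR, Module.End.one_apply, dirMap_basis]

variable [FiniteDimensional ℂ H] (hsymm : B.IsSymm) (hB : B.Nondegenerate)

include hsymm in
omit [Fintype ι] [DecidableEq ι] in
theorem wMat_symm (hR : R ∈ lowerGroup B hB) (i j : ι × ℕ) : wMat B b R i j = wMat B b R j i :=
  wVec_symm hsymm hB hR _ _ _ _

/-- The recursion `∂_{α,k+1} K = ∑ ∂_{α,k} ∂_{μ,0} F g^{μν} ∂_{ν,0} K`. -/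
def SatisfiesTRR (B : LinearMap.BilinForm ℂ H) (b : Module.Basis ι ℂ H)
    (F K : MvPowerSeries (ι × ℕ) ℂ) : Prop :=
  ∀ (α : ι) (k : ℕ), pderiv ℂ (α, k + 1) K = ∑ μ, ∑ ν,
    pderiv ℂ (α, k) (pderiv ℂ (μ, 0) F) * C (gramInv B b μ ν) * pderiv ℂ (ν, 0) K

omit [FiniteDimensional ℂ H] in
theorem SatisfiesTRR.add {F K K' : MvPowerSeries (ι × ℕ) ℂ} (h : SatisfiesTRR B b F K)
    (h' : SatisfiesTRR B b F K') : SatisfiesTRR B b F (K + K') := fun α k => by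
  simp only [map_add, h α k, h' α k, mul_add, sum_add_distrib]

omit [FiniteDimensional ℂ H] in
theorem SatisfiesTRR.const (F : MvPowerSeries (ι × ℕ) ℂ) (c : ℂ) :
    SatisfiesTRR B b F (C c) := fun α k => by
  simp

omit [FiniteDimensional ℂ H] in
theorem SatisfiesTRR.C_mul {F K : MvPowerSeries (ι × ℕ) ℂ} (h : SatisfiesTRR B b F K) (c : ℂ) :
    SatisfiesTRR B b F (C c * K) := fun α k => by
  simp only [Derivation.leibniz, pderiv_C, mul_zero, add_zero, smul_eq_mul, h α k, mul_sum]
  refine sum_congr rfl fun μ _ => sum_congr rfl fun ν _ => ?_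
  ring

omit [FiniteDimensional ℂ H] in
theorem SatisfiesTRR.sum {κ : Type*} {s : Finset κ} {F : MvPowerSeries (ι × ℕ) ℂ}
    {K : κ → MvPowerSeries (ι × ℕ) ℂ} (h : ∀ i ∈ s, SatisfiesTRR B b F (K i)) :
    SatisfiesTRR B b F (∑ i ∈ s, K i) := by
  classical
  induction s using Finset.induction_on with
  | empty => simpa using SatisfiesTRR.const b F 0
  | insert i s hi ih =>
    rw [sum_insert hi]
    exact (h i (mem_insert_self _ _)).add b (ih fun j hj => h j (mem_insert_of_mem hj))

include hsymm in
-- The chain rule writes ∂_{α,k+1} as a sum of derivatives along R_sφ_α at level k + 1 - s. For s ≤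
-- k the level is positive and the recursion for K applies. The term s = k + 1 sits at level zero,
-- where no recursion is available; it is produced by the Hessian of the quadratic part of the new
-- potential.
theorem SatisfiesTRR.subst_mat (hR : R ∈ lowerGroup B hB) {x : ι × ℕ → ℂ}
    (hx : ∀ i, 2 ≤ i.2 → x i = 0) {F K : MvPowerSeries (ι × ℕ) ℂ}
    (hK : SatisfiesTRR B b F K) :
    SatisfiesTRR B b (transform B b R x F) (subst (linSub (mat b R)) K) := by
  intro α k
  set φ : MvPowerSeries (ι × ℕ) ℂ → MvPowerSeries (ι × ℕ) ℂ := subst (linSub (mat b R)) with hφ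
  have hS := hasSubst_linSub (isLow_mat b R)
  have h1 : ∀ μ, pderiv ℂ (α, k) (pderiv ℂ (μ, 0) (transform B b R x F)) =
      ∑ s ∈ range (k + 1), dirMap b (fun j => φ (pderiv ℂ j (pderiv ℂ (μ, 0) F))) (k - s)
        (PowerSeries.coeff s R (b α)) + C (B (b μ) (PowerSeries.coeff (k + 1) R (b α))) := fun μ => by
    rw [transform, map_add, map_add, pderiv_subst_mat_zero b hR.1, pderiv_subst_mat,
      pderiv_pderiv_quad (wMat_symm b hsymm hB hR) hx, wMat, wVec_zero_left hB hR]
  have h3 : ∀ ν, pderiv ℂ (ν, 0) (φ K) = φ (pderiv ℂ (ν, 0) K) :=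
    fun ν => pderiv_subst_mat_zero b hR.1 ν K
  have hK' : ∀ α k, pderiv ℂ (α, k + 1) K = _ := hK
  have h2 : ∀ (l : ℕ) (v : H), dirMap b (fun j => φ (pderiv ℂ j K)) (l + 1) v =
      ∑ μ, ∑ ν, dirMap b (fun j => φ (pderiv ℂ j (pderiv ℂ (μ, 0) F))) l v *
        C (gramInv B b μ ν) * φ (pderiv ℂ (ν, 0) K) := fun l v => by
    simp only [dirMap_apply, hK', hφ, subst_linSub_sum (isLow_mat b R), subst_mul hS, subst_C, sum_mul,
      smul_sum]
    rw [sum_comm]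
    refine sum_congr rfl fun μ _ => ?_
    rw [sum_comm]
    refine sum_congr rfl fun ν _ => sum_congr rfl fun β _ => ?_
    simp only [smul_eq_C_mul]
    ring
  rw [pderiv_subst_mat, sum_range_succ]
  simp only [h1, h3, add_mul, sum_add_distrib, sum_mul]
  congr 1
  · rw [sum_congr rfl fun μ _ => sum_comm, sum_comm]
    refine sum_congr rfl fun s hs => ?_
    rw [mem_range] at hs
    rw [show k + 1 - s = k - s + 1 by omega, h2]
  -- The level zero term: contracting the Hessian entry (φ_μ, R_{k+1}φ_α) with g^{μν} returns the
  -- coordinates of R_{k+1}φ_α.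
  · rw [sum_comm, Nat.sub_self, dirMap_apply]
    refine sum_congr rfl fun ν _ => ?_
    rw [← sum_bilin_mul_gramInv hsymm hB, smul_eq_C_mul, map_sum, sum_mul]
    simp only [map_mul]
    rfl

include hsymm in
-- For a fixed potential the recursion is linear in the function to which it applies and holds for
-- constants. Second derivatives of the transform are combinations of substituted second derivatives
-- of F and constants from the quadratic part.
theorem TRR.transform (hR : R ∈ lowerGroup B hB) {x : ι × ℕ → ℂ}
    (hx : ∀ i, 2 ≤ i.2 → x i = 0) {F : MvPowerSeries (ι × ℕ) ℂ} (hF : TRR B b F) :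
    TRR B b (transform B b R x F) := by
  intro α β γ k l m
  refine (?_ : SatisfiesTRR B b _ (pderiv ℂ (β, l) (pderiv ℂ (γ, m) (GenusZero.transform B b R x F))))
    α k
  have h : pderiv ℂ (β, l) (pderiv ℂ (γ, m) (GenusZero.transform B b R x F)) =
      ∑ j ∈ lvl ι (m + 1), C (mat b R j (γ, m)) * ∑ i ∈ lvl ι (l + 1), C (mat b R i (β, l)) *
        subst (linSub (mat b R)) (pderiv ℂ i (pderiv ℂ j F)) +
      C (wMat B b R (γ, m) (β, l)) := by
    rw [GenusZero.transform, map_add, map_add, pderiv_pderiv_quad (wMat_symm b hsymm hB hR) hx,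
      pderiv_subst (isLow_mat b R), map_sum]
    congr 1
    refine sum_congr rfl fun j _ => ?_
    rw [Derivation.leibniz, pderiv_C, smul_zero, add_zero, smul_eq_mul, pderiv_subst (isLow_mat b R)]
  rw [h]
  refine SatisfiesTRR.add b (SatisfiesTRR.sum b fun j _ => SatisfiesTRR.C_mul b
    (SatisfiesTRR.sum b fun i _ => SatisfiesTRR.C_mul b ?_ _) _) (SatisfiesTRR.const b _ _)
  exact SatisfiesTRR.subst_mat b hsymm hB hR hx fun α k => hF α i.1 j.1 k i.2 j.2

end Transform

/-! ### Finite truncations of the dilaton and string sums. -/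

section Linear

variable {ι : Type*} [Fintype ι]

theorem coeff_qVar_mul_lvl {x : ι × ℕ → ℂ} (hx : ∀ i, 2 ≤ i.2 → x i = 0) {K : ℕ} (hK : 2 ≤ K)
    {m : ι × ℕ →₀ ℕ} (hm : m.support ⊆ lvl ι K) {i : ι × ℕ} (hi : K ≤ i.2)
    (G : MvPowerSeries (ι × ℕ) ℂ) : coeff m (qVar x i * G) = 0 :=
  coeff_qVar_mul_eq_zero (hx i (by omega)) (fun h => by
    have := mem_lvl.1 (hm h)
    omega) G

theorem qVar_congr_zero {x : ι × ℕ → ℂ} (hx : ∀ i, 2 ≤ i.2 → x i = 0) {K : ℕ} (hK : 2 ≤ K)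
    {i : ι × ℕ} (hi : K ≤ i.2) (N : ℕ) : Congr (lvl ι K) N (qVar x i) 0 := fun m hm _ => by
  rw [← mul_one (qVar x i), coeff_qVar_mul_lvl hx hK hm hi, map_zero]

theorem finsum_qVar_mul_eq {x : ι × ℕ → ℂ} (hx : ∀ i, 2 ≤ i.2 → x i = 0) {K : ℕ} (hK : 2 ≤ K)
    {m : ι × ℕ →₀ ℕ} (hm : m.support ⊆ lvl ι K) {π : ι × ℕ → ι × ℕ} (hπ : ∀ i, i.2 ≤ (π i).2)
    (G : ι × ℕ → MvPowerSeries (ι × ℕ) ℂ) :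
    ∑ᶠ i, coeff m (qVar x (π i) * G i) = coeff m (∑ i ∈ lvl ι K, qVar x (π i) * G i) := by
  rw [map_sum]
  refine finsum_eq_sum_of_support_subset _ fun i hi => ?_
  rw [mem_coe, mem_lvl]
  by_contra h
  exact hi (coeff_qVar_mul_lvl hx hK hm ((not_lt.1 h).trans (hπ i)) _)

/-- The map π is the identity for the dilaton sum and the level shift for the string sum. -/
theorem finsum_qVar_mul_iff {x : ι × ℕ → ℂ} (hx : ∀ i, 2 ≤ i.2 → x i = 0) {π : ι × ℕ → ι × ℕ}
    (hπ : ∀ i, i.2 ≤ (π i).2) (G : ι × ℕ → MvPowerSeries (ι × ℕ) ℂ) (E : MvPowerSeries (ι × ℕ) ℂ) :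
    (∀ m, ∑ᶠ i, coeff m (qVar x (π i) * G i) = coeff m E) ↔
      ∀ K ≥ 2, ∀ N, Congr (lvl ι K) N (∑ i ∈ lvl ι K, qVar x (π i) * G i) E := by
  constructor
  · intro h K hK N m hm _
    rw [← h, finsum_qVar_mul_eq hx hK hm hπ]
  · intro h m
    obtain ⟨k, hk⟩ := exists_support_subset_lvl m
    have hm := hk (max k 2) (le_max_left _ _)
    rw [finsum_qVar_mul_eq hx (le_max_right _ _) hm hπ]
    exact h _ (le_max_right _ _) _ m hm le_rfl

theorem sum_lvl_shift {V : Type*} [AddCommMonoid V] (K : ℕ) (f : ι × ℕ → V) :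
    ∑ i ∈ lvl ι K, f (i.1, i.2 + 1) + ∑ α, f (α, 0) = ∑ i ∈ lvl ι K, f i + ∑ α, f (α, K) := by
  rw [sum_lvl, sum_lvl, ← sum_range_succ' (fun k => ∑ α, f (α, k)), sum_range_succ]

theorem sum_lvl_shift_of_eq_zero {V : Type*} [AddCommMonoid V] {K : ℕ} {f : ι × ℕ → V}
    (hf : ∀ α, f (α, K) = 0) :
    ∑ i ∈ lvl ι K, f i = ∑ i ∈ lvl ι K, f (i.1, i.2 + 1) + ∑ α, f (α, 0) := by
  rw [sum_lvl_shift, sum_eq_zero (s := univ) fun α _ => hf α, add_zero]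

/-- The string equation for a quadratic form that is symplectically related to a triangular
substitution. -/
theorem string_identity [DecidableEq ι] {V : Type*} [CommRing V] (K : ℕ) (q : ι × ℕ → V)
    (hq : ∀ α, q (α, K) = 0) (g : ι → ι → V) (hg : ∀ α β, g α β = g β α)
    (w : ι × ℕ → ι × ℕ → V) (M : ι → ι × ℕ → V) (hM : ∀ γ α, M γ (α, 0) = if γ = α then 1 else 0)
    (hw : ∀ i α, w i (α, 0) = ∑ δ, g α δ * M δ (i.1, i.2 + 1))
    (hw' : ∀ i j, w i (j.1, j.2 + 1) + w j (i.1, i.2 + 1) =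
      ∑ γ, ∑ δ, g γ δ * (M γ (i.1, i.2 + 1) * M δ (j.1, j.2 + 1))) :
    2 * ∑ i ∈ lvl ι K, ∑ j ∈ lvl ι K, w i j * (q (i.1, i.2 + 1) * q j) +
        ∑ α, ∑ β, g α β * (q (α, 0) * q (β, 0)) =
      ∑ α, ∑ β, g α β * ((∑ i ∈ lvl ι K, M α i * q i) * ∑ i ∈ lvl ι K, M β i * q i) := by
  -- Y is the level zero part of Rq coming from the positive levels, so (Rq)₀ = Y + q₀. The claim is
  -- the expansion of (Y + q₀, Y + q₀): `h3` gives (Y, Y) and `h2` with `h4` the cross terms.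
  set Y : ι → V := fun γ => ∑ i ∈ lvl ι K, M γ (i.1, i.2 + 1) * q (i.1, i.2 + 1) with hY
  have h1 : ∀ γ, ∑ i ∈ lvl ι K, M γ i * q i = Y γ + q (γ, 0) := fun γ => by
    rw [sum_lvl_shift_of_eq_zero fun α => by rw [hq, mul_zero]]
    simp [hM, hY]
  have h2 : ∑ i ∈ lvl ι K, ∑ j ∈ lvl ι K, w i j * (q (i.1, i.2 + 1) * q j) =
      ∑ i ∈ lvl ι K, ∑ j ∈ lvl ι K,
        w i (j.1, j.2 + 1) * (q (i.1, i.2 + 1) * q (j.1, j.2 + 1)) +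
      ∑ α, ∑ β, g α β * (q (α, 0) * Y β) := by
    have h : ∀ i : ι × ℕ, ∑ j ∈ lvl ι K, w i j * (q (i.1, i.2 + 1) * q j) =
        ∑ j ∈ lvl ι K, w i (j.1, j.2 + 1) * (q (i.1, i.2 + 1) * q (j.1, j.2 + 1)) +
        ∑ α, w i (α, 0) * (q (i.1, i.2 + 1) * q (α, 0)) := fun i =>
      sum_lvl_shift_of_eq_zero (f := fun j => w i j * (q (i.1, i.2 + 1) * q j))
        fun α => by rw [hq, mul_zero, mul_zero]
    simp only [h, sum_add_distrib]
    congr 1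
    rw [sum_comm]
    refine sum_congr rfl fun α _ => ?_
    simp only [hw, hY, sum_mul, mul_sum]
    rw [sum_comm]
    exact sum_congr rfl fun i _ => sum_congr rfl fun δ _ => by ring
  have h3 : 2 * ∑ i ∈ lvl ι K, ∑ j ∈ lvl ι K,
        w i (j.1, j.2 + 1) * (q (i.1, i.2 + 1) * q (j.1, j.2 + 1)) =
      ∑ α, ∑ β, g α β * (Y α * Y β) := by
    -- The factor two pays for symmetrizing in i and j, after which `hw'` applies.
    calc _ = ∑ i ∈ lvl ι K, ∑ j ∈ lvl ι K, (w i (j.1, j.2 + 1) + w j (i.1, i.2 + 1)) *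
          (q (i.1, i.2 + 1) * q (j.1, j.2 + 1)) := by
          simp only [add_mul, sum_add_distrib]
          rw [two_mul]
          congr 1
          rw [sum_comm]
          exact sum_congr rfl fun i _ => sum_congr rfl fun j _ => by ring
      _ = ∑ i ∈ lvl ι K, ∑ α, ∑ j ∈ lvl ι K, ∑ β, g α β * ((M α (i.1, i.2 + 1) *
            q (i.1, i.2 + 1)) * (M β (j.1, j.2 + 1) * q (j.1, j.2 + 1))) := by
          refine sum_congr rfl fun i _ => ?_
          rw [sum_comm]
          refine sum_congr rfl fun j _ => ?_
          rw [hw', sum_mul]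
          refine sum_congr rfl fun γ _ => ?_
          rw [sum_mul]
          exact sum_congr rfl fun δ _ => by ring
      _ = _ := by
          rw [sum_comm]
          refine sum_congr rfl fun α _ => ?_
          rw [sum_congr rfl fun i _ => sum_comm, sum_comm]
          refine sum_congr rfl fun β _ => ?_
          simp only [hY]
          rw [sum_mul_sum, mul_sum]
          exact sum_congr rfl fun i _ => by rw [mul_sum]
  have h4 : ∑ α, ∑ β, g α β * (Y α * q (β, 0)) = ∑ α, ∑ β, g α β * (q (α, 0) * Y β) := by
    rw [sum_comm]
    refine sum_congr rfl fun α _ => sum_congr rfl fun β _ => ?_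
    rw [hg]
    ring
  simp only [h1, h2, mul_add, add_mul, sum_add_distrib, h4]
  rw [h3]
  ring

end Linear

/-! ### Stability of the dilaton and string equations. -/

section Invariance

variable {ι H : Type*} [Fintype ι] [DecidableEq ι] [AddCommGroup H] [Module ℂ H]
  {B : LinearMap.BilinForm ℂ H} (b : Module.Basis ι ℂ H) {R : PowerSeries (Module.End ℂ H)}

omit [DecidableEq ι] in
theorem dilaton_iff {x : ι × ℕ → ℂ} (hx : ∀ i, 2 ≤ i.2 → x i = 0) (F : MvPowerSeries (ι × ℕ) ℂ) :
    Dilaton x F ↔ ∀ K ≥ 2, ∀ N,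
      Congr (lvl ι K) N (∑ i ∈ lvl ι K, qVar x i * pderiv ℂ i F) (C 2 * F) := by
  refine Iff.trans ?_ (finsum_qVar_mul_iff hx (π := id) (fun i => le_rfl) (fun i => pderiv ℂ i F)
    (C 2 * F))
  simp only [coeff_C_mul]
  rfl

omit [DecidableEq ι] in
theorem stringEq_iff {x : ι × ℕ → ℂ} (hx : ∀ i, 2 ≤ i.2 → x i = 0)
    (F : MvPowerSeries (ι × ℕ) ℂ) :
    StringEq B b x F ↔ ∀ K ≥ 2, ∀ N,
      Congr (lvl ι K) N (∑ i ∈ lvl ι K, qVar x (i.1, i.2 + 1) * pderiv ℂ i F)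
        (C (-(1 / 2)) * ∑ α, ∑ β, C (B (b α) (b β)) * (qVar x (α, 0) * qVar x (β, 0))) := by
  rw [← finsum_qVar_mul_iff hx (π := fun i => (i.1, i.2 + 1)) (fun i => Nat.le_succ _)
    (fun i => pderiv ℂ i F)]
  simp only [coeff_C_mul, ← mul_assoc]
  rfl

omit [DecidableEq ι] in
theorem subst_qVar_congr {x x' : ι × ℕ → ℂ} {K : ℕ}
    (hxx : ∀ j, ∑ i ∈ lvl ι K, mat b R j i * x' i = x j) (j : ι × ℕ) (N : ℕ) :
    Congr (lvl ι K) N (∑ i ∈ lvl ι K, C (mat b R j i) * qVar x' i)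
      (subst (linSub (mat b R)) (qVar x j)) := by
  rw [qVar, subst_add (hasSubst_linSub (isLow_mat b R)), subst_C,
    subst_X (hasSubst_linSub (isLow_mat b R)), ← hxx]
  refine Congr.trans (Congr.of_eq ?_) ((Congr.refl _ _ _).add (linForm_congr _ _ _).symm)
  simp only [qVar, mul_add, sum_add_distrib, map_sum, map_mul]

/-- The Euler field is invariant under linear substitutions, provided the base points correspond
(`hxx`), and a quadratic form has Euler degree two. -/
theorem Dilaton.transform (hw : ∀ i j, wMat B b R i j = wMat B b R j i) {x x' : ι × ℕ → ℂ}
    (hx : ∀ i, 2 ≤ i.2 → x i = 0) (hx' : ∀ i, 2 ≤ i.2 → x' i = 0)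
    (hxx : ∀ K ≥ 2, ∀ j, ∑ i ∈ lvl ι K, mat b R j i * x' i = x j)
    {F : MvPowerSeries (ι × ℕ) ℂ} (hF : Dilaton x F) : Dilaton x' (transform B b R x' F) := by
  rw [dilaton_iff hx] at hF
  rw [dilaton_iff hx']
  intro K hK N
  have hS := hasSubst_linSub (isLow_mat b R)
  rw [GenusZero.transform]
  simp only [map_add, mul_add, sum_add_distrib]
  refine Congr.add ?_ ?_
  · refine Congr.trans (Congr.of_eq (?_ : _ = ∑ j ∈ lvl ι K,
      (∑ i ∈ lvl ι K, C (mat b R j i) * qVar x' i) *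
        subst (linSub (mat b R)) (pderiv ℂ j F))) ?_
    · simp only [sum_mul]
      rw [sum_comm]
      refine sum_congr rfl fun i hi => ?_
      rw [pderiv_subst_eq_sum (isLow_mat b R) (mem_lvl.1 hi), mul_sum]
      exact sum_congr rfl fun j _ => by ring
    · refine (Congr.sum fun j _ => (subst_qVar_congr b (hxx K hK) j N).mul
        (Congr.refl _ _ _)).trans ?_
      simp only [← subst_mul hS]
      rw [← subst_linSub_sum (isLow_mat b R)]
      refine ((hF K hK N).subst (isLow_mat b R)).trans (Congr.of_eq ?_)
      rw [subst_mul hS, subst_C]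
  · refine (Congr.sum fun i hi => (Congr.refl _ _ _).mul
      (pderiv_quad_congr hw hx' hK (mem_lvl.1 hi) N)).trans
      (Congr.trans (Congr.of_eq ?_) ((Congr.refl _ _ _).mul (quad_congr hx' hK N).symm))
    rw [← mul_assoc, ← map_mul, show (2 : ℂ) * (1 / 2) = 1 by norm_num, map_one, one_mul]
    refine sum_congr rfl fun i _ => ?_
    rw [mul_sum]
    exact sum_congr rfl fun j _ => by ring

omit [DecidableEq ι] in
theorem bilin_eq_sum (v w : H) :
    B v w = ∑ γ, ∑ δ, B (b γ) (b δ) * (b.repr v γ * b.repr w δ) := by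
  conv_lhs => rw [← b.sum_repr v, ← b.sum_repr w]
  simp only [map_sum, map_smul, LinearMap.sum_apply, LinearMap.smul_apply, smul_eq_mul, mul_sum]
  rw [sum_comm]
  exact sum_congr rfl fun γ _ => sum_congr rfl fun δ _ => by ring

variable [FiniteDimensional ℂ H] (hsymm : B.IsSymm) (hB : B.Nondegenerate)

include hsymm in
-- The string field q ↦ [q/z]₊ commutes with q ↦ [Rq]₊. The substituted part therefore yields
-- -½((Rq)₀, (Rq)₀), and the quadratic part corrects this to -½(q₀, q₀).
theorem StringEq.transform (hR : R ∈ lowerGroup B hB) {x x' : ι × ℕ → ℂ}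
    (hx : ∀ i, 2 ≤ i.2 → x i = 0) (hx' : ∀ i, 2 ≤ i.2 → x' i = 0)
    (hxx : ∀ K ≥ 2, ∀ j, ∑ i ∈ lvl ι K, mat b R j i * x' i = x j)
    {F : MvPowerSeries (ι × ℕ) ℂ} (hF : StringEq B b x F) :
    StringEq B b x' (transform B b R x' F) := by
  rw [stringEq_iff b hx] at hF
  rw [stringEq_iff b hx']
  intro K hK N
  have hS := hasSubst_linSub (isLow_mat b R)
  have hw := wMat_symm b hsymm hB hR
  -- Cutting the coordinates off makes those of level K vanish exactly rather than modulo
  -- truncation, so `string_identity` can be applied as an equality.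
  set q : ι × ℕ → MvPowerSeries (ι × ℕ) ℂ := fun i => if i.2 < K then qVar x' i else 0 with hqd
  have hq : ∀ i, Congr (lvl ι K) N (qVar x' i) (q i) := fun i => by
    simp only [hqd]
    split_ifs with h
    · exact Congr.refl _ _ _
    · exact qVar_congr_zero hx' hK (not_lt.1 h) N
  have hqK : ∀ α, q (α, K) = 0 := fun α => by simp [hqd]
  have hqs : ∀ j, Congr (lvl ι K) N (∑ i ∈ lvl ι K, C (mat b R j i) * q i)
      (subst (linSub (mat b R)) (qVar x j)) := fun j =>
    (Congr.sum fun i _ => (Congr.refl _ _ _).mul (hq i).symm).trans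
      (subst_qVar_congr b (hxx K hK) j N)
  have hid := string_identity K q hqK (fun α β => C (B (b α) (b β)))
    (fun α β => by rw [hsymm.eq]) (fun i j => C (wMat B b R i j)) (fun γ i => C (mat b R (γ, 0) i))
    (fun γ α => by
      rw [mat_self_level b hR.1]
      split_ifs <;> simp)
    (fun i α => by
      rw [hw, wMat, wVec_zero_left hB hR]
      simp only [← map_mul, ← map_sum]
      congr 1
      conv_lhs => rw [← b.sum_repr (PowerSeries.coeff (i.2 + 1) R (b i.1))]
      simp only [map_sum, map_smul, smul_eq_mul]
      exact sum_congr rfl fun δ _ => by simp [mat, mul_comm])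
    (fun i j => by
      rw [hw j, ← map_add, add_comm, wMat, wMat]
      simp only
      rw [wVec_succ_add, bilin_eq_sum b]
      simp [mat])
  have h1 : Congr (lvl ι K) N (∑ i ∈ lvl ι K, qVar x' (i.1, i.2 + 1) *
      pderiv ℂ i (subst (linSub (mat b R)) F))
      (C (-(1 / 2)) * ∑ α, ∑ β, C (B (b α) (b β)) * ((∑ i ∈ lvl ι K, C (mat b R (α, 0) i) * q i) *
        ∑ i ∈ lvl ι K, C (mat b R (β, 0) i) * q i)) := by
    refine Congr.trans (Congr.of_eq (?_ : _ = ∑ j ∈ lvl ι K,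
      (∑ i ∈ lvl ι K, C (mat b R j i) * qVar x' (i.1, i.2 + 1)) *
        subst (linSub (mat b R)) (pderiv ℂ j F))) ?_
    · simp only [sum_mul]
      rw [sum_comm]
      refine sum_congr rfl fun i hi => ?_
      rw [pderiv_subst_eq_sum (isLow_mat b R) (mem_lvl.1 hi), mul_sum]
      exact sum_congr rfl fun j _ => by ring
    -- Commutation with the shift: matrix entries depend on the difference of levels only, and a row
    -- of positive level has no entry in a level zero column.
    · have hsh : ∀ j : ι × ℕ, Congr (lvl ι K) N
          (∑ i ∈ lvl ι K, C (mat b R j i) * qVar x' (i.1, i.2 + 1))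
          (subst (linSub (mat b R)) (qVar x (j.1, j.2 + 1))) := fun j => by
        refine (Congr.sum fun i _ => (Congr.refl _ _ _).mul (hq _)).trans
          (Congr.trans (Congr.of_eq ?_) (hqs _))
        rw [sum_lvl_shift_of_eq_zero (f := fun i => C (mat b R (j.1, j.2 + 1) i) * q i)
          fun α => by rw [hqK, mul_zero]]
        simp [mat]
      refine (Congr.sum fun j _ => (hsh j).mul (Congr.refl _ _ _)).trans ?_
      simp only [← subst_mul hS]
      rw [← subst_linSub_sum (isLow_mat b R)]
      refine ((hF K hK N).subst (isLow_mat b R)).trans ?_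
      simp only [subst_mul hS, subst_C, subst_linSub_sum (isLow_mat b R)]
      exact (Congr.refl _ _ _).mul (Congr.sum fun α _ => Congr.sum fun β _ =>
        (Congr.refl _ _ _).mul ((hqs _).symm.mul (hqs _).symm))
  have h2 : Congr (lvl ι K) N (∑ i ∈ lvl ι K, qVar x' (i.1, i.2 + 1) *
      pderiv ℂ i (quad (wMat B b R) x')) (∑ i ∈ lvl ι K, ∑ j ∈ lvl ι K,
        C (wMat B b R i j) * (q (i.1, i.2 + 1) * q j)) := by
    refine Congr.sum fun i hi => ((hq _).mul
      ((pderiv_quad_congr hw hx' hK (mem_lvl.1 hi) N).trans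
        (Congr.sum fun j _ => (Congr.refl _ _ _).mul (hq j)))).trans (Congr.of_eq ?_)
    rw [mul_sum]
    exact sum_congr rfl fun j _ => by ring
  rw [GenusZero.transform]
  simp only [map_add, mul_add, sum_add_distrib]
  refine (h1.add h2).trans (Congr.trans (Congr.of_eq ?_) ((Congr.refl _ _ _).mul
    (Congr.sum fun α _ => Congr.sum fun β _ => (Congr.refl _ _ _).mul
      ((hq (α, 0)).mul (hq (β, 0))))).symm)
  rw [← hid]
  have h5 : (C (-(1 / 2)) : MvPowerSeries (ι × ℕ) ℂ) * 2 = -1 := by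
    rw [show (2 : MvPowerSeries (ι × ℕ) ℂ) = C 2 from rfl, ← map_mul]
    norm_num
  rw [mul_add, ← mul_assoc, h5]
  ring

include hsymm in
-- The transform pulls back along q ↦ [Rq]₊, so it leads from the image base point u - R₁𝟏 back to
-- u. For R = S⁻¹ this is the direction of the action of S.
theorem transform_mem_GW0 (hR : R ∈ lowerGroup B hB) {one u : H} {F : MvPowerSeries (ι × ℕ) ℂ}
    (hF : F ∈ GW0 B b one (u - PowerSeries.coeff 1 R one)) :
    transform B b R (basePt b one u) F ∈ GW0 B b one u := by
  have hx : ∀ u : H, ∀ i : ι × ℕ, 2 ≤ i.2 → basePt b one u i = 0 :=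
    fun u i hi => basePt_eq_zero b one u hi
  have hxx : ∀ K ≥ 2, ∀ j, ∑ i ∈ lvl ι K, mat b R j i * basePt b one u i =
      basePt b one (u - PowerSeries.coeff 1 R one) j := fun K hK j => by
    rw [sum_mat_basePt b R one u j hK, hR.1]
    rfl
  exact ⟨hF.1.transform b (wMat_symm b hsymm hB hR) (hx _) (hx _) hxx,
    hF.2.1.transform b hsymm hB hR (hx _) (hx _) hxx, hF.2.2.transform b hsymm hB hR (hx _)⟩

end Invariance

/-! ### Values of power series at nilpotent points. -/

section Evaluation

variable {ι : Type*} [Fintype ι] {A : Type} [CommRing A] [Algebra ℂ A]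

/-- A tuple of nilpotent elements that vanishes on the levels from `K` on. -/
structure IsNilTuple (K : ℕ) (t : ι × ℕ → A) : Prop where
  nilpotent : ∀ i, IsNilpotent (t i)
  eq_zero : ∀ i, K ≤ i.2 → t i = 0

variable {K : ℕ} {t : ι × ℕ → A}

omit [Algebra ℂ A] in
theorem IsNilTuple.hasSubst (ht : IsNilTuple K t) :
    HasSubst (fun i => (C (t i) : MvPowerSeries Empty A)) where
  const_coeff i := by simpa using ht.nilpotent i
  coeff_zero d := by
    refine (lvl ι K).finite_toSet.subset fun i hi => ?_
    rw [mem_coe, mem_lvl]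
    by_contra h
    exact hi (by rw [ht.eq_zero i (not_lt.1 h), map_zero, map_zero])

/-- A power series over A in no variables is its constant term. Evaluation thus becomes a
substitution and inherits its algebraic properties. -/
theorem evalNil_eq (ht : IsNilTuple K t) (G : MvPowerSeries (ι × ℕ) ℂ) :
    evalNil G t = constantCoeff (subst (fun i => (C (t i) : MvPowerSeries Empty A)) G) := by
  rw [constantCoeff_subst ht.hasSubst, evalNil]
  refine finsum_congr fun d => ?_
  rw [Algebra.smul_def, Finsupp.prod, Finsupp.prod, map_prod]
  simp

theorem evalNil_congr (ht : IsNilTuple K t) {G G' : MvPowerSeries (ι × ℕ) ℂ}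
    (h : ∀ N, Congr (lvl ι K) N G G') : evalNil G t = evalNil G' t := by
  refine finsum_congr fun d => ?_
  by_cases hd : d.support ⊆ lvl ι K
  · rw [h d.degree d hd le_rfl]
  · obtain ⟨i, hi, hiK⟩ := not_subset.1 hd
    rw [Finsupp.prod, prod_eq_zero hi, mul_zero, mul_zero]
    rw [ht.eq_zero i (by simpa using hiK), zero_pow (by simpa using hi)]

theorem evalNil_add (ht : IsNilTuple K t) (G G' : MvPowerSeries (ι × ℕ) ℂ) :
    evalNil (G + G') t = evalNil G t + evalNil G' t := by
  rw [evalNil_eq ht, evalNil_eq ht, evalNil_eq ht, subst_add ht.hasSubst, map_add]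

theorem evalNil_C (ht : IsNilTuple K t) (c : ℂ) : evalNil (C c) t = algebraMap ℂ A c := by
  rw [evalNil_eq ht, ← substAlgHom_apply ht.hasSubst]
  have := (substAlgHom (R := ℂ) ht.hasSubst).commutes c
  rw [MvPowerSeries.algebraMap_apply, MvPowerSeries.algebraMap_apply] at this
  rw [show (C c : MvPowerSeries (ι × ℕ) ℂ) = C (algebraMap ℂ ℂ c) from rfl, this]
  simp

theorem evalNil_mul (ht : IsNilTuple K t) (G G' : MvPowerSeries (ι × ℕ) ℂ) :
    evalNil (G * G') t = evalNil G t * evalNil G' t := by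
  rw [evalNil_eq ht, evalNil_eq ht, evalNil_eq ht, subst_mul ht.hasSubst, map_mul]

theorem evalNil_X (ht : IsNilTuple K t) (i : ι × ℕ) : evalNil (X i) t = t i := by
  rw [evalNil_eq ht, subst_X ht.hasSubst, constantCoeff_C]

theorem evalNil_sum (ht : IsNilTuple K t) {κ : Type*} (s : Finset κ)
    (G : κ → MvPowerSeries (ι × ℕ) ℂ) : evalNil (∑ k ∈ s, G k) t = ∑ k ∈ s, evalNil (G k) t := by
  simp only [evalNil_eq ht, ← substAlgHom_apply ht.hasSubst, map_sum]

theorem subst_const_congr (ht : IsNilTuple K t) {G G' : MvPowerSeries (ι × ℕ) ℂ}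
    (h : ∀ N, Congr (lvl ι K) N G G') :
    subst (fun i => (C (t i) : MvPowerSeries Empty A)) G =
      subst (fun i => (C (t i) : MvPowerSeries Empty A)) G' := by
  ext e
  rw [coeff_subst ht.hasSubst, coeff_subst ht.hasSubst]
  refine finsum_congr fun d => ?_
  by_cases hd : d.support ⊆ lvl ι K
  · rw [h d.degree d hd le_rfl]
  · obtain ⟨i, hi, hiK⟩ := not_subset.1 hd
    rw [Finsupp.prod, prod_eq_zero hi, map_zero, smul_zero, smul_zero]
    rw [ht.eq_zero i (by simpa using hiK), map_zero, zero_pow (by simpa using hi)]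

theorem evalNil_subst (ht : IsNilTuple K t) {M : ι × ℕ → ι × ℕ → ℂ} (hM : IsLow M)
    {t' : ι × ℕ → A} (ht' : IsNilTuple K t') (h : ∀ j, t' j = ∑ i ∈ lvl ι K, M j i • t i)
    (G : MvPowerSeries (ι × ℕ) ℂ) : evalNil (subst (linSub M) G) t = evalNil G t' := by
  rw [evalNil_eq ht, evalNil_eq ht', subst_comp_subst_apply (hasSubst_linSub hM) ht.hasSubst]
  congr 2
  funext j
  rw [linSub, subst_const_congr ht fun N => linForm_congr _ _ N, h,
    ← substAlgHom_apply ht.hasSubst, map_sum, map_sum]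
  refine sum_congr rfl fun i _ => ?_
  rw [← smul_eq_C_mul, map_smul, substAlgHom_X]
  ext e
  simp [Subsingleton.elim e 0]

theorem isNilTuple_of_eq (ht : IsNilTuple K t) {M : ι × ℕ → ι × ℕ → ℂ} (hM : IsLow M)
    {t' : ι × ℕ → A} (h : ∀ j, t' j = ∑ i ∈ lvl ι K, M j i • t i) : IsNilTuple K t' where
  nilpotent j := by
    rw [h]
    exact isNilpotent_sum fun i _ => (ht.nilpotent i).smul _
  eq_zero j hj := by
    rw [h]
    refine sum_eq_zero fun i hi => ?_
    rw [hM j i (by have := mem_lvl.1 hi; omega), zero_smul]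

end Evaluation

/-! ### Truncated polynomial algebras separate power series. -/

section TestAlgebra

/-- Polynomials in `d × ℕ` variables modulo monomials of degree at least `N`. -/
abbrev TestAlgebra (d N : ℕ) : Type :=
  MvPolynomial (Fin d × ℕ) ℂ ⧸ (MvPolynomial.idealOfVars (Fin d × ℕ) ℂ) ^ N

variable {ι : Type*} [Fintype ι]

/-- The index map to the variables of the test algebra. -/
def testIndex (ι : Type*) [Fintype ι] (i : ι × ℕ) : Fin (Fintype.card ι) × ℕ :=
  (Fintype.equivFin ι i.1, i.2)

/-- Relabelling by `Fin` keeps the test algebra in `Type`, where the points of cones are taken,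
whatever the universe of `ι`. Injectivity keeps distinct monomials distinct. -/
theorem testIndex_injective : Function.Injective (testIndex ι) := by
  rintro ⟨α, k⟩ ⟨β, l⟩ h
  simpa [testIndex] using h

/-- The generic point with coordinates of level below `K` in the test algebra. -/
def testPoint (ι : Type*) [Fintype ι] (K N : ℕ) (i : ι × ℕ) : TestAlgebra (Fintype.card ι) N :=
  if i.2 < K then Ideal.Quotient.mk _ (MvPolynomial.X (testIndex ι i)) else 0

theorem isNilTuple_testPoint (K N : ℕ) : IsNilTuple K (testPoint ι K N) where
  nilpotent i := by
    rw [testPoint]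
    split_ifs
    · refine ⟨N, ?_⟩
      rw [← map_pow, Ideal.Quotient.eq_zero_iff_mem]
      exact Ideal.pow_mem_pow (Ideal.subset_span (Set.mem_range_self (testIndex ι i))) N
    · exact IsNilpotent.zero
  eq_zero i hi := if_neg (not_lt.2 hi)

theorem prod_testPoint {K : ℕ} (N : ℕ) {d : ι × ℕ →₀ ℕ} (hd : d.support ⊆ lvl ι K) :
    (d.prod fun i e => testPoint ι K N i ^ e) =
      Ideal.Quotient.mk _ (MvPolynomial.monomial (d.mapDomain (testIndex ι)) 1) := by
  rw [MvPolynomial.monomial_eq, map_one, one_mul,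
    Finsupp.prod_mapDomain_index_inj testIndex_injective, Finsupp.prod, Finsupp.prod, map_prod]
  refine prod_congr rfl fun i hi => ?_
  rw [testPoint, if_pos (mem_lvl.1 (hd hi)), map_pow]

theorem evalNil_testPoint (K N : ℕ) (G : MvPowerSeries (ι × ℕ) ℂ) [DecidableEq ι] :
    evalNil G (testPoint ι K N) = Ideal.Quotient.mk _
      (∑ d ∈ (range N).biUnion (finsuppAntidiag (lvl ι K)),
        MvPolynomial.monomial (d.mapDomain (testIndex ι)) (coeff d G)) := by
  rw [evalNil, finsum_eq_sum_of_support_subset (s := (range N).biUnion (finsuppAntidiag (lvl ι K))),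
    map_sum]
  · refine sum_congr rfl fun d hd => ?_
    obtain ⟨k, _, hk⟩ := mem_biUnion.1 hd
    rw [prod_testPoint N (mem_finsuppAntidiag.1 hk).2]
    conv_rhs => rw [← mul_one (coeff d G), ← MvPolynomial.C_mul_monomial, map_mul]
    rfl
  · intro d hd
    rw [mem_coe, mem_biUnion]
    have hs : d.support ⊆ lvl ι K := by
      by_contra h
      obtain ⟨i, hi, hiK⟩ := not_subset.1 h
      refine hd ?_
      simp only
      rw [Finsupp.prod, prod_eq_zero hi, mul_zero]
      rw [testPoint, if_neg (by simpa using hiK), zero_pow (by simpa using hi)]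
    refine ⟨d.degree, ?_, ?_⟩
    · rw [mem_range]
      by_contra h
      refine hd ?_
      simp only
      rw [prod_testPoint N hs, Ideal.Quotient.eq_zero_iff_mem.2, mul_zero]
      rw [MvPolynomial.mem_pow_idealOfVars_iff]
      intro x hx
      have := MvPolynomial.support_monomial_subset hx
      rw [mem_singleton] at this
      rw [this, Finsupp.degree_mapDomain]
      exact not_lt.1 h
    · rw [mem_finsuppAntidiag]
      refine ⟨?_, hs⟩
      rw [Finsupp.degree_apply]
      exact (sum_subset hs fun i _ hi => by simpa using hi).symm

/-- A power series is determined by its values at nilpotent tuples. -/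
theorem eq_of_evalNil_eq {G G' : MvPowerSeries (ι × ℕ) ℂ}
    (h : ∀ (A : Type) [CommRing A] [Algebra ℂ A] (K : ℕ) (t : ι × ℕ → A), IsNilTuple K t →
      evalNil G t = evalNil G' t) : G = G' := by
  classical
  ext m
  obtain ⟨K, hK⟩ := exists_support_subset_lvl m
  have hm := hK K le_rfl
  -- With this order of nilpotency the monomial m survives at the generic point, and its coefficient
  -- can be read off.
  have h1 := h _ K _ (isNilTuple_testPoint (ι := ι) K (m.degree + 1))
  rw [evalNil_testPoint, evalNil_testPoint, Ideal.Quotient.eq, ← sum_sub_distrib,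
    MvPolynomial.mem_pow_idealOfVars_iff] at h1
  simp only [← map_sub] at h1
  have h2 : MvPolynomial.coeff (m.mapDomain (testIndex ι))
      (∑ d ∈ (range (m.degree + 1)).biUnion (finsuppAntidiag (lvl ι K)),
        MvPolynomial.monomial (d.mapDomain (testIndex ι)) (coeff d G - coeff d G')) = 0 := by
    by_contra hne
    have := h1 _ (MvPolynomial.mem_support_iff.2 hne)
    rw [Finsupp.degree_mapDomain] at this
    omega
  rw [MvPolynomial.coeff_sum] at h2
  simp only [MvPolynomial.coeff_monomial,
    (Finsupp.mapDomain_injective testIndex_injective).eq_iff] at h2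
  rw [sum_ite_eq', if_pos] at h2
  · exact sub_eq_zero.1 h2
  · rw [mem_biUnion]
    refine ⟨m.degree, self_mem_range_succ _, ?_⟩
    rw [mem_finsuppAntidiag]
    refine ⟨?_, hm⟩
    rw [Finsupp.degree_apply]
    exact (sum_subset hm fun i _ hi => by simpa using hi).symm

end TestAlgebra

/-! ### Operator series acting on Laurent series. -/

section LoopAction

variable {R V : Type*} [CommRing R] [AddCommGroup V] [Module R V]

theorem Loop.act_apply (M : ℕ → Module.End R V) {f : Loop V} {N n : ℤ} {L : ℕ}
    (hf : ∀ k, N ≤ k → f.1 k = 0) (hL : N ≤ n + L) :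
    (Loop.act M f).1 n = ∑ i ∈ range L, M i (f.1 (n + i)) := by
  refine finsum_eq_sum_of_support_subset _ fun i hi => ?_
  rw [coe_range, Set.mem_Iio]
  by_contra h
  exact hi (by simp only; rw [hf _ (by omega), map_zero])

theorem Loop.act_eq_zero (M : ℕ → Module.End R V) {f : Loop V} {N : ℤ}
    (hf : ∀ k, N ≤ k → f.1 k = 0) {k : ℤ} (hk : N ≤ k) : (Loop.act M f).1 k = 0 := by
  rw [Loop.act_apply M (L := 0) hf (by omega), range_zero, sum_empty]

theorem Loop.exists_bound {V : Type*} [Zero V] (f : Loop V) (K₀ : ℕ) :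
    ∃ K ≥ K₀, ∀ n : ℤ, (K : ℤ) ≤ n → f.1 n = 0 := by
  obtain ⟨N, hN⟩ := f.2
  exact ⟨max K₀ (N + 1).toNat, le_max_left _ _, fun n hn => hN n (by omega)⟩

theorem Loop.act_act (M M' : ℕ → Module.End R V) (f : Loop V) :
    Loop.act M (Loop.act M' f) =
      Loop.act (fun n => ∑ p ∈ antidiagonal n, M p.1 * M' p.2) f := by
  obtain ⟨K, -, hK⟩ := f.exists_bound 0
  refine Subtype.ext (funext fun n => ?_)
  set L := (K - n).toNat
  have h0 : ∀ k : ℤ, (K : ℤ) ≤ k → (Loop.act M' f).1 k = 0 := fun k => Loop.act_eq_zero M' hK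
  rw [Loop.act_apply M (L := L) h0 (by omega), Loop.act_apply _ (L := L) hK (by omega)]
  calc _ = ∑ i ∈ range L, ∑ j ∈ range L, M i (M' j (f.1 (n + i + j))) := by
        refine sum_congr rfl fun i _ => ?_
        rw [Loop.act_apply M' (L := L) hK (by omega), map_sum]
    _ = _ := by
        rw [sum_range_range_eq_sum_antidiagonal]
        · refine sum_congr rfl fun k _ => ?_
          rw [LinearMap.sum_apply]
          refine sum_congr rfl fun p hp => ?_
          rw [HasAntidiagonal.mem_antidiagonal] at hp
          rw [Module.End.mul_apply, ← hp]
          push_cast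
          rw [add_assoc]
        · intro i j hij
          rw [hK _ (by omega), map_zero, map_zero]

theorem Loop.act_one (f : Loop V) :
    Loop.act (fun n => if n = 0 then (1 : Module.End R V) else 0) f = f := by
  obtain ⟨K, -, hK⟩ := f.exists_bound 0
  refine Subtype.ext (funext fun n => ?_)
  rw [Loop.act_apply _ (L := (K - n).toNat + 1) hK (by omega), sum_range_succ']
  simp

variable {H : Type*} [AddCommGroup H] [Module ℂ H] (A : Type) [CommRing A] [Algebra ℂ A]

/-- The action of a series of operators over `ℂ` on `(A ⊗ H)((z⁻¹))`. -/
abbrev actBase (S : PowerSeries (Module.End ℂ H)) : Loop (A ⊗[ℂ] H) → Loop (A ⊗[ℂ] H) :=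
  Loop.act fun i => (PowerSeries.coeff i S).baseChange A

theorem actBase_actBase_of_mul_eq_one {S T : PowerSeries (Module.End ℂ H)} (h : S * T = 1)
    (f : Loop (A ⊗[ℂ] H)) : actBase A S (actBase A T f) = f := by
  rw [actBase, Loop.act_act]
  conv_rhs => rw [← Loop.act_one (R := A) f]
  congr 1
  funext n
  have h1 := congrArg (fun φ => (LinearMap.baseChangeHom ℂ A H H) (PowerSeries.coeff n φ)) h
  simp only [PowerSeries.coeff_mul, map_sum, LinearMap.baseChangeHom_apply,
    PowerSeries.coeff_one] at h1
  simp only [← LinearMap.baseChange_mul, h1]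
  split_ifs
  · exact LinearMap.baseChange_one _ _
  · exact LinearMap.baseChange_zero

end LoopAction

/-! ### Darboux coordinates of Sf. -/

section Coordinates

variable {ι H : Type*} [Fintype ι] [DecidableEq ι] [AddCommGroup H] [Module ℂ H]
  {B : LinearMap.BilinForm ℂ H} (b : Module.Basis ι ℂ H) (A : Type) [CommRing A] [Algebra ℂ A]

/-- `f` has no powers of `z` from `z^K` on. -/
def Loop.BoundedBy {V : Type*} [Zero V] (f : Loop V) (K : ℕ) : Prop :=
  ∀ n : ℤ, (K : ℤ) ≤ n → f.1 n = 0

omit [DecidableEq ι] in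
theorem repr_baseChange (φ : Module.End ℂ H) (v : A ⊗[ℂ] H) (β : ι) :
    (b.baseChange A).repr (φ.baseChange A v) β =
      ∑ α, b.repr (φ (b α)) β • (b.baseChange A).repr v α := by
  induction v using TensorProduct.induction_on with
  | zero => simp
  | tmul a v =>
    simp only [LinearMap.baseChange_tmul, Module.Basis.baseChange_repr_tmul]
    conv_lhs => rw [← b.sum_repr v]
    simp only [map_sum, map_smul, Finsupp.finsetSum_apply, Finsupp.smul_apply, sum_smul,
      smul_eq_mul, mul_comm, smul_smul]
  | add v w hv hw =>
    simp only [map_add, Finsupp.add_apply, hv, hw, smul_add, sum_add_distrib]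

omit [DecidableEq ι] in
theorem bilin_baseChange_tmul (v : A ⊗[ℂ] H) (w : H) :
    LinearMap.BilinForm.baseChange A B v (1 ⊗ₜ w) =
      ∑ α, B (b α) w • (b.baseChange A).repr v α := by
  induction v using TensorProduct.induction_on with
  | zero => simp
  | tmul a v =>
    simp only [LinearMap.BilinForm.baseChange_tmul, Module.Basis.baseChange_repr_tmul]
    conv_lhs => rw [← b.sum_repr v]
    simp only [map_sum, map_smul, LinearMap.sum_apply, LinearMap.smul_apply, sum_smul, smul_smul,
      smul_eq_mul, mul_one, mul_comm]
  | add v w hv hw =>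
    simp only [map_add, LinearMap.add_apply, Finsupp.add_apply, hv, hw, smul_add, sum_add_distrib]

variable {b A}

omit [Fintype ι] [DecidableEq ι] in
theorem qCoord_eq_zero {f : Loop (A ⊗[ℂ] H)} {K : ℕ} (hf : f.BoundedBy K) {i : ι × ℕ}
    (hi : K ≤ i.2) : qCoord b A f i = 0 := by
  rw [qCoord, hf _ (by omega), map_zero, Finsupp.zero_apply]

theorem Loop.BoundedBy.actBase {f : Loop (A ⊗[ℂ] H)} {K : ℕ} (hf : f.BoundedBy K)
    (S : PowerSeries (Module.End ℂ H)) : (actBase A S f).BoundedBy K :=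
  fun _ hn => Loop.act_eq_zero _ hf hn

omit [DecidableEq ι] in
theorem qCoord_actBase {f : Loop (A ⊗[ℂ] H)} {K : ℕ} (hf : f.BoundedBy K)
    (S : PowerSeries (Module.End ℂ H)) (j : ι × ℕ) :
    qCoord b A (actBase A S f) j = ∑ i ∈ lvl ι K, mat b S j i • qCoord b A f i := by
  have h1 : ∀ k ∈ range K, ∑ α, mat b S j (α, k) • qCoord b A f (α, k) = if j.2 ≤ k then
      (b.baseChange A).repr ((PowerSeries.coeff (k - j.2) S).baseChange A (f.1 k)) j.1 else 0 :=
    fun k _ => by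
      rw [repr_baseChange]
      simp only [mat]
      split_ifs
      · rfl
      · simp
  rw [sum_lvl, sum_congr rfl h1, ← sum_filter]
  have h2 : filter (fun k => j.2 ≤ k) (range K) = Ico j.2 K := by
    ext k
    simp only [mem_filter, mem_range, mem_Ico]
    omega
  rw [h2, sum_Ico_eq_sum_range, qCoord, actBase, Loop.act_apply _ (L := K - j.2) hf (by omega),
    map_sum, Finsupp.finsetSum_apply]
  refine sum_congr rfl fun s _ => ?_
  rw [Nat.add_sub_cancel_left]
  push_cast
  rfl

variable [FiniteDimensional ℂ H] (hsymm : B.IsSymm) (hB : B.Nondegenerate)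

include hsymm in
-- The adjoint of S_s is (-1)^s times the s-th coefficient of S*(-z). This moves S across the
-- pairing onto constant vectors.
theorem bilin_baseChange_adjNeg (S : PowerSeries (Module.End ℂ H)) (s : ℕ) (v : A ⊗[ℂ] H)
    (w : H) : LinearMap.BilinForm.baseChange A B ((PowerSeries.coeff s S).baseChange A v)
      (1 ⊗ₜ w) = (-1) ^ s * LinearMap.BilinForm.baseChange A B v
        (1 ⊗ₜ (PowerSeries.coeff s (adjNeg B hB S) w)) := by
  induction v using TensorProduct.induction_on with
  | zero => simp
  | tmul a v =>
    simp only [LinearMap.baseChange_tmul, LinearMap.BilinForm.baseChange_tmul, adjNeg,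
      PowerSeries.coeff_mk, LinearMap.smul_apply, map_smul]
    rw [hsymm.eq v, leftAdjoint_apply, hsymm.eq w, Algebra.smul_def, Algebra.smul_def, smul_eq_mul,
      map_mul, map_pow, map_neg, map_one]
    have h : ((-1 : A) ^ s) * (-1) ^ s = 1 := by rw [← mul_pow]; simp
    linear_combination (-(algebraMap ℂ A ((B ((PowerSeries.coeff s S) v)) w) * (1 * a))) * h
  | add v w hv hw =>
    simp only [map_add, LinearMap.add_apply, hv, hw, mul_add]

/-- The pairing with the coefficient of `z^{-l-1}`, normalized so that basis vectors give the
coordinates `p`. -/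
def pMap (B : LinearMap.BilinForm ℂ H) (f : Loop (A ⊗[ℂ] H)) (l : ℕ) : H →ₗ[ℂ] A :=
  ((-1 : A) ^ (l + 1)) • ((LinearMap.BilinForm.baseChange A B
    (f.1 (-(l : ℤ) - 1))).restrictScalars ℂ ∘ₗ TensorProduct.mk ℂ A H 1)

omit [FiniteDimensional ℂ H] in
theorem pMap_apply (f : Loop (A ⊗[ℂ] H)) (l : ℕ) (w : H) : pMap B f l w =
    (-1 : A) ^ (l + 1) * LinearMap.BilinForm.baseChange A B (f.1 (-(l : ℤ) - 1)) (1 ⊗ₜ w) := rfl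

omit [FiniteDimensional ℂ H] in
omit [Fintype ι] [DecidableEq ι] in
theorem pCoord_eq (f : Loop (A ⊗[ℂ] H)) (i : ι × ℕ) : pCoord B b A f i = pMap B f i.2 (b i.1) := by
  rw [pCoord, pMap_apply, Module.Basis.baseChange_apply]

/-- The pairing of operators that produces the coefficients `wVec`. -/
def wMap (B : LinearMap.BilinForm ℂ H) (R : PowerSeries (Module.End ℂ H)) (k : ℕ) (w : H) (r : ℕ) :
    H →ₗ[ℂ] ℂ :=
  ((-1 : ℂ) ^ r) • B.flip (PowerSeries.coeff (k + 1 + r) R w)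

omit [DecidableEq ι] in
include hsymm in
/-- The momenta of `S f`. -/
theorem pCoord_actBase {S : PowerSeries (Module.End ℂ H)} (hS : adjNeg B hB S * S = 1)
    {f : Loop (A ⊗[ℂ] H)} {K : ℕ} (hf : f.BoundedBy K) {i : ι × ℕ} (hi : i.2 < K) :
    pCoord B b A (actBase A S f) i =
      ∑ j ∈ lvl ι K, mat b (adjNeg B hB S) j i • pCoord B b A f j +
        ∑ j ∈ lvl ι K, wMat B b (adjNeg B hB S) j i • qCoord b A (actBase A S f) j := by
  set R := adjNeg B hB S with hR
  have h1 : ∑ j ∈ lvl ι K, mat b R j i • pCoord B b A f j =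
      ∑ s ∈ range (i.2 + 1), pMap B f (i.2 - s) (PowerSeries.coeff s R (b i.1)) := by
    simp only [pCoord_eq]
    exact sum_mat_smul b R (pMap B f) i hi
  -- W factors as the transpose of [R ·]₊ followed by the pairing with [R ·]₋.
  have h2 : ∀ l ∈ lvl ι K, wMat B b R l i =
      ∑ j ∈ lvl ι K, mat b R j l * wMap B R i.2 (b i.1) j.2 (b j.1) := fun l hl => by
    have := sum_mat_smul b R (wMap B R i.2 (b i.1)) l (mem_lvl.1 hl)
    simp only [smul_eq_mul] at this
    rw [this, wMat, wVec]
    refine sum_congr rfl fun s hs => ?_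
    rw [mem_range] at hs
    rw [wMap, LinearMap.smul_apply, smul_eq_mul, LinearMap.BilinForm.flip_apply,
      show l.2 + i.2 + 1 - s = i.2 + 1 + (l.2 - s) by omega]
  -- Since f = R(Sf), the factor [R ·]₊ turns the positions of Sf into those of f.
  have h3 : ∑ j ∈ lvl ι K, wMat B b R j i • qCoord b A (actBase A S f) j =
      ∑ j ∈ lvl ι K, wMap B R i.2 (b i.1) j.2 (b j.1) • qCoord b A f j := by
    rw [sum_congr rfl fun l hl => by rw [h2 l hl, sum_smul], sum_comm]
    refine sum_congr rfl fun j _ => ?_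
    conv_rhs => rw [← actBase_actBase_of_mul_eq_one A hS f,
      qCoord_actBase (hf.actBase S), smul_sum]
    exact sum_congr rfl fun l _ => by rw [smul_smul, mul_comm]
  rw [h1, h3, pCoord_eq, pMap_apply, actBase,
    -- The first i.2 + 1 terms of the coefficient of z^{-i.2-1} in Sf meet negative powers of z in
    -- f, that is momenta; the remaining K meet positions.
    Loop.act_apply _ (L := i.2 + 1 + K) hf (by push_cast; omega), sum_range_add, map_add,
    LinearMap.add_apply, mul_add]
  congr 1
  · rw [map_sum, LinearMap.sum_apply, mul_sum]
    refine sum_congr rfl fun s hs => ?_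
    rw [mem_range] at hs
    rw [bilin_baseChange_adjNeg hsymm hB, pMap_apply, ← mul_assoc,
      show -(i.2 : ℤ) - 1 + s = -((i.2 - s : ℕ) : ℤ) - 1 by omega]
    congr 1
    obtain ⟨r, hr⟩ : ∃ r, i.2 = s + r := ⟨i.2 - s, by omega⟩
    rw [hr, show s + r - s = r by omega, ← pow_add, show s + r + 1 + s = 2 * s + (r + 1) by ring,
      pow_add, pow_mul]
    simp
  · rw [map_sum, LinearMap.sum_apply, mul_sum, sum_lvl]
    refine sum_congr rfl fun r _ => ?_
    rw [bilin_baseChange_adjNeg hsymm hB, bilin_baseChange_tmul b, ← mul_assoc, ← pow_add,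
      show i.2 + 1 + (i.2 + 1 + r) = 2 * (i.2 + 1) + r by ring, pow_add, pow_mul, mul_sum]
    refine sum_congr rfl fun α _ => ?_
    rw [wMap, LinearMap.smul_apply, LinearMap.BilinForm.flip_apply, smul_eq_mul, mul_smul, qCoord,
      Algebra.smul_def ((-1 : ℂ) ^ r)]
    simp only [even_two, Even.neg_pow, one_pow, one_mul, map_pow, map_neg, map_one]
    rw [show -(i.2 : ℤ) - 1 + ((i.2 + 1 + r : ℕ) : ℤ) = (r : ℤ) by push_cast; ring]

end Coordinates

/-! ### The action on cones. -/

section Cone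

variable {ι H : Type*} [Fintype ι] [DecidableEq ι] [AddCommGroup H] [Module ℂ H]
  [FiniteDimensional ℂ H] {B : LinearMap.BilinForm ℂ H} (hsymm : B.IsSymm) (hB : B.Nondegenerate)
  (b : Module.Basis ι ℂ H) {A : Type} [CommRing A] [Algebra ℂ A]

include hsymm in
theorem evalNil_pderiv_transform {R : PowerSeries (Module.End ℂ H)} (hR : R ∈ lowerGroup B hB)
    {x : ι × ℕ → ℂ} (hx : ∀ i, 2 ≤ i.2 → x i = 0) {K : ℕ} (hK : 2 ≤ K) {t t' : ι × ℕ → A}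
    (ht : IsNilTuple K t) (ht' : IsNilTuple K t')
    (h : ∀ j, t j = ∑ i ∈ lvl ι K, mat b R j i • t' i) (F : MvPowerSeries (ι × ℕ) ℂ)
    {i : ι × ℕ} (hi : i.2 < K) :
    evalNil (pd i (transform B b R x F)) t' = ∑ j ∈ lvl ι K, mat b R j i • evalNil (pd j F) t +
      ∑ j ∈ lvl ι K, wMat B b R j i • (algebraMap ℂ A (x j) + t' j) := by
  rw [transform, pd, map_add, evalNil_add ht']
  congr 1
  · rw [pderiv_subst_eq_sum (isLow_mat b R) hi, evalNil_sum ht']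
    refine sum_congr rfl fun j _ => ?_
    rw [evalNil_mul ht', evalNil_C ht', evalNil_subst ht' (isLow_mat b R) ht h, Algebra.smul_def]
  · rw [evalNil_congr ht' (pderiv_quad_congr (wMat_symm b hsymm hB hR) hx hK hi), evalNil_sum ht']
    refine sum_congr rfl fun j _ => ?_
    rw [evalNil_mul ht', evalNil_C ht', wMat_symm b hsymm hB hR i, qVar, evalNil_add ht',
      evalNil_C ht', evalNil_X ht', Algebra.smul_def]

variable {S : PowerSeries (Module.End ℂ H)} {one u : H}

omit [DecidableEq ι] [FiniteDimensional ℂ H] in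
theorem mat_basePt_eq (hS0 : PowerSeries.coeff 0 S = 1) {K : ℕ} (hK : 2 ≤ K) (j : ι × ℕ) :
    ∑ i ∈ lvl ι K, mat b S j i * basePt b one u i =
      basePt b one (u - PowerSeries.coeff 1 S one) j := by
  rw [sum_mat_basePt b S one u j hK, hS0]
  rfl

/-- The coordinates of a point relative to the base point. -/
def tCoord (b : Module.Basis ι ℂ H) (one u : H) (f : Loop (A ⊗[ℂ] H)) (i : ι × ℕ) : A :=
  qCoord b A f i - algebraMap ℂ A (basePt b one u i)

omit [FiniteDimensional ℂ H] in
omit [DecidableEq ι] in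
theorem tCoord_actBase (hS0 : PowerSeries.coeff 0 S = 1) {f : Loop (A ⊗[ℂ] H)} {K : ℕ}
    (hK : 2 ≤ K) (hf : f.BoundedBy K) (j : ι × ℕ) :
    tCoord b one (u - PowerSeries.coeff 1 S one) (actBase A S f) j =
      ∑ i ∈ lvl ι K, mat b S j i • tCoord b one u f i := by
  simp only [tCoord, smul_sub, sum_sub_distrib]
  rw [qCoord_actBase hf, ← mat_basePt_eq b hS0 hK, map_sum]
  simp only [Algebra.smul_def, map_mul]

omit [FiniteDimensional ℂ H] in
omit [Fintype ι] [DecidableEq ι] in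
theorem isNilTuple_tCoord {f : Loop (A ⊗[ℂ] H)} {K : ℕ} (hK : 2 ≤ K) (hf : f.BoundedBy K)
    (h : ∀ i, IsNilpotent (tCoord b one u f i)) : IsNilTuple K (tCoord b one u f) where
  nilpotent := h
  eq_zero i hi := by
    rw [tCoord, qCoord_eq_zero hf hi, basePt_eq_zero b one u (hK.trans hi), map_zero, sub_zero]

include hsymm in
-- Modulo nilpotency, which linear maps preserve in both directions, membership means that the
-- defect p - dF vanishes. The defects of f and Sf are related by the transpose of the matrix of R,
-- whose inverse is the transpose of that of S.
theorem actBase_mem_cone_iff (hS : S ∈ lowerGroup B hB) (hS' : adjNeg B hB S ∈ lowerGroup B hB)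
    (hSR : S * adjNeg B hB S = 1) (F : MvPowerSeries (ι × ℕ) ℂ) (f : Loop (A ⊗[ℂ] H)) :
    actBase A S f ∈ cone B b one (u - PowerSeries.coeff 1 S one)
        (transform B b (adjNeg B hB S) (basePt b one (u - PowerSeries.coeff 1 S one)) F) A ↔
      f ∈ cone B b one u F A := by
  set R := adjNeg B hB S with hR
  set u' := u - PowerSeries.coeff 1 S one with hu'
  have hu : u' - PowerSeries.coeff 1 R one = u := by
    have := congrArg (PowerSeries.coeff 1) hSR
    rw [PowerSeries.coeff_mul, PowerSeries.coeff_one, Finset.Nat.antidiagonal_succ] at this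
    simp [hS.1, hS'.1] at this
    have h2 := congrArg (fun φ : Module.End ℂ H => φ one) this
    simp only [LinearMap.add_apply, LinearMap.zero_apply] at h2
    rw [hu', sub_sub, add_comm, h2, sub_zero]
  have hff : actBase A R (actBase A S f) = f := actBase_actBase_of_mul_eq_one A hS.2 f
  have htt : ∀ K, 2 ≤ K → f.BoundedBy K → ∀ j, tCoord b one u f j =
      ∑ i ∈ lvl ι K, mat b R j i • tCoord b one u' (actBase A S f) i := fun K hK hf j => by
    have := tCoord_actBase (u := u') (one := one) b hS'.1 hK (hf.actBase S) j
    rwa [hu, hff] at this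
  -- The contributions of W to the momenta of Sf and to the differential of the transform are
  -- identical and cancel.
  have hkey : ∀ K, 2 ≤ K → f.BoundedBy K → IsNilTuple K (tCoord b one u f) →
      IsNilTuple K (tCoord b one u' (actBase A S f)) → ∀ i : ι × ℕ, i.2 < K →
      pCoord B b A (actBase A S f) i - evalNil (pd i (transform B b R (basePt b one u') F))
          (tCoord b one u' (actBase A S f)) =
        ∑ j ∈ lvl ι K, mat b R j i •
          (pCoord B b A f j - evalNil (pd j F) (tCoord b one u f)) := by
    intro K hK hf ht ht' i hi
    rw [pCoord_actBase hsymm hB hS.2 hf hi, evalNil_pderiv_transform hsymm hB b hS'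
      (fun i hi => basePt_eq_zero b one u' hi) hK ht ht' (htt K hK hf) F hi, ← hR]
    simp only [smul_sub, sum_sub_distrib]
    have : ∀ j, algebraMap ℂ A (basePt b one u' j) + tCoord b one u' (actBase A S f) j =
        qCoord b A (actBase A S f) j := fun j => add_sub_cancel _ _
    simp only [this]
    ring
  obtain ⟨K₀, hK₀, hf₀⟩ := f.exists_bound 2
  have hbd : ∀ K ≥ K₀, f.BoundedBy K := fun K hK n hn => hf₀ n (by omega)
  have hnil : (∀ i, IsNilpotent (tCoord b one u' (actBase A S f) i)) ↔
      ∀ i, IsNilpotent (tCoord b one u f i) := by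
    constructor
    · intro h
      exact (isNilTuple_of_eq (isNilTuple_tCoord b hK₀ ((hbd _ le_rfl).actBase S) h)
        (isLow_mat b R) (htt K₀ hK₀ (hbd _ le_rfl))).nilpotent
    · intro h
      exact (isNilTuple_of_eq (isNilTuple_tCoord b hK₀ (hbd _ le_rfl) h)
        (isLow_mat b S) (tCoord_actBase b hS.1 hK₀ (hbd _ le_rfl))).nilpotent
  change ((∀ i, IsNilpotent (tCoord b one u' (actBase A S f) i)) ∧ ∀ i, _ =
    evalNil _ (tCoord b one u' (actBase A S f))) ↔ ((∀ i, IsNilpotent (tCoord b one u f i)) ∧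
      ∀ i, _ = evalNil _ (tCoord b one u f))
  rw [hnil]
  refine and_congr_right fun h => ?_
  have ht : ∀ K ≥ K₀, IsNilTuple K (tCoord b one u f) := fun K hK =>
    isNilTuple_tCoord b (hK₀.trans hK) (hbd K hK) h
  have ht' : ∀ K ≥ K₀, IsNilTuple K (tCoord b one u' (actBase A S f)) := fun K hK =>
    isNilTuple_tCoord b (hK₀.trans hK) ((hbd K hK).actBase S) (hnil.2 h)
  have hk : ∀ K ≥ K₀, ∀ i : ι × ℕ, i.2 < K → _ := fun K hK =>
    hkey K (hK₀.trans hK) (hbd K hK) (ht K hK) (ht' K hK)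
  constructor
  · intro hp l
    set K := max K₀ (l.2 + 1)
    have hK : K ≥ K₀ := le_max_left _ _
    have hl : l.2 < K := lt_of_lt_of_le (Nat.lt_succ_self _) (le_max_right _ _)
    rw [← sub_eq_zero]
    have h1 : ∑ i ∈ lvl ι K, mat b S i l • ∑ j ∈ lvl ι K, mat b R j i •
        (pCoord B b A f j - evalNil (pd j F) (tCoord b one u f)) = 0 :=
      sum_eq_zero fun i hi => by
        rw [← hk K hK i (mem_lvl.1 hi), hp, sub_self, smul_zero]
    -- Inverting the transposed matrix recovers the defect of f. K was chosen beyond the level of l,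
    -- so the truncated product is exact there.
    have h2 : ∀ j, ∑ i ∈ lvl ι K, mat b R j i * mat b S i l = if j = l then 1 else 0 := fun j => by
      rw [mat_mul b S R j l hl, hS.2, mat_one]
    rw [← h1]
    simp only [smul_sum, smul_smul]
    rw [sum_comm]
    simp only [← sum_smul, mul_comm (mat b S _ l), h2, ite_smul, one_smul, zero_smul]
    rw [sum_ite_eq', if_pos (mem_lvl.2 hl)]
  · intro hp i
    have := hk (max K₀ (i.2 + 1)) (le_max_left _ _) i
      (lt_of_lt_of_le (Nat.lt_succ_self _) (le_max_right _ _))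
    rw [sum_eq_zero fun j _ => by rw [hp, sub_self, smul_zero]] at this
    exact sub_eq_zero.1 this

/-- The point with prescribed Darboux coordinates. -/
def pointOfCoords (B : LinearMap.BilinForm ℂ H) (b : Module.Basis ι ℂ H) (K : ℕ)
    (q p : ι × ℕ → A) : Loop (A ⊗[ℂ] H) :=
  ⟨fun n => if 0 ≤ n then (if n < K then ∑ α, q (α, n.toNat) ⊗ₜ b α else 0) else
    ∑ α, ((-1) ^ ((-n - 1).toNat + 1) * p (α, (-n - 1).toNat)) ⊗ₜ dualVec B b α,
    K, fun n hn => (if_pos (by omega)).trans (if_neg (by omega))⟩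

omit [FiniteDimensional ℂ H] in
theorem qCoord_pointOfCoords {K : ℕ} {q p : ι × ℕ → A} (hq : ∀ i, K ≤ i.2 → q i = 0)
    (i : ι × ℕ) : qCoord b A (pointOfCoords B b K q p) i = q i := by
  rw [qCoord, pointOfCoords]
  simp only [Int.natCast_nonneg, if_true, Int.toNat_natCast]
  split_ifs with h
  · rw [map_sum, Finsupp.finsetSum_apply]
    simp [Module.Basis.baseChange_repr_tmul, Finsupp.single_apply]
  · rw [hq i (by omega)]
    simp

omit [FiniteDimensional ℂ H] in
include hB in
theorem pCoord_pointOfCoords {K : ℕ} {q p : ι × ℕ → A} (i : ι × ℕ) :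
    pCoord B b A (pointOfCoords B b K q p) i = p i := by
  have h0 : ¬ (0 : ℤ) ≤ -(i.2 : ℤ) - 1 := by omega
  have h1 : (-(-(i.2 : ℤ) - 1) - 1).toNat = i.2 := by omega
  rw [pCoord, pointOfCoords]
  simp only [h0, if_false, h1]
  rw [map_sum, LinearMap.sum_apply]
  simp only [Module.Basis.baseChange_apply, LinearMap.BilinForm.baseChange_tmul,
    bilin_dualVec_left hB, Module.Basis.repr_self, Finsupp.single_apply, ite_smul, zero_smul,
    one_smul]
  rw [sum_ite_eq, if_pos (mem_univ _), mul_one, ← mul_assoc, ← mul_pow]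
  simp

omit [FiniteDimensional ℂ H] in
include hB in
/-- A formal theory is determined by its cone. -/
theorem eq_of_cone_eq {F F' : MvPowerSeries (ι × ℕ) ℂ} (hF : F ∈ GW0 B b one u)
    (hF' : F' ∈ GW0 B b one u)
    (h : ∀ (A : Type) [CommRing A] [Algebra ℂ A], cone B b one u F A = cone B b one u F' A) :
    F = F' := by
  -- Every nilpotent tuple lifts to a point of the cone of F; its momenta are the values of dF, and
  -- membership in the other cone makes them values of dF'.
  have hpd : ∀ i, pd i F = pd i F' := fun i => by
    refine eq_of_evalNil_eq fun A _ _ K t ht => ?_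
    set f := pointOfCoords B b (max K 2) (fun j => algebraMap ℂ A (basePt b one u j) + t j)
      (fun j => evalNil (pd j F) t)
    have hq : ∀ j, qCoord b A f j - algebraMap ℂ A (basePt b one u j) = t j := fun j => by
      rw [qCoord_pointOfCoords b, add_sub_cancel_left]
      intro j hj
      rw [basePt_eq_zero b one u ((le_max_right _ _).trans hj),
        ht.eq_zero j ((le_max_left _ _).trans hj), map_zero, add_zero]
    have hp : ∀ j, pCoord B b A f j = evalNil (pd j F) t := pCoord_pointOfCoords hB b
    have hf : f ∈ cone B b one u F A := by
      refine ⟨fun j => by rw [hq]; exact ht.nilpotent j, fun j => ?_⟩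
      simp only [hq, hp]
    rw [h A] at hf
    have := hf.2 i
    simp only [hq, hp] at this
    exact this
  -- The dilaton equation expresses 2F through dF, so not even a constant is left undetermined.
  ext m
  have h1 := hF.1 m
  have h2 := hF'.1 m
  simp only [hpd] at h1
  rw [h1] at h2
  exact mul_left_cancel₀ two_ne_zero h2

include hsymm in
theorem coneAction_transform (hS : S ∈ lowerGroup B hB) (hS' : adjNeg B hB S ∈ lowerGroup B hB)
    (hSR : S * adjNeg B hB S = 1) {F : MvPowerSeries (ι × ℕ) ℂ} (hF : F ∈ GW0 B b one u) :
    ConeAction B b one u S F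
      (transform B b (adjNeg B hB S) (basePt b one (u - PowerSeries.coeff 1 S one)) F) := by
  have hu : u - PowerSeries.coeff 1 S one - PowerSeries.coeff 1 (adjNeg B hB S) one = u := by
    have := congrArg (PowerSeries.coeff 1) hSR
    rw [PowerSeries.coeff_mul, PowerSeries.coeff_one, Finset.Nat.antidiagonal_succ] at this
    simp [hS.1, hS'.1] at this
    have h2 := congrArg (fun φ : Module.End ℂ H => φ one) this
    simp only [LinearMap.add_apply, LinearMap.zero_apply] at h2
    rw [sub_sub, add_comm, h2, sub_zero]
  refine ⟨transform_mem_GW0 b hsymm hB hS' (by rwa [hu]), fun A _ _ => ?_⟩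
  ext f
  constructor
  · rintro ⟨f, hf, rfl⟩
    exact (actBase_mem_cone_iff hsymm hB b hS hS' hSR F f).2 hf
  · intro hf
    have hff := actBase_actBase_of_mul_eq_one A hSR f
    refine ⟨actBase A (adjNeg B hB S) f, ?_, hff⟩
    rw [← actBase_mem_cone_iff hsymm hB b hS hS' hSR F, hff]
    exact hf

omit [FiniteDimensional ℂ H] in
include hB in
theorem ConeAction.unique {F F' F'' : MvPowerSeries (ι × ℕ) ℂ}
    (h : ConeAction B b one u S F F') (h' : ConeAction B b one u S F F'') : F' = F'' :=
  eq_of_cone_eq hB b h.1 h'.1 fun A _ _ => (h.2 A).symm.trans (h'.2 A)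

end Cone

/-! ### The quantized Hamiltonian in Darboux coordinates. -/

section Hamiltonian

variable {ι H : Type*} [Fintype ι] [DecidableEq ι] [AddCommGroup H] [Module ℂ H]
  {B : LinearMap.BilinForm ℂ H} (hsymm : B.IsSymm) (hB : B.Nondegenerate)
  (b : Module.Basis ι ℂ H)

omit [Fintype ι] [DecidableEq ι] in
theorem omega_qVec_right (f : Loop H) (j : ι × ℕ) :
    omega B f (qVec b j) = (-1 : ℂ) ^ (j.2 + 1) * B (f.1 (-1 - j.2)) (b j.1) := by
  rw [omega, finsum_eq_single _ (-1 - (j.2 : ℤ))]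
  · have h : (-1 : ℂ) ^ (-1 - (j.2 : ℤ)) = (-1 : ℂ) ^ (j.2 + 1) := by
      rw [show -1 - (j.2 : ℤ) = -((j.2 + 1 : ℕ) : ℤ) by push_cast; ring, zpow_neg, zpow_natCast,
        ← inv_pow]
      norm_num
    rw [h, qVec]
    simp
  · intro n hn
    simp only [qVec]
    rw [if_neg (by omega), map_zero, mul_zero]

include hsymm hB in
theorem omega_pVec_right (f : Loop H) (j : ι × ℕ) :
    omega B f (pVec B b j) = -b.repr (f.1 j.2) j.1 := by
  rw [omega, finsum_eq_single _ (j.2 : ℤ)]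
  · simp only [pVec]
    rw [if_pos (by omega), map_smul, hsymm.eq, bilin_dualVec_left hB, zpow_natCast, smul_eq_mul,
      ← mul_assoc, ← pow_add, show j.2 + (j.2 + 1) = 2 * j.2 + 1 by ring, pow_succ, pow_mul]
    simp
  · intro n hn
    simp only [pVec]
    rw [if_neg (by omega), map_zero, mul_zero]

omit [Fintype ι] [DecidableEq ι] in
theorem act_qVec (M : ℕ → Module.End ℂ H) (i : ι × ℕ) {n : ℤ} {s : ℕ} (h : n + s = i.2) :
    (Loop.act M (qVec b i)).1 n = M s (b i.1) := by
  change ∑ᶠ r : ℕ, M r (if n + r = i.2 then b i.1 else 0) = _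
  rw [finsum_eq_single _ s, if_pos h]
  intro r hr
  rw [if_neg (by omega), map_zero]

omit [Fintype ι] [DecidableEq ι] in
theorem act_qVec_eq_zero (M : ℕ → Module.End ℂ H) (i : ι × ℕ) {n : ℤ} (h : (i.2 : ℤ) < n) :
    (Loop.act M (qVec b i)).1 n = 0 :=
  Loop.act_eq_zero M (N := i.2 + 1) (fun _ hk => if_neg (by omega)) (by omega)

theorem act_pVec (M : ℕ → Module.End ℂ H) (i : ι × ℕ) {n : ℤ} {s : ℕ} (h : n + s = -i.2 - 1) :
    (Loop.act M (pVec B b i)).1 n = (-1 : ℂ) ^ (i.2 + 1) • M s (dualVec B b i.1) := by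
  change ∑ᶠ r : ℕ, M r (if n + r = -i.2 - 1 then (-1 : ℂ) ^ (i.2 + 1) • dualVec B b i.1 else 0) = _
  rw [finsum_eq_single _ s, if_pos h, map_smul]
  intro r hr
  rw [if_neg (by omega), map_zero]

theorem act_pVec_eq_zero (M : ℕ → Module.End ℂ H) (i : ι × ℕ) {n : ℤ} (h : -(i.2 : ℤ) - 1 < n) :
    (Loop.act M (pVec B b i)).1 n = 0 :=
  Loop.act_eq_zero M (N := -i.2) (fun _ hk => if_neg (by omega)) (by omega)

variable [FiniteDimensional ℂ H]

include hsymm in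
omit [Fintype ι] [DecidableEq ι] in
theorem bilin_coeff_lowerAlgebra {a : PowerSeries (Module.End ℂ H)} (ha : a ∈ lowerAlgebra B hB)
    (n : ℕ) (v w : H) : B (PowerSeries.coeff n a v) w =
      (-1 : ℂ) ^ (n + 1) * B v (PowerSeries.coeff n a w) := by
  have := leftAdjoint_apply B hB (PowerSeries.coeff n a) w v
  rw [ha.2, LinearMap.smul_apply, map_smul, LinearMap.smul_apply, smul_eq_mul] at this
  rw [hsymm.eq, ← this, hsymm.eq]

/-- The part of `H_a` quadratic in the coordinates `q`. -/
def hMat (B : LinearMap.BilinForm ℂ H) (b : Module.Basis ι ℂ H)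
    (a : PowerSeries (Module.End ℂ H)) (i j : ι × ℕ) : ℂ :=
  (-1 : ℂ) ^ (j.2 + 1) * B (PowerSeries.coeff (i.2 + j.2 + 1) a (b i.1)) (b j.1)

variable {a : PowerSeries (Module.End ℂ H)} (ha : a ∈ lowerAlgebra B hB)

include hsymm ha in
omit [Fintype ι] [DecidableEq ι] in
theorem hamPolar_qVec_qVec (i j : ι × ℕ) :
    hamPolar B a (qVec b i) (qVec b j) = hMat B b a i j := by
  rw [hamPolar, omega_qVec_right, omega_qVec_right, act_qVec b _ i (s := i.2 + j.2 + 1)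
    (by push_cast; ring), act_qVec b _ j (s := i.2 + j.2 + 1) (by push_cast; ring), hMat,
    bilin_coeff_lowerAlgebra hsymm hB ha _ (b j.1), hsymm.eq (b j.1), ← mul_assoc, ← pow_add,
    show i.2 + 1 + (i.2 + j.2 + 1 + 1) = 2 * (i.2 + 1) + (j.2 + 1) by ring, pow_add _ (2 * _), pow_mul]
  norm_num
  ring

include hsymm ha in
theorem hamPolar_qVec_pVec (i j : ι × ℕ) :
    hamPolar B a (qVec b i) (pVec B b j) = -mat b a j i := by
  rw [hamPolar, omega_qVec_right, omega_pVec_right hsymm hB, mat]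
  split_ifs with h
  · obtain ⟨s, hs⟩ : ∃ s, i.2 = j.2 + s := ⟨i.2 - j.2, by omega⟩
    rw [act_qVec b _ i (s := s) (by omega), act_pVec b _ j (s := s) (by omega), map_smul,
      LinearMap.smul_apply, bilin_coeff_lowerAlgebra hsymm hB ha, bilin_dualVec_left hB, smul_eq_mul,
      hs, Nat.add_sub_cancel_left, ← mul_assoc, ← mul_assoc, ← pow_add, ← pow_add,
      show j.2 + s + 1 + (j.2 + 1) + (s + 1) = 2 * (j.2 + s + 1) + 1 by ring, pow_succ, pow_mul]
    norm_num
    ring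
  · rw [act_qVec_eq_zero b _ i (by omega), act_pVec_eq_zero b _ j (by omega)]
    simp

omit [FiniteDimensional ℂ H] in
include hsymm hB in
-- A series in z⁻¹ maps negative powers of z to negative powers, and these are isotropic for Ω.
-- Hence the quantized operator has order one.
theorem hamPolar_pVec_pVec (i j : ι × ℕ) (a : PowerSeries (Module.End ℂ H)) :
    hamPolar B a (pVec B b i) (pVec B b j) = 0 := by
  rw [hamPolar, omega_pVec_right hsymm hB, omega_pVec_right hsymm hB,
    act_pVec_eq_zero b _ i (by omega), act_pVec_eq_zero b _ j (by omega)]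
  simp

omit [DecidableEq ι] [Fintype ι] in
-- An order one operator conjugated by e^f and applied to 1 is linear in f up to a source, so
-- different powers of ħ do not interact.
theorem conjDeriv_one (f : HbarSeries ι) (i : ι × ℕ) (n : ℤ) :
    (conjDeriv f i 1).coeff n = pd i (f.coeff n) := by
  rw [conjDeriv, mul_one, HahnSeries.coeff_add, HahnSeries.map_coeff, HahnSeries.map_coeff,
    HahnSeries.coeff_one]
  split_ifs <;> simp

include hsymm ha in
/-- The right hand side of the flow equation, in coordinates that move with the base point. -/
theorem quantHam_add {x : ι × ℕ → ℂ} {one u : H} (hx : x = basePt b one u) (f : HbarSeries ι)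
    (n : ℤ) (m : ι × ℕ →₀ ℕ) :
    quantHam B b x a f 1 n m + ∑ α, b.repr (-(PowerSeries.coeff 1 a one)) α *
        coeff m (pd (α, 0) (f.coeff n)) =
      (if n = -1 then coeff m (quad (hMat B b a) x) else 0) -
        coeff m (flowOp (mat b a) (f.coeff n)) := by
  have hx2 : ∀ i, 2 ≤ i.2 → x i = 0 := fun i hi => by rw [hx, basePt_eq_zero b one u hi]
  obtain ⟨k, hk⟩ := exists_support_subset_lvl m
  set K := max k 2
  have hm : m.support ⊆ lvl ι K := hk _ (le_max_left _ _)
  have hK : 2 ≤ K := le_max_right _ _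
  have h1 : 1 / 2 * ∑ᶠ ij : (ι × ℕ) × (ι × ℕ), hamPolar B a (qVec b ij.1) (qVec b ij.2) *
      coeff m (qVar x ij.1 * qVar x ij.2 * (1 : HbarSeries ι).coeff (n + 1)) =
      if n = -1 then coeff m (quad (hMat B b a) x) else 0 := by
    rw [HahnSeries.coeff_one]
    split_ifs with h h' h'
    · simp only [mul_one, coeff_quad_eq_finsum hx2, hamPolar_qVec_qVec hsymm hB b ha]
    · omega
    · omega
    · simp
  have h2 : ∑ᶠ ij : (ι × ℕ) × (ι × ℕ), hamPolar B a (qVec b ij.1) (pVec B b ij.2) *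
      coeff m (qVar x ij.1 * (conjDeriv f ij.2 1).coeff n) =
      -(∑ i ∈ lvl ι K, ∑ j ∈ lvl ι K, mat b a j i * coeff m (qVar x i * pd j (f.coeff n))) := by
    simp only [hamPolar_qVec_pVec hsymm hB b ha, conjDeriv_one]
    rw [finsum_eq_sum_of_support_subset (s := lvl ι K ×ˢ lvl ι K), sum_product, ← sum_neg_distrib]
    · simp only [neg_mul, sum_neg_distrib]
    · intro p hp
      rw [mem_coe, mem_product, mem_lvl, mem_lvl]
      have h1 : p.1.2 < K := by
        by_contra h
        exact hp (by simp only [coeff_qVar_mul_lvl hx2 hK hm (not_lt.1 h), mul_zero])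
      refine ⟨h1, lt_of_le_of_lt ?_ h1⟩
      by_contra h
      exact hp (by simp only [isLow_mat b a _ _ (not_le.1 h), neg_zero, zero_mul])
  -- The velocity of the base point is [ax]₊ = -a₁𝟏. It cancels the constant part of the vector
  -- field, so the coefficient q_i = x_i + X_i becomes X_i.
  have h3 : ∑ α, b.repr (-(PowerSeries.coeff 1 a one)) α * coeff m (pd (α, 0) (f.coeff n)) =
      ∑ i ∈ lvl ι K, ∑ j ∈ lvl ι K, mat b a j i * (x i * coeff m (pd j (f.coeff n))) := by
    rw [sum_comm]
    have : ∀ j, ∑ i ∈ lvl ι K, mat b a j i * (x i * coeff m (pd j (f.coeff n))) =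
        basePt b 0 (-(PowerSeries.coeff 1 a one)) j * coeff m (pd j (f.coeff n)) := fun j => by
      have h := sum_mat_basePt b a one u j hK
      rw [ha.1] at h
      simp only [LinearMap.zero_apply, zero_sub] at h
      rw [← h, sum_mul, hx]
      simp only [mul_assoc]
    simp only [this]
    rw [sum_lvl]
    symm
    rw [sum_eq_single 0]
    · simp [basePt]
    · intro l _ hl
      simp [basePt, hl]
    · intro h
      exact absurd (mem_range.2 (by omega)) h
  have h4 : coeff m (flowOp (mat b a) (f.coeff n)) =
      ∑ i ∈ lvl ι K, ∑ j ∈ lvl ι K, mat b a j i * coeff m (X i * pd j (f.coeff n)) := by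
    rw [flowOp_congr_sum (isLow_mat b a) K m.degree _ m hm le_rfl, map_sum]
    refine sum_congr rfl fun i _ => ?_
    rw [mul_sum, map_sum]
    refine sum_congr rfl fun j _ => ?_
    rw [mul_left_comm, coeff_C_mul]
  rw [quantHam, h1, h2, h3, h4]
  simp only [hamPolar_pVec_pVec hsymm hB, zero_mul, finsum_zero, mul_zero, add_zero, qVar, add_mul,
    map_add, coeff_C_mul, mul_add, sum_add_distrib]
  ring

end Hamiltonian

/-! ### Uniqueness of the flow through a weight filtration. -/

section Uniqueness

variable {ι : Type*} [Fintype ι]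

/-- The weight of a monomial, in which a variable counts with its level. -/
def weight (m : ι × ℕ →₀ ℕ) : ℕ := m.sum fun i e => e * i.2

omit [Fintype ι] in
theorem weight_add (m m' : ι × ℕ →₀ ℕ) : weight (m + m') = weight m + weight m' :=
  Finsupp.sum_add_index' (fun _ => by simp) fun _ _ _ => by ring

omit [Fintype ι] in
theorem weight_single (i : ι × ℕ) : weight (Finsupp.single i 1) = i.2 := by
  simp [weight]

/-- The term X_i ∂_j reads the coefficient of the monomial in which one X_i is traded for an X_j of
strictly lower level, so only smaller weights enter. -/
theorem coeff_flowOp_eq_zero {A : ι × ℕ → ι × ℕ → ℂ} (hA : ∀ j i, i.2 ≤ j.2 → A j i = 0)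
    {G : MvPowerSeries (ι × ℕ) ℂ} {m : ι × ℕ →₀ ℕ}
    (hG : ∀ m', weight m' < weight m → coeff m' G = 0) : coeff m (flowOp A G) = 0 := by
  classical
  change coeff m (∑ i ∈ m.support, X i * ∑ j ∈ lvl ι (i.2 + 1), C (A j i) * pderiv ℂ j G) = 0
  rw [map_sum]
  refine sum_eq_zero fun i hi => ?_
  rw [X_def, coeff_monomial_mul]
  split_ifs with h
  · rw [map_sum, mul_sum]
    refine sum_eq_zero fun j _ => ?_
    rw [coeff_C_mul, coeff_pderiv]
    by_cases hj : i.2 ≤ j.2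
    · rw [hA j i hj]
      simp
    · rw [hG, zero_mul, mul_zero, mul_zero]
      have := weight_add (m - Finsupp.single i 1) (Finsupp.single i 1)
      rw [tsub_add_cancel_of_le h, weight_single] at this
      rw [weight_add, weight_single]
      omega
  · rfl

/-- A solution of a linear flow that strictly lowers weights is determined by its initial value. -/
theorem eq_zero_of_flow {A : ι × ℕ → ι × ℕ → ℂ} (hA : ∀ j i, i.2 ≤ j.2 → A j i = 0)
    {Y : ℝ → MvPowerSeries (ι × ℕ) ℂ} (hY : ∀ ε, HasCoeffDerivAt Y (-flowOp A (Y ε)) ε)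
    (h0 : Y 0 = 0) (ε : ℝ) : Y ε = 0 := by
  -- Once all smaller weights vanish for all times, a coefficient has zero derivative and keeps its
  -- initial value.
  have key : ∀ N, ∀ m, weight m < N → ∀ ε, coeff m (Y ε) = 0 := by
    intro N
    induction N with
    | zero => exact fun m hm => absurd hm (Nat.not_lt_zero _)
    | succ N ih =>
      intro m hm ε
      have hd : ∀ ε, HasDerivAt (fun e => coeff m (Y e)) 0 ε := fun ε => by
        refine (hY ε m).congr_deriv ?_
        rw [map_neg, coeff_flowOp_eq_zero hA fun m' hm' => ih m' (by omega) ε, neg_zero]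
      have := is_const_of_deriv_eq_zero (fun ε => (hd ε).differentiableAt)
        (fun ε => (hd ε).deriv) ε 0
      simpa [h0] using this
  ext m
  exact key _ m (Nat.lt_succ_self _) ε

end Uniqueness

/-! ### Time derivatives of exp(-εa). -/

section Derivative

variable {H : Type*} [AddCommGroup H] [Module ℂ H] {a : PowerSeries (Module.End ℂ H)}

theorem hasDerivAt_coeff_expSeries (ha : PowerSeries.coeff 0 a = 0) (k : ℕ)
    (φ : Module.End ℂ H →ₗ[ℂ] ℂ) (ε : ℝ) :
    HasDerivAt (fun e : ℝ => φ (PowerSeries.coeff k (expSeries ((e : ℂ) • a))))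
      (φ (PowerSeries.coeff k (expSeries ((ε : ℂ) • a) * a))) ε := by
  have h0 : ∀ s : ℂ, PowerSeries.coeff 0 (s • a) = 0 := fun s => by simp [ha]
  have hp : ∀ (s : ℂ) (n k : ℕ),
      PowerSeries.coeff k ((s • a) ^ n) = s ^ n • PowerSeries.coeff k (a ^ n) := fun s n k => by
    rw [smul_pow]; simp
  have h1 : ∀ e : ℝ, φ (PowerSeries.coeff k (expSeries ((e : ℂ) • a))) =
      ∑ n ∈ range (k + 1), (e : ℂ) ^ n * ((n.factorial : ℂ)⁻¹ * φ (PowerSeries.coeff k (a ^ n))) :=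
    fun e => by
      rw [coeff_expSeries (h0 _) (Nat.lt_succ_self k), map_sum]
      refine sum_congr rfl fun n _ => ?_
      rw [map_smul, hp, map_smul, smul_eq_mul, smul_eq_mul]
      ring
  have h2 : φ (PowerSeries.coeff k (expSeries ((ε : ℂ) • a) * a)) = ∑ n ∈ range (k + 1),
      (ε : ℂ) ^ n * ((n.factorial : ℂ)⁻¹ * φ (PowerSeries.coeff k (a ^ (n + 1)))) := by
    have : PowerSeries.coeff k (expSeries ((ε : ℂ) • a) * a) = ∑ n ∈ range (k + 1),
        ((n.factorial : ℂ)⁻¹ * (ε : ℂ) ^ n) • PowerSeries.coeff k (a ^ (n + 1)) := by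
      simp only [pow_succ a, PowerSeries.coeff_mul, smul_sum]
      rw [sum_comm]
      refine sum_congr rfl fun p hp' => ?_
      rw [HasAntidiagonal.mem_antidiagonal] at hp'
      rw [coeff_expSeries (h0 _) (show p.1 < k + 1 by omega), sum_mul]
      refine sum_congr rfl fun n _ => ?_
      rw [hp, smul_mul_assoc, smul_mul_assoc, smul_smul]
    rw [this, map_sum]
    refine sum_congr rfl fun n _ => ?_
    rw [map_smul, smul_eq_mul]
    ring
  simp only [h1]
  rw [h2, sum_range_succ, coeff_pow_eq_zero_of_lt ha (Nat.lt_succ_self k), map_zero, mul_zero,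
    mul_zero, add_zero]
  have h3 : ∀ n : ℕ, HasDerivAt (fun e : ℝ => (e : ℂ) ^ n * ((n.factorial : ℂ)⁻¹ *
      φ (PowerSeries.coeff k (a ^ n)))) ((n : ℂ) * (ε : ℂ) ^ (n - 1) * ((n.factorial : ℂ)⁻¹ *
      φ (PowerSeries.coeff k (a ^ n)))) ε := fun n =>
    ((hasDerivAt_pow n (ε : ℂ)).comp_ofReal).mul_const _
  refine (HasDerivAt.fun_sum fun n _ => h3 n).congr_deriv ?_
  rw [sum_range_succ', Nat.cast_zero, zero_mul, zero_mul, add_zero]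
  refine sum_congr rfl fun n _ => ?_
  rw [Nat.add_sub_cancel, Nat.factorial_succ, Nat.cast_mul, mul_inv]
  have : ((n + 1 : ℕ) : ℂ) ≠ 0 := Nat.cast_ne_zero.2 (Nat.succ_ne_zero n)
  field_simp

variable {ι : Type*} [Fintype ι] (b : Module.Basis ι ℂ H)

theorem hasDerivAt_mat_expSeries (ha : PowerSeries.coeff 0 a = 0) (j i : ι × ℕ) (ε : ℝ) :
    HasDerivAt (fun e : ℝ => mat b (expSeries ((e : ℂ) • -a)) j i)
      (-∑ k ∈ lvl ι (i.2 + 1), mat b (expSeries ((ε : ℂ) • -a)) j k * mat b a k i) ε := by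
  rw [mat_mul b a _ j i (Nat.lt_succ_self _)]
  simp only [mat]
  split_ifs with h
  · refine (hasDerivAt_coeff_expSeries (a := -a) (by rw [map_neg, ha, neg_zero]) (i.2 - j.2)
      (b.coord j.1 ∘ₗ LinearMap.applyₗ (b i.1)) ε).congr_deriv ?_
    simp
  · rw [neg_zero]
    exact hasDerivAt_const _ _

variable (B : LinearMap.BilinForm ℂ H)

include b in
theorem hasDerivAt_bilin_expSeries (ha : PowerSeries.coeff 0 a = 0) (s t : ℕ) (v w : H) (ε : ℝ) :
    HasDerivAt (fun e : ℝ => B (PowerSeries.coeff s (expSeries ((e : ℂ) • -a)) v)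
        (PowerSeries.coeff t (expSeries ((e : ℂ) • -a)) w))
      (-(B (PowerSeries.coeff s (expSeries ((ε : ℂ) • -a) * a) v)
          (PowerSeries.coeff t (expSeries ((ε : ℂ) • -a)) w) +
        B (PowerSeries.coeff s (expSeries ((ε : ℂ) • -a)) v)
          (PowerSeries.coeff t (expSeries ((ε : ℂ) • -a) * a) w))) ε := by
  classical
  have h : ∀ (k : ℕ) (v : H) (γ : ι), HasDerivAt
      (fun e : ℝ => b.repr (PowerSeries.coeff k (expSeries ((e : ℂ) • -a)) v) γ)
      (-b.repr (PowerSeries.coeff k (expSeries ((ε : ℂ) • -a) * a) v) γ) ε := fun k v γ => by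
    refine (hasDerivAt_coeff_expSeries (a := -a) (by rw [map_neg, ha, neg_zero]) k
      (b.coord γ ∘ₗ LinearMap.applyₗ v) ε).congr_deriv ?_
    simp
  rw [bilin_eq_sum b (PowerSeries.coeff s (expSeries ((ε : ℂ) • -a) * a) v),
    bilin_eq_sum b (PowerSeries.coeff s (expSeries ((ε : ℂ) • -a)) v)]
  rw [show (fun e : ℝ => B (PowerSeries.coeff s (expSeries ((e : ℂ) • -a)) v)
    (PowerSeries.coeff t (expSeries ((e : ℂ) • -a)) w)) = _ from
      funext fun e => bilin_eq_sum b _ _]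
  refine (HasDerivAt.fun_sum fun γ _ => HasDerivAt.fun_sum fun δ _ =>
    ((h s v γ).mul (h t w δ)).const_mul (B (b γ) (b δ))).congr_deriv ?_
  rw [← sum_add_distrib, ← sum_neg_distrib]
  refine sum_congr rfl fun γ _ => ?_
  rw [← sum_add_distrib, ← sum_neg_distrib]
  exact sum_congr rfl fun δ _ => by ring

end Derivative

/-! ### W and composition with a Lie algebra element. -/

section WFlow

variable {H : Type*} [AddCommGroup H] [Module ℂ H] (B : LinearMap.BilinForm ℂ H)
  (R a : PowerSeries (Module.End ℂ H)) (k l : ℕ) (v w : H)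

/-- In the first argument only [Ra f]₊ = [R[a f]₊]₊ matters, so no correction arises. -/
theorem sum_wVec_left : ∑ r ∈ range (k + 1), wVec B R (k - r) l (PowerSeries.coeff r a v) w =
    ∑ s ∈ range (k + 1), (-1 : ℂ) ^ (k - s) *
      B (PowerSeries.coeff s (R * a) v) (PowerSeries.coeff (k + l + 1 - s) R w) := by
  have h : ∀ s, (-1 : ℂ) ^ (k - s) *
      B (PowerSeries.coeff s (R * a) v) (PowerSeries.coeff (k + l + 1 - s) R w) =
      ∑ r ∈ range (s + 1), (-1 : ℂ) ^ (k - s) * B (PowerSeries.coeff (s - r) R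
        (PowerSeries.coeff r a v)) (PowerSeries.coeff (k + l + 1 - s) R w) := fun s => by
    rw [PowerSeries.coeff_mul, ← Finset.Nat.sum_antidiagonal_swap,
      Finset.Nat.sum_antidiagonal_eq_sum_range_succ_mk, LinearMap.sum_apply, map_sum,
      LinearMap.sum_apply, mul_sum]
    rfl
  simp only [h]
  rw [sum_comm' (t' := range (k + 1)) (s' := fun r => Ico r (k + 1))
    (by intro s r; simp only [mem_range, mem_Ico]; omega)]
  refine sum_congr rfl fun r hr => ?_
  rw [mem_range] at hr
  rw [sum_Ico_eq_sum_range, wVec, show k + 1 - r = k - r + 1 by omega]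
  refine sum_congr rfl fun s hs => ?_
  rw [mem_range] at hs
  rw [show k - (r + s) = k - r - s by omega, Nat.add_sub_cancel_left,
    show k + l + 1 - (r + s) = k - r + l + 1 - s by omega]

variable {B} [FiniteDimensional ℂ H] (hsymm : B.IsSymm) (hB : B.Nondegenerate) {R}

include hsymm in
-- In the second argument [ag]₋ also contributes. By the symplectic property, Ω([Rf]₊, R[ag]₋) =
-- Ω(Rf, R[ag]₋) = Ω(f, [ag]₋), the last term of the formula. In coordinates, orthogonality kills
-- every r except r = k.
theorem sum_wVec_right (hR : R ∈ lowerGroup B hB) :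
    ∑ s ∈ range (k + 1), (-1 : ℂ) ^ (k - s) *
      B (PowerSeries.coeff s R v) (PowerSeries.coeff (k + l + 1 - s) (R * a) w) =
    ∑ r ∈ range (l + 1), wVec B R k (l - r) v (PowerSeries.coeff r a w) +
      (-1) ^ k * B v (PowerSeries.coeff (k + l + 1) a w) := by
  have h : ∀ s ∈ range (k + 1), (-1 : ℂ) ^ (k - s) *
      B (PowerSeries.coeff s R v) (PowerSeries.coeff (k + l + 1 - s) (R * a) w) =
      ∑ r ∈ range (l + 1), (-1 : ℂ) ^ (k - s) * B (PowerSeries.coeff s R v)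
        (PowerSeries.coeff (k + (l - r) + 1 - s) R (PowerSeries.coeff r a w)) +
      ∑ r ∈ range (k - s + 1), (-1 : ℂ) ^ (k - s) * B (PowerSeries.coeff s R v)
        (PowerSeries.coeff (k - r - s) R (PowerSeries.coeff (l + 1 + r) a w)) := fun s hs => by
    rw [mem_range] at hs
    rw [PowerSeries.coeff_mul, ← Finset.Nat.sum_antidiagonal_swap,
      Finset.Nat.sum_antidiagonal_eq_sum_range_succ_mk, LinearMap.sum_apply, map_sum, mul_sum,
      show (k + l + 1 - s).succ = (l + 1) + (k - s + 1) by omega, sum_range_add]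
    congr 1
    · refine sum_congr rfl fun r hr => ?_
      rw [mem_range] at hr
      rw [show k + (l - r) + 1 - s = k + l + 1 - s - r by omega]
      rfl
    · refine sum_congr rfl fun r hr => ?_
      rw [show k - r - s = k + l + 1 - s - (l + 1 + r) by omega]
      rfl
  rw [sum_congr rfl h, sum_add_distrib]
  congr 1
  · rw [sum_comm]
    rfl
  · rw [sum_comm' (t' := range (k + 1)) (s' := fun r => range (k - r + 1))
      (by intro s r; simp only [mem_range]; omega), sum_eq_single k]
    · simp only [Nat.sub_self, zero_add, sum_range_one, Nat.sub_zero, Nat.zero_sub, hR.1]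
      rw [show l + 1 + k = k + l + 1 by ring]
      rfl
    · intro r hr hrk
      rw [mem_range] at hr
      have := sum_antidiagonal_pairing hsymm hB hR (k - r) v (PowerSeries.coeff (l + 1 + r) a w)
      rw [if_neg (by omega), Finset.Nat.sum_antidiagonal_eq_sum_range_succ_mk] at this
      rw [← mul_zero ((-1 : ℂ) ^ k), ← this, mul_sum]
      refine sum_congr rfl fun s hs => ?_
      rw [mem_range] at hs
      obtain ⟨t, rfl⟩ : ∃ t, k = s + t := ⟨k - s, by omega⟩
      rw [← mul_assoc, ← pow_add, show s + t + s = 2 * s + t by ring, pow_add, pow_mul,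
        Nat.add_sub_cancel_left]
      simp
    · intro hk
      exact absurd (mem_range.2 (Nat.lt_succ_self k)) hk

end WFlow

/-! ### The explicit quantum flow. -/

section Existence

variable {ι H : Type*} [Fintype ι] [DecidableEq ι] [AddCommGroup H] [Module ℂ H]
  [FiniteDimensional ℂ H] {B : LinearMap.BilinForm ℂ H} (hsymm : B.IsSymm) (hB : B.Nondegenerate)
  (b : Module.Basis ι ℂ H) {a : PowerSeries (Module.End ℂ H)} (ha : a ∈ lowerAlgebra B hB)

include ha in
theorem expSeries_smul_neg_mem (ε : ℂ) : expSeries (ε • -a) ∈ lowerGroup B hB :=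
  expSeries_mem_lowerGroup B hB (smul_mem_lowerAlgebra B hB (neg_mem_lowerAlgebra B hB ha) ε)

include hsymm ha in
omit [DecidableEq ι] in
-- With R = exp(-εa) the derivative of R is -Ra, so W changes by -W(a·, ·) - W(·, a·) and by the
-- correction from [ag]₋, which is the qq part of the Hamiltonian.
theorem hasDerivAt_wMat_expSeries {K : ℕ} {i j : ι × ℕ} (hi : i.2 < K) (hj : j.2 < K) (ε : ℝ) :
    HasDerivAt (fun e : ℝ => wMat B b (expSeries ((e : ℂ) • -a)) i j)
      (hMat B b a i j - ∑ k ∈ lvl ι K, mat b a k i * wMat B b (expSeries ((ε : ℂ) • -a)) k j -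
        ∑ k ∈ lvl ι K, mat b a k j * wMat B b (expSeries ((ε : ℂ) • -a)) i k) ε := by
  have hR := expSeries_smul_neg_mem hB ha (ε : ℂ)
  change HasDerivAt (fun e : ℝ => ∑ s ∈ range (i.2 + 1), (-1 : ℂ) ^ (i.2 - s) *
    B (PowerSeries.coeff s (expSeries ((e : ℂ) • -a)) (b i.1))
      (PowerSeries.coeff (i.2 + j.2 + 1 - s) (expSeries ((e : ℂ) • -a)) (b j.1))) _ ε
  refine (HasDerivAt.fun_sum fun s _ => (hasDerivAt_bilin_expSeries b B ha.1 s
    (i.2 + j.2 + 1 - s) (b i.1) (b j.1) ε).const_mul ((-1 : ℂ) ^ (i.2 - s))).congr_deriv ?_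
  set R := expSeries ((ε : ℂ) • -a)
  have hlin : ∀ (l : ℕ) (w : H), ∃ f : ℕ → H →ₗ[ℂ] ℂ, ∀ k v, f k v = wVec B R k l v w :=
    fun l w => ⟨fun k => ∑ s ∈ range (k + 1), (-1 : ℂ) ^ (k - s) •
      (LinearMap.flip B (PowerSeries.coeff (k + l + 1 - s) R w) ∘ₗ PowerSeries.coeff s R),
      fun k v => by simp [wVec, LinearMap.sum_apply]⟩
  have hsum : ∀ {i : ι × ℕ} (_ : i.2 < K) (l : ℕ) (w : H),
      ∑ k ∈ lvl ι K, mat b a k i * wVec B R k.2 l (b k.1) w =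
        ∑ r ∈ range (i.2 + 1), wVec B R (i.2 - r) l (PowerSeries.coeff r a (b i.1)) w :=
    fun {i} hi l w => by
      obtain ⟨f, hf⟩ := hlin l w
      have := sum_mat_smul b a f i hi
      simpa only [hf, smul_eq_mul] using this
  have h1 := hsum hi j.2 (b j.1)
  have h2 := hsum hj i.2 (b i.1)
  have h3 : ∀ k, wMat B b R i k = wVec B R k.2 i.2 (b k.1) (b i.1) := fun k =>
    wVec_symm hsymm hB hR _ _ _ _
  have h4 := sum_wVec_left B R a i.2 j.2 (b i.1) (b j.1)
  have h5 := sum_wVec_right a i.2 j.2 (b i.1) (b j.1) hsymm hB hR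
  have h6 : hMat B b a i j =
      -((-1) ^ i.2 * B (b i.1) (PowerSeries.coeff (i.2 + j.2 + 1) a (b j.1))) := by
    rw [hMat, bilin_coeff_lowerAlgebra hsymm hB ha, ← mul_assoc, ← pow_add,
      show j.2 + 1 + (i.2 + j.2 + 1 + 1) = 2 * (j.2 + 1) + (i.2 + 1) by ring, pow_add _ (2 * _),
      pow_mul, pow_succ _ i.2]
    norm_num
  simp only [h3]
  simp only [wMat]
  rw [h1, h2, h4, h6]
  simp only [wVec_symm hsymm hB hR i.2] at h5
  simp only [mul_neg, mul_add, sum_neg_distrib, sum_add_distrib]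
  rw [h5]
  ring

/-- The flow of the quantized Hamiltonian. -/
def quantFlow (B : LinearMap.BilinForm ℂ H) (b : Module.Basis ι ℂ H) (one u : H)
    (a : PowerSeries (Module.End ℂ H)) (f : HbarSeries ι) (ε : ℝ) : HbarSeries ι :=
  f.map (substAlgHom (hasSubst_linSub (isLow_mat b (expSeries ((ε : ℂ) • -a))))) +
    HahnSeries.single (-1) (quad (wMat B b (expSeries ((ε : ℂ) • -a)))
      (basePt b one (u - (ε : ℂ) • PowerSeries.coeff 1 a one)))

omit [FiniteDimensional ℂ H] in
theorem coeff_quantFlow (one u : H) (a : PowerSeries (Module.End ℂ H)) (f : HbarSeries ι)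
    (ε : ℝ) (n : ℤ) : (quantFlow B b one u a f ε).coeff n =
      subst (linSub (mat b (expSeries ((ε : ℂ) • -a)))) (f.coeff n) +
        if n = -1 then quad (wMat B b (expSeries ((ε : ℂ) • -a)))
          (basePt b one (u - (ε : ℂ) • PowerSeries.coeff 1 a one)) else 0 := by
  rw [quantFlow, HahnSeries.coeff_add, HahnSeries.map_coeff, HahnSeries.coeff_single,
    substAlgHom_apply]
  split_ifs <;> rfl

omit [FiniteDimensional ℂ H] in
theorem quantFlow_zero (one u : H) (a : PowerSeries (Module.End ℂ H)) (f : HbarSeries ι) :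
    quantFlow B b one u a f 0 = f := by
  have h1 : linSub (mat b (1 : PowerSeries (Module.End ℂ H))) = X := by
    funext j
    ext m
    rw [linSub, coeff_linForm (s := insert j m.support) _ (subset_insert _ _)]
    simp [mat_one]
  have h2 : ∀ x : ι × ℕ → ℂ, quad (wMat B b (1 : PowerSeries (Module.End ℂ H))) x = 0 := fun x => by
    ext m
    change coeff m (C (1 / 2) * ∑ i ∈ lvl ι 2 ∪ m.support, ∑ j ∈ lvl ι 2 ∪ m.support,
      C (wVec B 1 i.2 j.2 (b i.1) (b j.1)) * (qVar x i * qVar x j)) = _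
    simp [wVec_one]
  ext1
  funext n
  rw [coeff_quantFlow, Complex.ofReal_zero, zero_smul, expSeries_zero, h1, h2, subst_self, ite_self,
    add_zero]
  rfl

include hsymm ha in
theorem isQuantumFlow_quantFlow (one u : H) {f : HbarSeries ι} (hf : IsLogPotential f) :
    IsQuantumFlow B b one u a (quantFlow B b one u a f) := by
  intro ε
  have hS : ∀ e : ℝ, IsLow (mat b (expSeries ((e : ℂ) • -a))) := fun e => isLow_mat b _
  refine ⟨fun n hn => ?_, fun n m => ?_⟩
  · rw [coeff_quantFlow, hf n hn, if_neg (by omega), add_zero, ← substAlgHom_apply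
      (hasSubst_linSub (hS ε)), map_zero]
  · refine HasDerivAt.congr_deriv ?_ (quantHam_add hsymm hB b ha rfl _ n m).symm
    have h1 := hasCoeffDerivAt_subst (isLow_mat b a) hS (hasDerivAt_mat_expSeries b ha.1 · · ε)
      (f.coeff n)
    simp only [coeff_quantFlow]
    -- The quadratic part of the solution lives in ħ⁻¹ alone; all other powers of ħ only undergo the
    -- substitution.
    by_cases hn : n = -1
    · have h2 := hasCoeffDerivAt_quad (isLow_mat b a) (h := hMat B b a)
        (w := fun e : ℝ => wMat B b (expSeries ((e : ℂ) • -a)))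
        (x := fun e : ℝ => basePt b one (u - (e : ℂ) • PowerSeries.coeff 1 a one)) (ε := ε)
        (wMat_symm b hsymm hB (expSeries_smul_neg_mem hB ha _))
        (fun e i hi => basePt_eq_zero b one _ hi)
        (fun K i j hi hj => hasDerivAt_wMat_expSeries hsymm hB b ha hi hj ε)
        (fun K hK j => by
          rw [sum_mat_basePt b a one _ j hK, ha.1]
          simp only [basePt]
          split_ifs
          · have : HasDerivAt (fun e : ℝ => (e : ℂ) * b.repr (PowerSeries.coeff 1 a one) j.1)
                (1 * b.repr (PowerSeries.coeff 1 a one) j.1) ε :=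
              ((hasDerivAt_id (ε : ℂ)).comp_ofReal).mul_const _
            refine ((this.const_sub (b.repr u j.1)).congr_deriv ?_).congr_of_eventuallyEq ?_
            · simp
            · exact Filter.Eventually.of_forall fun e => by
                simp only [map_sub, map_smul, Finsupp.sub_apply, Finsupp.smul_apply, smul_eq_mul]
          · simpa using hasDerivAt_const ε (-(b.repr one j.1))
          · exact hasDerivAt_const _ _)
      simp only [hn, if_true] at h1 ⊢
      refine ((h1.add h2) m).congr_deriv ?_
      rw [flowOp_add (isLow_mat b a)]
      simp only [map_add, map_sub, map_neg]
      ring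
    · simp only [hn, if_false, add_zero, zero_sub]
      exact h1 m

include hsymm ha in
-- The equation is affine, so the difference of two solutions satisfies the homogeneous flow, which
-- is strictly triangular because a has no constant term.
theorem IsQuantumFlow.unique {one u : H} {γ γ' : ℝ → HbarSeries ι}
    (h : IsQuantumFlow B b one u a γ) (h' : IsQuantumFlow B b one u a γ') (h0 : γ 0 = γ' 0) :
    γ = γ' := by
  funext ε
  ext1
  funext n
  have hA : ∀ j i : ι × ℕ, i.2 ≤ j.2 → mat b a j i = 0 := fun j i hij => by
    rw [mat]
    split_ifs with hji
    · rw [Nat.sub_eq_zero_of_le hij, ha.1]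
      simp
    · rfl
  have key := eq_zero_of_flow hA (Y := fun e => (γ e).coeff n + -(γ' e).coeff n)
    (fun e m => by
      simp only [map_add, map_neg]
      refine (((h e).2 n m).fun_add ((h' e).2 n m).fun_neg).congr_deriv ?_
      rw [quantHam_add hsymm hB b ha rfl, quantHam_add hsymm hB b ha rfl,
        flowOp_add (isLow_mat b a), flowOp_neg (isLow_mat b a)]
      simp only [map_add, map_neg]
      ring) (by simp only [h0, add_neg_cancel]) ε
  exact add_neg_eq_zero.1 key

include hsymm in
/-- The explicit form of the quantized action. -/
theorem quantumAction_iff (ha : a ∈ lowerAlgebra B hB) {one u : H} {f f' : HbarSeries ι}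
    (hf : IsLogPotential f) : QuantumAction B hB b one u (expSeries a) f f' ↔
      f' = quantFlow B b one u a f 1 := by
  constructor
  · rintro ⟨a', ha', haa, γ, hγ, hγ0, rfl⟩
    obtain rfl : a' = a := expSeries_injOn ha'.1 ha.1 haa
    rw [IsQuantumFlow.unique hsymm hB b ha hγ (isQuantumFlow_quantFlow hsymm hB b ha one u hf)
      (by rw [hγ0, quantFlow_zero])]
  · rintro rfl
    exact ⟨a, ha, rfl, _, isQuantumFlow_quantFlow hsymm hB b ha one u hf,
      quantFlow_zero b one u a f, rfl⟩

omit [FiniteDimensional ℂ H] in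
theorem genusPart_quantFlow (one u : H) (f : HbarSeries ι) :
    genusPart (quantFlow B b one u a f 1) 0 = transform B b (expSeries (-a))
      (basePt b one (u - PowerSeries.coeff 1 a one)) (genusPart f 0) := by
  rw [genusPart, genusPart, coeff_quantFlow, transform]
  simp

end Existence

end

end GenusZero

end

theorem mainTheorem3 {ι H : Type*} [Fintype ι] [DecidableEq ι] [AddCommGroup H] [Module ℂ H]
    [FiniteDimensional ℂ H] (B : LinearMap.BilinForm ℂ H) (hsymm : B.IsSymm)
    (hB : B.Nondegenerate) (b : Module.Basis ι ℂ H) (one : H) (hone : one ≠ 0)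
    (u : H) (S : PowerSeries (Module.End ℂ H)) (hS : S ∈ GenusZero.lowerGroup B hB)
    (F : MvPowerSeries (ι × ℕ) ℂ) (hF : F ∈ GenusZero.GW0 B b one u) :
    (∃! F' : MvPowerSeries (ι × ℕ) ℂ, GenusZero.ConeAction B b one u S F F') ∧
    ∀ f : GenusZero.HbarSeries ι, GenusZero.IsLogPotential f → GenusZero.genusPart f 0 = F →
      (∃! f' : GenusZero.HbarSeries ι, GenusZero.QuantumAction B hB b one u S f f') ∧
      ∀ f' : GenusZero.HbarSeries ι, GenusZero.QuantumAction B hB b one u S f f' →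
        ∀ F' : MvPowerSeries (ι × ℕ) ℂ,
          GenusZero.ConeAction B b one u S F F' ↔ GenusZero.genusPart f' 0 = F' := by
  -- With S = exp(a), the inverse S*(-z) is exp(-a), the same series that governs the quantum flow
  -- at time one. The two explicit formulas then coincide.
  obtain ⟨a, ⟨ha, rfl⟩, -⟩ := GenusZero.existsUnique_expSeries_eq B hB hS
  have hadj := GenusZero.adjNeg_expSeries_of_mem B hB ha
  have hcone := GenusZero.coneAction_transform hsymm hB b (one := one) (u := u) hS
    (by
      rw [hadj]
      exact GenusZero.expSeries_mem_lowerGroup B hB (GenusZero.neg_mem_lowerAlgebra B hB ha))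
    (by rw [hadj, GenusZero.expSeries_mul_expSeries_neg ha.1]) hF
  refine ⟨⟨_, hcone, fun F' h => h.unique hB b hcone⟩, fun f hf hfF => ?_⟩
  have hiff : ∀ f', GenusZero.QuantumAction B hB b one u (GenusZero.expSeries a) f f' ↔ _ :=
    fun f' => GenusZero.quantumAction_iff hsymm hB b ha hf
  refine ⟨⟨_, (hiff _).2 rfl, fun f' h => (hiff f').1 h⟩, fun f' h F' => ?_⟩
  rw [hadj, GenusZero.coeff_one_expSeries, ← hfF, ← GenusZero.genusPart_quantFlow] at hcone
  rw [(hiff f').1 h]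
  refine ⟨fun h' => hcone.unique hB b (hfF ▸ h'), ?_⟩
  rintro rfl
  exact hfF ▸ hcone
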